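/- All rings are commutative with identity. For a ring $R$ and a nonnegative integer $n$, an $R$-module $M$ is called strongly $n$-Gorenstein projective if there is a short exact sequence $0\to M\to P\to M\to 0$ with $\mathrm{pd}_R(P)\le n$, and $\mathrm{Ext}_R^{n+1}(M,Q)=0$ for every projective $R$-module $Q$; it is called strongly $n$-Gorenstein flat if there is a short exact sequence $0\to M\to F\to M\to 0$ with $\mathrm{fd}_R(F)\le n$, and $\mathrm{Tor}^R_{n+1}(M,I)=0$ for every injective $R$-module $I$. The ring $R$ is called $n$-SG (respectively, $n$-wSG) if every $R$-module is strongly $n$-Gorenstein projective (respectively, strongly $n$-Gorenstein flat). An $R$-module is Gorenstein flat if it is isomorphic to $\mathrm{Im}(F_0\to F^0)$ for some exact sequence $\cdots\to F_1\to F_0\to F^0\to F^1\to\cdots$ of flat $R$-modules that remains exact after applying $-\otimes_R I$ for every injective $R$-module $I$; the Gorenstein flat dimension $\mathrm{Gfd}_R(M)$ is the least length of a resolution of $M$ by Gorenstein flat modules ($\infty$ if there is none), and $\mathrm{wGgldim}(R)=\sup\{\mathrm{Gfd}_R(M) : M \text{ an } R\text{-module}\}$. As usual, $\mathrm{gldim}$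 and $\mathrm{wdim}$ denote the global and the weak global dimension. Let $K$ be a field, and set $R_1=K[X]/(X^2)$ and $R_2=K[X]/(X^3)$. Let $n\ge 0$ be an integer and let $S_n$ be a coherent ring with $\mathrm{wdim}(S_n)=n<\mathrm{gldim}(S_n)$. Then: 1. $R_1\times S_n$ is an $n$-wSG ring which is not an $n$-SG ring. 2. $\mathrm{wGgldim}(R_2\times S_n)=n$, but $R_2\times S_n$ is not an $n$-wSG ring. Such rings $S_n$ are obtained as follows: if $S_0$ is a non-Noetherian von Neumann regular ring, then for every $n\ge 0$ the polynomial ring $S_n=S_0[X_1,\dots,X_n]$ is coherent and satisfies $\mathrm{wdim}(S_n)=n<\mathrm{gldim}(S_n)$. -/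

import Mathlib

universe u

open CategoryTheory Polynomial

namespace SGRing

/-! ### Rings -/

/-- A commutative ring is coherent if each of its finitely generated ideals is finitely
presented. -/
def IsCoherentRing (R : Type u) [CommRing R] : Prop :=
  ∀ I : Ideal R, I.FG → Module.FinitePresentation R I

/-- A commutative ring is von Neumann regular if each element `a` can be written `a = a * x * a`. -/
def IsVonNeumannRegularRing (R : Type u) [CommRing R] : Prop :=
  ∀ a : R, ∃ x : R, a = a * x * a

/-- The ring `K[X] / (X ^ m)`. -/
abbrev TruncatedPoly (K : Type u) [Field K] (m : ℕ) : Type u :=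
  K[X] ⧸ Ideal.span {(X : K[X]) ^ m}

variable (R : Type u) [CommRing R]

/-! ### Dimensions given by resolutions -/

variable {R} in
/-- `HasResolutionOfLength 𝒳 n M`: there is an exact sequence `0 → G_n → ⋯ → G_1 → G_0 → M → 0`
with all `G_i` in the class `𝒳` of modules (which is meant to be closed under isomorphism and to
contain the zero module). It is built from its last map `G_0 → M` and a resolution of length
`n - 1` of the kernel of that map. -/
def HasResolutionOfLength (𝒳 : ModuleCat.{u} R → Prop) : ℕ → ModuleCat.{u} R → Prop
  | 0, M => 𝒳 M
  | n + 1, M => ∃ (G : ModuleCat.{u} R) (p : G →ₗ[R] M), 𝒳 G ∧ Function.Surjective p ∧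
      HasResolutionOfLength 𝒳 n (ModuleCat.of R (LinearMap.ker p))

variable {R} in
/-- The least length of a resolution of `M` by modules in `𝒳` (`⊤` if there is none). -/
noncomputable def resolutionDim (𝒳 : ModuleCat.{u} R → Prop) (M : ModuleCat.{u} R) : ℕ∞ :=
  ⨅ (n : ℕ) (_ : HasResolutionOfLength 𝒳 n M), (n : ℕ∞)

/-- `M` is a Gorenstein flat module: `M` is the image of `d 0` in an exact sequence
`⋯ → F (-1) → F 0 → F 1 → F 2 → ⋯` of flat modules that stays exact when it is tensored with any
injective module. -/
def IsGorensteinFlat (M : ModuleCat.{u} R) : Prop :=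
  ∃ (F : ℤ → ModuleCat.{u} R) (d : ∀ i : ℤ, F i →ₗ[R] F (i + 1)),
    (∀ i, Module.Flat R (F i)) ∧
    (∀ i, Function.Exact (d i) (d (i + 1))) ∧
    (∀ I : ModuleCat.{u} R, Module.Injective R I →
      ∀ i, Function.Exact ((d i).lTensor I) ((d (i + 1)).lTensor I)) ∧
    Nonempty (M ≃ₗ[R] LinearMap.range (d 0))

variable {R} in
/-- The flat dimension of a module. -/
noncomputable def flatDim (M : ModuleCat.{u} R) : ℕ∞ :=
  resolutionDim (fun G : ModuleCat.{u} R => Module.Flat R G) M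

variable {R} in
/-- The Gorenstein flat dimension of a module. -/
noncomputable def gorensteinFlatDim (M : ModuleCat.{u} R) : ℕ∞ :=
  resolutionDim (IsGorensteinFlat R) M

/-- The global dimension of a ring. Here the projective dimension is Mathlib's, so that the zero
module has projective dimension `⊥`. -/
noncomputable def gldim : WithBot ℕ∞ :=
  ⨆ M : ModuleCat.{u} R, projectiveDimension M

/-- The weak global dimension of a ring. -/
noncomputable def wdim : ℕ∞ :=
  ⨆ M : ModuleCat.{u} R, flatDim M

/-- The weak Gorenstein global dimension of a ring. -/
noncomputable def wGgldim : ℕ∞ :=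
  ⨆ M : ModuleCat.{u} R, gorensteinFlatDim M

/-! ### Strongly `n`-Gorenstein modules and rings -/

variable {R} in
/-- `M` is strongly `n`-Gorenstein projective: there is a short exact sequence
`0 → M → P → M → 0` with `pd P ≤ n`, and `Ext^{n+1}(M, Q) = 0` for all projective `Q`. -/
def IsStronglyGorensteinProjective (n : ℕ) (M : ModuleCat.{u} R) : Prop :=
  (∃ (P : ModuleCat.{u} R) (f : M →ₗ[R] P) (g : P →ₗ[R] M),
    Function.Injective f ∧ Function.Exact f g ∧ Function.Surjective g ∧
      projectiveDimension P ≤ (n : WithBot ℕ∞)) ∧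
  ∀ Q : ModuleCat.{u} R, Module.Projective R Q → Subsingleton (Abelian.Ext M Q (n + 1))

variable {R} in
/-- `M` is strongly `n`-Gorenstein flat: there is a short exact sequence
`0 → M → F → M → 0` with `fd F ≤ n`, and `Tor_{n+1}(M, I) = 0` for all injective `I`. -/
def IsStronglyGorensteinFlat (n : ℕ) (M : ModuleCat.{u} R) : Prop :=
  (∃ (F : ModuleCat.{u} R) (f : M →ₗ[R] F) (g : F →ₗ[R] M),
    Function.Injective f ∧ Function.Exact f g ∧ Function.Surjective g ∧
      flatDim F ≤ (n : ℕ∞)) ∧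
  ∀ I : ModuleCat.{u} R, Module.Injective R I →
    Limits.IsZero (((Tor (ModuleCat.{u} R) (n + 1)).obj M).obj I)

/-- `R` is an `n`-strongly Gorenstein ring (`n`-SG): every module is strongly `n`-Gorenstein
projective. -/
def IsSG (n : ℕ) : Prop :=
  ∀ M : ModuleCat.{u} R, IsStronglyGorensteinProjective n M

/-- `R` is a weakly `n`-strongly Gorenstein ring (`n`-wSG): every module is strongly
`n`-Gorenstein flat. -/
def IsWSG (n : ℕ) : Prop :=
  ∀ M : ModuleCat.{u} R, IsStronglyGorensteinFlat n M

end SGRing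

/-!
A module over `T × S` is the direct sum of a `T`-module and an `S`-module, so the first part of the
theorem is about the two factors.

*Positive claims.* Let `T = K[x] / (x ^ m)`. The map `y ↦ ∑ x ^ i ⊗ x ^ (m - 1 - i) y` embeds each
`T`-module `M` into the free module `T ⊗ M` over `T` (`IsTruncated.exists_free_injective`), so
injective modules over `T × S` have flat dimension at most `wdim S = n`, and `Tor_{n + 1}` against
them vanishes (`isZero_tor_of_flatDimLT`). For `m = 2` the cokernel of this embedding is `M` again,
by an involution of `M` that anticommutes with `x` (`IsTruncated.exists_isShortExact_self`); on
the other factor the split sequence `0 → N → N × N → N → 0` does, and `T × S` is `n`-wSG. For every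
`m`, a module over `T × S` whose component over `S` is flat is Gorenstein flat, because it has a
flat embedding and a flat cover whose cokernel and kernel are of the same kind. Conversely, the
component over `S` of a Gorenstein flat module is an `n`-th syzygy, hence flat. So `wGgldim (T × S)`
is `n` (`IsProductRing.wGgldim_eq`).

*Negative claims.* If `0 → M → P → M → 0` is exact, `P` is projective and `M` is flat, then `M` is
projective, by the theorem of Benson and Goodearl (`projective_of_isShortExact_self`): splicing
copies of the sequence gives a periodic complex of free modules that is contractible on finite sets
of basis elements, thus on countable subcomplexes, and the contractions are glued by Zorn's lemma.
Taking syzygies, an `n`-SG ring `T × S` has `gldim S ≤ n` (`IsProductRing.gldim_le_of_isSG`). For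
`m = 3`, put `a = (x, 0)` and `c = (x, 1)`; then `a` and `c ^ 2` generate each other's annihilator.
If `F` has finite flat dimension and is an extension of `R / (c)` by itself, then `c ^ 2` kills `F`,
so that `F = a F = a ^ 2 F ⊆ c ^ 2 F = 0`, which is absurd (`not_isWSG_of_exact`).

*Dimensions of polynomial rings.* The characteristic sequence `0 → M[X] → M[X] → M → 0` bounds
`wdim A[X]` by `wdim A + 1`. In the other direction, an `A`-module `M` killed by `X` is a direct
summand of `K / X K` for a syzygy `K` of `M` over `A[X]` (`exists_syzygy_retract`), so both the weak
and the global dimension of `A` are less than those of `A[X]`. Over a von Neumann regular ring all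
modules are flat, and if all modules are projective then the ring is Noetherian.

*Coherence.* The syzygies of polynomials over a von Neumann regular ring `A` have to be finitely
generated. The coefficients lie in a Noetherian subring `A₀`. Near a maximal ideal `𝔪` of `A`, the
subring acts through the domain `D = A₀ / (𝔪 ∩ A₀)`, and any given nonzero element of `D` may be
assumed to be invertible. By generic flatness (`genericallyFlat_mvPolynomial`), the syzygies over
`D` generate those over `A` on a neighbourhood of `𝔪`
(`IsVonNeumannRegularRing.exists_notMem_smul_mem`), and the elements of `A` that multiply the
syzygies into a finitely generated submodule form an ideal, which therefore contains `1`.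
-/

namespace SGRing

/-! ### Homological dimensions -/

section ShortExact

variable {R : Type u} [CommRing R] {A B C : Type u} [AddCommGroup A] [AddCommGroup B]
  [AddCommGroup C] [Module R A] [Module R B] [Module R C]

/-- `0 → A → B → C → 0` is a short exact sequence of modules. -/
structure IsShortExact (f : A →ₗ[R] B) (g : B →ₗ[R] C) : Prop where
  inj : Function.Injective f
  exact : Function.Exact f g
  surj : Function.Surjective g

theorem IsShortExact.of_surjective {g : B →ₗ[R] C} (hg : Function.Surjective g) :
    IsShortExact (LinearMap.ker g).subtype g :=
  ⟨Subtype.val_injective, LinearMap.exact_subtype_ker_map g, hg⟩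

theorem isShortExact_prod : IsShortExact (LinearMap.inl R A B) (LinearMap.snd R A B) :=
  ⟨LinearMap.inl_injective, .inl_snd, LinearMap.snd_surjective⟩

theorem IsShortExact.shortExact {f : A →ₗ[R] B} {g : B →ₗ[R] C} (h : IsShortExact f g) :
    (ShortComplex.moduleCatMk f g h.exact.linearMap_comp_eq_zero).ShortExact :=
  ModuleCat.shortComplex_shortExact _ h.exact h.inj h.surj

/-- The kernel of the second map is the first module. -/
noncomputable def IsShortExact.kerEquiv {f : A →ₗ[R] B} {g : B →ₗ[R] C} (h : IsShortExact f g) :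
    LinearMap.ker g ≃ₗ[R] A :=
  ((LinearEquiv.ofInjective f h.inj).trans
    (LinearEquiv.ofEq _ _ (LinearMap.exact_iff.1 h.exact).symm)).symm

/-- Passing to character modules reverses a short exact sequence. -/
theorem IsShortExact.dual {f : A →ₗ[R] B} {g : B →ₗ[R] C} (h : IsShortExact f g) :
    IsShortExact (CharacterModule.dual g) (CharacterModule.dual f) := by
  refine ⟨CharacterModule.dual_injective_of_surjective g h.surj, ?_,
    CharacterModule.dual_surjective_of_injective f h.inj⟩
  intro c
  constructor
  · intro hc
    have hc' : ∀ a, c (f a) = 0 := fun a => DFunLike.congr_fun hc a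
    have hk : LinearMap.ker g.toAddMonoidHom.toIntLinearMap ≤
        LinearMap.ker (AddMonoidHom.toIntLinearMap (c : B →+ AddCircle (1 : ℚ))) := by
      intro b hb
      obtain ⟨a, rfl⟩ := (h.exact b).1 hb
      exact hc' a
    let g' : B →ₗ[ℤ] C := g.toAddMonoidHom.toIntLinearMap
    let e := g'.quotKerEquivOfSurjective h.surj
    refine ⟨(((LinearMap.ker g').liftQ _ hk).comp e.symm.toLinearMap).toAddMonoidHom, ?_⟩
    refine DFunLike.ext _ _ fun b => ?_
    change (LinearMap.ker g').liftQ _ hk (e.symm (g' b)) = c b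
    have : e.symm (g' b) = Submodule.Quotient.mk b := by
      rw [LinearEquiv.symm_apply_eq]; rfl
    rw [this]
    rfl
  · rintro ⟨d, rfl⟩
    refine DFunLike.ext _ _ fun a => ?_
    change d (g (f a)) = 0
    rw [h.exact.apply_apply_eq_zero, map_zero]

end ShortExact

section Dim

variable (R : Type u) [CommRing R] (M : Type u) [AddCommGroup M] [Module R M]

/-- The flat dimension of `M` is less than `n`. This is expressed by the injective dimension of the
character module, for which the long exact sequences are available. -/
def FlatDimLT (n : ℕ) : Prop :=
  HasInjectiveDimensionLT (ModuleCat.of R (CharacterModule M)) n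

/-- The projective dimension of `M` is less than `n`. -/
def ProjDimLT (n : ℕ) : Prop :=
  HasProjectiveDimensionLT (ModuleCat.of R M) n

theorem flatDimLT_one_iff : FlatDimLT R M 1 ↔ Module.Flat R M := by
  rw [FlatDimLT, ← injective_iff_hasInjectiveDimensionLT_one,
    ← Module.injective_iff_injective_object, Module.Flat.iff_characterModule_injective]

theorem projDimLT_one_iff : ProjDimLT R M 1 ↔ Module.Projective R M := by
  rw [ProjDimLT, ← projective_iff_hasProjectiveDimensionLT_one, ← IsProjective.iff_projective]

variable {R M}

theorem FlatDimLT.mono {m n : ℕ} (h : FlatDimLT R M m) (hmn : m ≤ n) : FlatDimLT R M n :=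
  have : HasInjectiveDimensionLT (ModuleCat.of R (CharacterModule M)) m := h
  hasInjectiveDimensionLT_of_ge _ m n hmn

theorem ProjDimLT.mono {m n : ℕ} (h : ProjDimLT R M m) (hmn : m ≤ n) : ProjDimLT R M n :=
  have : HasProjectiveDimensionLT (ModuleCat.of R M) m := h
  hasProjectiveDimensionLT_of_ge _ m n hmn

theorem FlatDimLT.of_flat [Module.Flat R M] (n : ℕ) : FlatDimLT R M (n + 1) :=
  ((flatDimLT_one_iff R M).2 inferInstance).mono (by lia)

theorem ProjDimLT.of_projective [Module.Projective R M] (n : ℕ) : ProjDimLT R M (n + 1) :=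
  ((projDimLT_one_iff R M).2 inferInstance).mono (by lia)

variable {A B C : Type u} [AddCommGroup A] [AddCommGroup B]
  [AddCommGroup C] [Module R A] [Module R B] [Module R C]

theorem FlatDimLT.of_retract {n : ℕ} (h : FlatDimLT R B n) (i : A →ₗ[R] B) (r : B →ₗ[R] A)
    (hri : r ∘ₗ i = LinearMap.id) : FlatDimLT R A n := by
  have : HasInjectiveDimensionLT (ModuleCat.of R (CharacterModule B)) n := h
  refine Retract.hasInjectiveDimensionLT (X := ModuleCat.of R (CharacterModule A))
    (Y := ModuleCat.of R (CharacterModule B))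
    ⟨ModuleCat.ofHom (CharacterModule.dual r), ModuleCat.ofHom (CharacterModule.dual i), ?_⟩ n
  rw [← ModuleCat.ofHom_comp, ← CharacterModule.dual_comp, hri]
  rfl

theorem ProjDimLT.of_retract {n : ℕ} (h : ProjDimLT R B n) (i : A →ₗ[R] B) (r : B →ₗ[R] A)
    (hri : r ∘ₗ i = LinearMap.id) : ProjDimLT R A n := by
  have : HasProjectiveDimensionLT (ModuleCat.of R B) n := h
  refine Retract.hasProjectiveDimensionLT (X := ModuleCat.of R A) (Y := ModuleCat.of R B)
    ⟨ModuleCat.ofHom i, ModuleCat.ofHom r, ?_⟩ n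
  rw [← ModuleCat.ofHom_comp, hri]
  rfl

theorem FlatDimLT.of_equiv {n : ℕ} (h : FlatDimLT R B n) (e : A ≃ₗ[R] B) : FlatDimLT R A n :=
  h.of_retract e.toLinearMap e.symm.toLinearMap (by ext; simp)

theorem ProjDimLT.of_equiv {n : ℕ} (h : ProjDimLT R B n) (e : A ≃ₗ[R] B) : ProjDimLT R A n :=
  h.of_retract e.toLinearMap e.symm.toLinearMap (by ext; simp)

namespace IsShortExact

variable {f : A →ₗ[R] B} {g : B →ₗ[R] C} (h : IsShortExact f g) {n : ℕ}
include h

theorem flatDimLT_mid (hA : FlatDimLT R A n) (hC : FlatDimLT R C n) : FlatDimLT R B n :=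
  h.dual.shortExact.hasInjectiveDimensionLT_X₂ n hC hA

theorem flatDimLT_right (hA : FlatDimLT R A n) (hB : FlatDimLT R B (n + 1)) :
    FlatDimLT R C (n + 1) :=
  h.dual.shortExact.hasInjectiveDimensionLT_X₁ n hA hB

theorem flatDimLT_left (hB : FlatDimLT R B n) (hC : FlatDimLT R C (n + 1)) :
    FlatDimLT R A n :=
  h.dual.shortExact.hasInjectiveDimensionLT_X₃ n hB hC

theorem projDimLT_right (hA : ProjDimLT R A n) (hB : ProjDimLT R B (n + 1)) :
    ProjDimLT R C (n + 1) :=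
  h.shortExact.hasProjectiveDimensionLT_X₃ n hA hB

theorem projDimLT_left (hB : ProjDimLT R B n) (hC : ProjDimLT R C (n + 1)) :
    ProjDimLT R A n :=
  h.shortExact.hasProjectiveDimensionLT_X₁ n hB hC

end IsShortExact

theorem FlatDimLT.prod {n : ℕ} (hA : FlatDimLT R A n) (hB : FlatDimLT R B n) :
    FlatDimLT R (A × B) n :=
  isShortExact_prod.flatDimLT_mid hA hB

end Dim

section Resolution

variable {R : Type u} [CommRing R]

theorem exists_free_surjective (M : Type u) [AddCommGroup M] [Module R M] :
    ∃ (L : Type u) (_ : AddCommGroup L) (_ : Module R L) (p : L →ₗ[R] M),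
      Module.Free R L ∧ Function.Surjective p :=
  ⟨M →₀ R, inferInstance, inferInstance, Finsupp.linearCombination R id, inferInstance,
    Finsupp.linearCombination_id_surjective R M⟩

/-- The flat dimension defined by resolutions agrees with the one defined by character modules. -/
theorem hasResolutionOfLength_flat_iff {n : ℕ} (M : ModuleCat.{u} R) :
    HasResolutionOfLength (fun G : ModuleCat.{u} R => Module.Flat R G) n M ↔
      FlatDimLT R M (n + 1) := by
  induction n generalizing M with
  | zero => exact (flatDimLT_one_iff R M).symm
  | succ n ih =>
    constructor
    · rintro ⟨G, p, hG, hp, hK⟩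
      exact (IsShortExact.of_surjective hp).flatDimLT_right ((ih _).1 hK) (.of_flat _)
    · intro h
      obtain ⟨L, _, _, p, _, hp⟩ := exists_free_surjective (R := R) M
      exact ⟨ModuleCat.of R L, p, inferInstanceAs (Module.Flat R L), hp,
        (ih _).2 ((IsShortExact.of_surjective hp).flatDimLT_left (.of_flat _) h)⟩

theorem resolutionDim_le_iff {𝒳 : ModuleCat.{u} R → Prop} {n : ℕ} {M : ModuleCat.{u} R} :
    resolutionDim 𝒳 M ≤ n ↔ ∃ k ≤ n, HasResolutionOfLength 𝒳 k M := by
  constructor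
  · intro h
    by_contra! hk
    have h' : ((n + 1 : ℕ) : ℕ∞) ≤ resolutionDim 𝒳 M := by
      refine le_iInf₂ fun k hk' => ?_
      by_contra! hlt
      exact hk k (by have := Nat.cast_lt.1 hlt; lia) hk'
    exact absurd (Nat.cast_le.1 (h'.trans h)) (by lia)
  · rintro ⟨k, hk, h⟩
    exact (iInf₂_le k h).trans (Nat.cast_le.2 hk)

theorem flatDim_le_iff {n : ℕ} {M : ModuleCat.{u} R} : flatDim M ≤ n ↔ FlatDimLT R M (n + 1) := by
  rw [flatDim, resolutionDim_le_iff]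
  constructor
  · rintro ⟨k, hk, h⟩
    exact ((hasResolutionOfLength_flat_iff M).1 h).mono (by lia)
  · exact fun h => ⟨n, le_rfl, (hasResolutionOfLength_flat_iff M).2 h⟩

theorem wdim_le_iff {n : ℕ} :
    wdim R ≤ n ↔ ∀ (M : Type u) [AddCommGroup M] [Module R M], FlatDimLT R M (n + 1) := by
  simp only [wdim, iSup_le_iff, flatDim_le_iff]
  exact ⟨fun h M _ _ => h (ModuleCat.of R M), fun h M => h M⟩

theorem gldim_le_iff {n : ℕ} :
    gldim R ≤ (n : WithBot ℕ∞) ↔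
      ∀ (M : Type u) [AddCommGroup M] [Module R M], ProjDimLT R M (n + 1) := by
  simp only [gldim, iSup_le_iff]
  exact ⟨fun h M _ _ => (projectiveDimension_le_iff _ n).1 (h (ModuleCat.of R M)),
    fun h M => (projectiveDimension_le_iff _ n).2 (h M)⟩

end Resolution

/-! ### Base change and product rings -/

open TensorProduct

section BaseChange

variable {R : Type u} [CommRing R] (S : Type u) [CommRing S] [Algebra R S]
  {A B C : Type u} [AddCommGroup A] [AddCommGroup B]
  [AddCommGroup C] [Module R A] [Module R B] [Module R C]

theorem IsShortExact.baseChange_of_injective {f : A →ₗ[R] B} {g : B →ₗ[R] C}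
    (h : IsShortExact f g) (hf : Function.Injective (f.lTensor S)) :
    IsShortExact (f.baseChange S) (g.baseChange S) :=
  ⟨hf, lTensor_exact S h.exact h.surj, LinearMap.lTensor_surjective S h.surj⟩

theorem IsShortExact.baseChange [Module.Flat R S] {f : A →ₗ[R] B} {g : B →ₗ[R] C}
    (h : IsShortExact f g) : IsShortExact (f.baseChange S) (g.baseChange S) :=
  h.baseChange_of_injective S (Module.Flat.lTensor_preserves_injective_linearMap f h.inj)

/-- Base change does not increase the flat dimension of the modules of a class `𝒜` that is closed
under syzygies and whose members are acyclic for the base change. -/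
theorem FlatDimLT.baseChange_of_acyclic {𝒜 : ModuleCat.{u} R → Prop}
    (h𝒜 : ∀ (L M : Type u) [AddCommGroup L] [Module R L] [AddCommGroup M] [Module R M]
      (p : L →ₗ[R] M), Module.Free R L → Function.Surjective p → 𝒜 (ModuleCat.of R M) →
        𝒜 (ModuleCat.of R (LinearMap.ker p)) ∧
          Function.Injective ((LinearMap.ker p).subtype.lTensor S))
    {n : ℕ} {M : Type u} [AddCommGroup M] [Module R M] (hM : 𝒜 (ModuleCat.of R M))
    (h : FlatDimLT R M (n + 1)) : FlatDimLT S (S ⊗[R] M) (n + 1) := by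
  induction n generalizing M with
  | zero =>
    have := (flatDimLT_one_iff R M).1 h
    exact .of_flat _
  | succ n ih =>
    obtain ⟨L, _, _, p, hL, hp⟩ := exists_free_surjective (R := R) M
    obtain ⟨h1, h2⟩ := h𝒜 L M p hL hp hM
    have hs := IsShortExact.of_surjective hp
    exact (hs.baseChange_of_injective S h2).flatDimLT_right
      (ih h1 (hs.flatDimLT_left (.of_flat _) h)) (.of_flat _)

/-- Base change does not increase the projective dimension of the modules of a class `𝒜` that is
closed under syzygies and whose members are acyclic for the base change. -/
theorem ProjDimLT.baseChange_of_acyclic {𝒜 : ModuleCat.{u} R → Prop}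
    (h𝒜 : ∀ (L M : Type u) [AddCommGroup L] [Module R L] [AddCommGroup M] [Module R M]
      (p : L →ₗ[R] M), Module.Free R L → Function.Surjective p → 𝒜 (ModuleCat.of R M) →
        𝒜 (ModuleCat.of R (LinearMap.ker p)) ∧
          Function.Injective ((LinearMap.ker p).subtype.lTensor S))
    {n : ℕ} {M : Type u} [AddCommGroup M] [Module R M] (hM : 𝒜 (ModuleCat.of R M))
    (h : ProjDimLT R M (n + 1)) : ProjDimLT S (S ⊗[R] M) (n + 1) := by
  induction n generalizing M with
  | zero =>
    have := (projDimLT_one_iff R M).1 h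
    exact .of_projective _
  | succ n ih =>
    obtain ⟨L, _, _, p, hL, hp⟩ := exists_free_surjective (R := R) M
    obtain ⟨h1, h2⟩ := h𝒜 L M p hL hp hM
    have hs := IsShortExact.of_surjective hp
    exact (hs.baseChange_of_injective S h2).projDimLT_right
      (ih h1 (hs.projDimLT_left (.of_projective _) h)) (.of_projective _)

theorem FlatDimLT.baseChange [Module.Flat R S] {n : ℕ} {M : Type u} [AddCommGroup M] [Module R M]
    (h : FlatDimLT R M (n + 1)) : FlatDimLT S (S ⊗[R] M) (n + 1) :=
  h.baseChange_of_acyclic S (𝒜 := fun _ => True)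
    (fun _ _ _ _ _ _ _ _ _ _ => ⟨trivial,
      Module.Flat.lTensor_preserves_injective_linearMap _ Subtype.val_injective⟩) trivial

theorem ProjDimLT.baseChange [Module.Flat R S] {n : ℕ} {M : Type u} [AddCommGroup M] [Module R M]
    (h : ProjDimLT R M (n + 1)) : ProjDimLT S (S ⊗[R] M) (n + 1) :=
  h.baseChange_of_acyclic S (𝒜 := fun _ => True)
    (fun _ _ _ _ _ _ _ _ _ _ => ⟨trivial,
      Module.Flat.lTensor_preserves_injective_linearMap _ Subtype.val_injective⟩) trivial

variable {S} in
theorem FlatDimLT.restrictScalars [Module.Flat R S] {n : ℕ} {M : Type u} [AddCommGroup M]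
    [Module R M] [Module S M] [IsScalarTower R S M]
    (h : FlatDimLT S M (n + 1)) : FlatDimLT R M (n + 1) := by
  induction n generalizing M with
  | zero =>
    have := (flatDimLT_one_iff S M).1 h
    exact (flatDimLT_one_iff R M).2 (Module.Flat.trans R S M)
  | succ n ih =>
    let p := Finsupp.linearCombination S (id : M → M)
    have hp : Function.Surjective p := Finsupp.linearCombination_id_surjective S M
    have hs := IsShortExact.of_surjective hp
    have hL : Module.Flat R (M →₀ S) := Module.Flat.trans R S _
    have hs' : IsShortExact (A := LinearMap.ker p) (B := M →₀ S)
        ((LinearMap.ker p).subtype.restrictScalars R) (p.restrictScalars R) := by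
      refine ⟨hs.inj, fun x => ?_, hs.surj⟩
      exact hs.exact x
    exact hs'.flatDimLT_right (ih (hs.flatDimLT_left (.of_flat _) h)) (.of_flat _)

end BaseChange

section Surjective

variable {R T : Type u} [CommRing R] [CommRing T] [Algebra R T]

/-- Base change along a surjective ring map does not alter the modules over the target. -/
noncomputable def baseChangeEquivOfSurjective (h : Function.Surjective (algebraMap R T))
    (M : Type u) [AddCommGroup M] [Module R M] [Module T M] [IsScalarTower R T M] :
    (T ⊗[R] M) ≃ₗ[T] M :=
  LinearEquiv.ofLinearMap
    (TensorProduct.AlgebraTensorModule.lift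
      (LinearMap.toSpanSingleton T (M →ₗ[R] M) LinearMap.id))
    { toFun := fun m => 1 ⊗ₜ m
      map_add' := fun m m' => TensorProduct.tmul_add _ _ _
      map_smul' := fun t m => by
        obtain ⟨r, rfl⟩ := h t
        simp [← Algebra.algebraMap_eq_smul_one, TensorProduct.smul_tmul'] }
    (by ext; simp)
    (by
      ext m
      simp)

theorem baseChangeEquivOfSurjective_tmul (h : Function.Surjective (algebraMap R T))
    (M : Type u) [AddCommGroup M] [Module R M] [Module T M] [IsScalarTower R T M] (t : T) (m : M) :
    baseChangeEquivOfSurjective h M (t ⊗ₜ m) = t • m := by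
  simp [baseChangeEquivOfSurjective]

end Surjective

section Product

variable {R T S : Type u} [CommRing R] [CommRing T] [CommRing S] [Algebra R T] [Algebra R S]

variable (R T S) in
/-- The ring `R` is the product of the rings `T` and `S`, by means of its algebra maps. -/
def IsProductRing : Prop :=
  Function.Bijective fun r : R => (algebraMap R T r, algebraMap R S r)

variable (h : IsProductRing R T S)

theorem IsProductRing.symm (h : IsProductRing R T S) : IsProductRing R S T :=
  (Equiv.prodComm T S).bijective.comp h

include h

namespace IsProductRing

theorem surjective_left : Function.Surjective (algebraMap R T) := fun t => by
  obtain ⟨r, hr⟩ := h.2 (t, 0)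
  exact ⟨r, congrArg Prod.fst hr⟩

/-- A product ring is the direct sum of its factors. -/
noncomputable def linearEquiv : R ≃ₗ[R] T × S :=
  LinearEquiv.ofBijective ((Algebra.linearMap R T).prod (Algebra.linearMap R S)) h

theorem projective_left : Module.Projective R T :=
  Module.Projective.of_split (h.linearEquiv.symm.toLinearMap ∘ₗ LinearMap.inl R T S)
    (LinearMap.fst R T S ∘ₗ h.linearEquiv.toLinearMap) (by ext; simp)

theorem flat_left : Module.Flat R T :=
  have := h.projective_left
  inferInstance

variable (M : Type u) [AddCommGroup M] [Module R M]

/-- A module over a product ring is the direct sum of its base changes to the factors. -/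
noncomputable def decomp : M ≃ₗ[R] (T ⊗[R] M) × (S ⊗[R] M) :=
  (TensorProduct.lid R M).symm ≪≫ₗ TensorProduct.congr h.linearEquiv (LinearEquiv.refl R M) ≪≫ₗ
    TensorProduct.prodLeft R R T S M

variable [Module T M] [IsScalarTower R T M]

theorem subsingleton_baseChange : Subsingleton (S ⊗[R] M) := by
  obtain ⟨r, hr⟩ := h.2 ((0 : T), (1 : S))
  refine ⟨fun x y => ?_⟩
  have hz : ∀ x : S ⊗[R] M, x = 0 := fun x => by
    induction x with
    | zero => rfl
    | add x y hx hy => rw [hx, hy, add_zero]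
    | tmul s m =>
      have h1 : algebraMap R T r = 0 := congrArg Prod.fst hr
      have h2 : algebraMap R S r = 1 := congrArg Prod.snd hr
      have : s = r • s := by rw [Algebra.smul_def, h2, one_mul]
      rw [this, TensorProduct.smul_tmul, ← algebraMap_smul T, h1, zero_smul, tmul_zero]
  rw [hz x, hz y]

end IsProductRing

end Product

/-! ### Vanishing of Tor -/

section Tor

variable {R : Type u} [CommRing R]

section

variable {A B C : Type u} [AddCommGroup A] [AddCommGroup B]
  [AddCommGroup C] [Module R A] [Module R B] [Module R C]

/-- A pair of maps `A → B → C` that is exact at `B` gives a short exact sequence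
`0 → B / im → C → C / im → 0`. -/
theorem isShortExact_of_exact {f : A →ₗ[R] B} {g : B →ₗ[R] C} (h : Function.Exact f g) :
    IsShortExact ((LinearMap.range f).liftQ g (LinearMap.range_le_ker_iff.2
      h.linearMap_comp_eq_zero)) (LinearMap.range g).mkQ := by
  refine ⟨?_, ?_, Submodule.mkQ_surjective _⟩
  · rw [← LinearMap.ker_eq_bot]
    exact Submodule.ker_liftQ_eq_bot _ _ _ (LinearMap.exact_iff.1 h).le
  · rw [LinearMap.exact_iff, Submodule.ker_mkQ, Submodule.range_liftQ]

end

variable {P : ℕ → Type u} [∀ k, AddCommGroup (P k)] [∀ k, Module R (P k)]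
  [∀ k, Module.Flat R (P k)] {d : ∀ k, P (k + 1) →ₗ[R] P k}
  {I : Type u} [AddCommGroup I] [Module R I] {ε : P 0 →ₗ[R] I}

/-- In a flat resolution the cokernels of the differentials have decreasing flat dimension. -/
theorem flatDimLT_coker_of_resolution (hd : ∀ k, Function.Exact (d (k + 1)) (d k))
    (h0 : Function.Exact (d 0) ε) (hε : Function.Surjective ε) {n : ℕ}
    (hI : FlatDimLT R I (n + 1)) (k m : ℕ) (hkm : k + m = n) :
    FlatDimLT R (P k ⧸ LinearMap.range (d k)) (m + 1) := by
  induction k generalizing m with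
  | zero =>
    obtain rfl : m = n := by lia
    exact hI.of_equiv ((Submodule.quotEquivOfEq _ _ (LinearMap.exact_iff.1 h0).symm).trans
      (ε.quotKerEquivOfSurjective hε))
  | succ k ih =>
    exact (isShortExact_of_exact (hd k)).flatDimLT_left (.of_flat _) (ih (m + 1) (by lia))

theorem lTensor_exact_of_resolution (hd : ∀ k, Function.Exact (d (k + 1)) (d k))
    (h0 : Function.Exact (d 0) ε) (hε : Function.Surjective ε) {n : ℕ}
    (hI : FlatDimLT R I (n + 1)) (M : Type u) [AddCommGroup M] [Module R M] :
    Function.Exact ((d (n + 1)).lTensor M) ((d n).lTensor M) := by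
  have hs := isShortExact_of_exact (hd n)
  have := (flatDimLT_one_iff _ _).1 (flatDimLT_coker_of_resolution hd h0 hε hI n 0 rfl)
  have hinj := LinearMap.lTensor_injective_of_exact_of_flat _ hs.surj _ hs.inj hs.exact M
  have hex := lTensor_exact M (f := d (n + 1)) (g := (LinearMap.range (d (n + 1))).mkQ)
    (by rw [LinearMap.exact_iff, Submodule.ker_mkQ]) (Submodule.mkQ_surjective _)
  have hcomp : d n = (LinearMap.range (d (n + 1))).liftQ (d n) (LinearMap.range_le_ker_iff.2
      (hd n).linearMap_comp_eq_zero) ∘ₗ (LinearMap.range (d (n + 1))).mkQ :=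
    (Submodule.liftQ_mkQ _ _ _).symm
  rw [hcomp, LinearMap.lTensor_comp]
  exact hex.comp_injective _ hinj (map_zero _)

/-- `Tor_{n + 1}(-, I)` vanishes if `I` has flat dimension at most `n`. -/
theorem isZero_tor_of_flatDimLT {n : ℕ} (M I : ModuleCat.{u} R) (hI : FlatDimLT R I (n + 1)) :
    Limits.IsZero (((Tor (ModuleCat.{u} R) (n + 1)).obj M).obj I) := by
  let P : ProjectiveResolution I := (HasProjectiveResolution.out (Z := I)).some
  refine Limits.IsZero.of_iso ?_ (P.isoLeftDerivedObj
    ((MonoidalCategory.tensoringLeft (ModuleCat.{u} R)).obj M) (n + 1))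
  change Limits.IsZero (HomologicalComplex.homology _ _)
  rw [← HomologicalComplex.exactAt_iff_isZero_homology,
    HomologicalComplex.exactAt_iff' _ (n + 2) (n + 1) n (by simp) (by simp),
    ShortComplex.ShortExact.moduleCat_exact_iff_function_exact]
  have hfl : ∀ k, Module.Flat R (P.complex.X k) := fun k =>
    have : Module.Projective R (P.complex.X k) :=
      (IsProjective.iff_projective _).2 (P.projective k)
    inferInstance
  refine lTensor_exact_of_resolution (P := fun k => P.complex.X k)
    (d := fun k => (P.complex.d (k + 1) k).hom) (ε := (P.π.f 0).hom) (I := I) ?_ ?_ ?_ hI M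
  · intro k
    have := P.complex_exactAt_succ k
    rw [HomologicalComplex.exactAt_iff' _ (k + 2) (k + 1) k (by simp) (by simp),
      ShortComplex.ShortExact.moduleCat_exact_iff_function_exact] at this
    exact this
  · exact (ShortComplex.ShortExact.moduleCat_exact_iff_function_exact _).1 P.exact₀
  · exact (ModuleCat.epi_iff_surjective _).1 inferInstance

end Tor

/-! ### Modules over truncated polynomial rings -/

section Truncated

/-- The `K`-algebra `T` is generated by an element `x` with `x ^ m = 0`, and there is a functional
that picks the coefficient of `x ^ (m - 1)`: these are the properties of `K[X] / (X ^ m)` that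
make its injective modules flat. -/
structure IsTruncated (K : Type u) [Field K] (m : ℕ) {T : Type u} [CommRing T] [Algebra K T]
    (x : T) : Prop where
  pow_eq_zero : x ^ m = 0
  aeval_surjective : Function.Surjective (aeval (R := K) x)
  exists_topCoeff : ∃ c : T →ₗ[K] K, ∀ i < m, c (x ^ i) = if i = m - 1 then 1 else 0

theorem isTruncated_truncatedPoly (K : Type u) [Field K] {m : ℕ} (hm : m ≠ 0) :
    IsTruncated K m (Ideal.Quotient.mk (Ideal.span {X ^ m}) X : TruncatedPoly K m) where
  pow_eq_zero := by
    rw [← map_pow, Ideal.Quotient.eq_zero_iff_mem]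
    exact Ideal.mem_span_singleton_self _
  aeval_surjective t := by
    obtain ⟨p, rfl⟩ := Ideal.Quotient.mk_surjective t
    refine ⟨p, ?_⟩
    change aeval (Ideal.Quotient.mkₐ K _ X) p = _
    rw [aeval_algHom_apply, aeval_X_left_apply]
    rfl
  exists_topCoeff := by
    let J : Ideal K[X] := Ideal.span {X ^ m}
    have hJ : J.restrictScalars K ≤ LinearMap.ker (lcoeff K (m - 1)) := fun p hp => by
      rw [Submodule.restrictScalars_mem, Ideal.mem_span_singleton] at hp
      rw [LinearMap.mem_ker, lcoeff_apply]
      exact X_pow_dvd_iff.1 hp _ (by lia)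
    refine ⟨(J.restrictScalars K).liftQ _ hJ ∘ₗ
      (Submodule.Quotient.restrictScalarsEquiv K J).symm.toLinearMap, fun i _ => ?_⟩
    change lcoeff K (m - 1) (X ^ i) = _
    rw [lcoeff_apply, coeff_X_pow]
    simp [eq_comm]

variable {K : Type u} [Field K] {m : ℕ} {T : Type u} [CommRing T] [Algebra K T] {x : T}

section

variable {M N : Type u} [AddCommGroup M] [Module K M] [Module T M]
  [IsScalarTower K T M] [AddCommGroup N] [Module K N] [Module T N] [IsScalarTower K T N]

/-- A `K`-linear map commuting with a generator `x` of the `K`-algebra `T` is `T`-linear. -/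
def linearMapOfCommutes (hx : Function.Surjective (aeval (R := K) x)) (f : M →ₗ[K] N)
    (hf : ∀ y, f (x • y) = x • f y) : M →ₗ[T] N where
  toFun := f
  map_add' := f.map_add
  map_smul' t y := by
    obtain ⟨p, rfl⟩ := hx t
    simp only [RingHom.id_apply]
    induction p using Polynomial.induction_on with
    | C a => rw [aeval_C, algebraMap_smul, algebraMap_smul, map_smul]
    | add p q hp hq => rw [map_add, add_smul, map_add, hp, hq, add_smul]
    | monomial n a h =>
      rw [pow_succ, ← mul_assoc, mul_comm, map_mul, aeval_X, mul_smul, mul_smul, hf, h]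

/-- The map `y ↦ ∑ i < m, x ^ i ⊗ x ^ (m - 1 - i) y` from a module over `K[x] / (x ^ m)` to a free
module. It is linear because the sum telescopes. -/
noncomputable def toFree (hx : IsTruncated K m x) : M →ₗ[T] T ⊗[K] M :=
  linearMapOfCommutes hx.aeval_surjective
    (∑ i ∈ Finset.range m, TensorProduct.mk K T M (x ^ i) ∘ₗ
      Algebra.lsmul K K M (x ^ (m - 1 - i))) fun y => by
    have h1 : ∀ i ∈ Finset.range m, (x ^ i) ⊗ₜ[K] (x ^ (m - 1 - i) • x • y) =
          (x ^ i) ⊗ₜ[K] (x ^ (m - i) • y) := fun i hi => by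
      rw [← mul_smul, ← pow_succ, show m - 1 - i + 1 = m - i by
        have := Finset.mem_range.1 hi; lia]
    have h2 : ∀ i ∈ Finset.range m, x • (x ^ i) ⊗ₜ[K] (x ^ (m - 1 - i) • y) =
          (x ^ (i + 1)) ⊗ₜ[K] (x ^ (m - (i + 1)) • y) := fun i hi => by
      rw [TensorProduct.smul_tmul', smul_eq_mul, ← pow_succ', Nat.sub_sub, add_comm 1 i]
    simp only [LinearMap.sum_apply, LinearMap.comp_apply, TensorProduct.mk_apply,
      Algebra.lsmul_coe, Finset.smul_sum]
    rw [Finset.sum_congr rfl h1, Finset.sum_congr rfl h2]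
    have h3 := (Finset.sum_range_succ (fun i => (x ^ i) ⊗ₜ[K]
      (x ^ (m - i) • y)) m).symm.trans (Finset.sum_range_succ' _ m)
    simpa [hx.pow_eq_zero] using h3

theorem toFree_apply (hx : IsTruncated K m x) (y : M) : toFree hx y =
    ∑ i ∈ Finset.range m, (x ^ i) ⊗ₜ[K] (x ^ (m - 1 - i) • y) := by
  change (∑ i ∈ Finset.range m, TensorProduct.mk K T M (x ^ i) ∘ₗ
      Algebra.lsmul K K M (x ^ (m - 1 - i))) y = _
  simp only [LinearMap.sum_apply, LinearMap.comp_apply, TensorProduct.mk_apply, Algebra.lsmul_coe]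

theorem toFree_injective (hx : IsTruncated K m x) (hm : m ≠ 0) :
    Function.Injective (toFree (M := M) hx) := by
  obtain ⟨c, hc⟩ := hx.exists_topCoeff
  refine Function.LeftInverse.injective
    (g := (TensorProduct.lid K M) ∘ c.rTensor M) fun y => ?_
  have h : ∀ i ∈ Finset.range m, (TensorProduct.lid K M)
      (c (x ^ i) ⊗ₜ[K] (x ^ (m - 1 - i) • y)) =
        if i = m - 1 then y else 0 := fun i hi => by
    rw [hc i (Finset.mem_range.1 hi)]
    split_ifs with h
    · simp [h]
    · simp
  rw [Function.comp_apply, toFree_apply, map_sum, map_sum]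
  simp only [LinearMap.rTensor_tmul]
  rw [Finset.sum_congr rfl h, Finset.sum_ite_eq', if_pos (Finset.mem_range.2 (by lia))]

end

/-- Every module over `K[x] / (x ^ m)` embeds into a free module. -/
theorem IsTruncated.exists_free_injective (hx : IsTruncated K m x) (hm : m ≠ 0) (M : Type u)
    [AddCommGroup M] [Module T M] :
    ∃ (F : Type u) (_ : AddCommGroup F) (_ : Module T F) (i : M →ₗ[T] F),
      Module.Free T F ∧ Function.Injective i := by
  let : Module K M := Module.compHom M (algebraMap K T)
  have : IsScalarTower K T M := .of_compHom _ _ _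
  exact ⟨T ⊗[K] M, inferInstance, inferInstance, toFree hx, inferInstance,
    toFree_injective hx hm⟩

/-- A module `M` over `K[x] / (x ^ 2)` has an involution `φ` that anticommutes with `x`. It makes
the cokernel of the embedding of `M` into the free module isomorphic to `M`. -/
theorem exists_anticommuting_involution (hx2 : x ^ 2 = 0) (M : Type u) [AddCommGroup M] [Module K M]
    [Module T M] [IsScalarTower K T M] :
    ∃ φ : M →ₗ[K] M, (∀ y, φ (φ y) = y) ∧ ∀ y, φ (x • y) = - (x • φ y) := by
  let ξ : M →ₗ[K] M := Algebra.lsmul K K M x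
  have hξ : ∀ y, ξ (ξ y) = 0 := fun y => by
    change x • x • y = 0
    rw [← mul_smul, ← pow_two, hx2, zero_smul]
  obtain ⟨W, hW⟩ := (LinearMap.ker ξ).exists_isCompl
  let φ : M →ₗ[K] M := LinearMap.ofIsCompl hW (LinearMap.ker ξ).subtype (-W.subtype)
  have hφ1 : ∀ y ∈ LinearMap.ker ξ, φ y = y := fun y hy =>
    LinearMap.ofIsCompl_apply_left hW ⟨y, hy⟩
  have hφ2 : ∀ y ∈ W, φ y = -y := fun y hy =>
    LinearMap.ofIsCompl_apply_right hW ⟨y, hy⟩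
  have hdec : ∀ y, ∃ a ∈ LinearMap.ker ξ, ∃ b ∈ W, a + b = y := fun y =>
    Submodule.mem_sup.1 (hW.sup_eq_top ▸ Submodule.mem_top)
  refine ⟨φ, fun y => ?_, fun y => ?_⟩
  · obtain ⟨a, ha, b, hb, rfl⟩ := hdec y
    rw [map_add, hφ1 a ha, hφ2 b hb, map_add, hφ1 a ha, map_neg, hφ2 b hb, neg_neg]
  · obtain ⟨a, ha, b, hb, rfl⟩ := hdec y
    change φ (ξ _) = - ξ (φ _)
    rw [map_add φ, hφ1 a ha, hφ2 b hb, hφ1 _ (hξ _), map_add, map_add, map_neg,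
      LinearMap.mem_ker.1 ha]
    simp

/-- Every module over `K[x] / (x ^ 2)` is an extension of itself by itself with free total
module. -/
theorem IsTruncated.exists_isShortExact_self (hx : IsTruncated K 2 x) (M : Type u) [AddCommGroup M]
    [Module T M] :
    ∃ (F : Type u) (_ : AddCommGroup F) (_ : Module T F) (f : M →ₗ[T] F) (g : F →ₗ[T] M),
      Module.Free T F ∧ IsShortExact f g := by
  let : Module K M := Module.compHom M (algebraMap K T)
  have : IsScalarTower K T M := .of_compHom _ _ _
  obtain ⟨φ, hφ, hφx⟩ := exists_anticommuting_involution (K := K) hx.pow_eq_zero M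
  let g : T ⊗[K] M →ₗ[T] M :=
    TensorProduct.AlgebraTensorModule.lift (LinearMap.toSpanSingleton T (M →ₗ[K] M) φ)
  have hg : ∀ t y, g (t ⊗ₜ y) = t • φ y := fun t y => by simp [g]
  have hf : ∀ y : M, toFree hx y = 1 ⊗ₜ (x • y) + x ⊗ₜ y := fun y => by
    simp [toFree_apply, Finset.sum_range_succ]
  refine ⟨T ⊗[K] M, inferInstance, inferInstance, toFree hx, g, inferInstance,
    toFree_injective hx two_ne_zero, ?_, fun y => ⟨1 ⊗ₜ φ y, by rw [hg, hφ, one_smul]⟩⟩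
  -- Every element of `T ⊗ M` has the form `1 ⊗ a + x ⊗ b`.
  have hspan : ∀ z : T ⊗[K] M, ∃ a b : M, z = 1 ⊗ₜ a + x ⊗ₜ b := fun z => by
    induction z with
    | zero => exact ⟨0, 0, by simp⟩
    | add z w hz hw =>
      obtain ⟨a, b, rfl⟩ := hz
      obtain ⟨c, d, rfl⟩ := hw
      exact ⟨a + c, b + d, by rw [tmul_add, tmul_add]; abel⟩
    | tmul t y =>
      obtain ⟨p, rfl⟩ := hx.aeval_surjective t
      obtain ⟨q, hq⟩ : (X : K[X]) ^ 2 ∣ p - (C (p.coeff 0) + C (p.coeff 1) * X) := by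
        rw [X_pow_dvd_iff]
        intro d hd
        interval_cases d <;> simp [coeff_X]
      have hp : aeval x p = p.coeff 0 • (1 : T) + p.coeff 1 • x := by
        have h1 := congrArg (aeval x) hq
        simp only [map_sub, map_add, map_mul, map_pow, aeval_X, aeval_C, hx.pow_eq_zero,
          zero_mul, sub_eq_zero] at h1
        rw [h1, Algebra.smul_def, Algebra.smul_def, mul_one]
      exact ⟨p.coeff 0 • y, p.coeff 1 • y, by
        rw [hp, add_tmul, smul_tmul, smul_tmul]⟩
  intro z
  constructor
  · obtain ⟨a, b, rfl⟩ := hspan z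
    intro h
    rw [map_add, hg, hg, one_smul] at h
    refine ⟨b, ?_⟩
    have hab : φ a = φ (x • b) := by rw [hφx, eq_neg_iff_add_eq_zero, h]
    rw [hf, ← hφ a, hab, hφ]
  · rintro ⟨y, rfl⟩
    rw [hf, map_add, hg, hg, one_smul, hφx, neg_add_cancel]

end Truncated

/-! ### Gorenstein flat modules over a product ring -/

section GorensteinFlat

variable {R : Type u} [CommRing R]

/-- `0 → Z → F → Z' → 0` is exact for some flat module `F`, and remains so after tensoring with an
injective module. -/
def FlatLink (Z Z' : ModuleCat.{u} R) : Prop :=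
  ∃ (F : ModuleCat.{u} R) (f : Z →ₗ[R] F) (g : F →ₗ[R] Z'), Module.Flat R F ∧ IsShortExact f g ∧
    ∀ I : ModuleCat.{u} R, Module.Injective R I → Function.Injective (f.lTensor I)

/-- A class of modules in which every module is linked to another one in both directions consists
of Gorenstein flat modules. -/
theorem isGorensteinFlat_of_flatLink {𝒞 : ModuleCat.{u} R → Prop}
    (hnext : ∀ Z, 𝒞 Z → ∃ Z', 𝒞 Z' ∧ FlatLink Z Z')
    (hprev : ∀ Z, 𝒞 Z → ∃ Z', 𝒞 Z' ∧ FlatLink Z' Z) {M : ModuleCat.{u} R} (hM : 𝒞 M) :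
    IsGorensteinFlat R M := by
  choose next hnext1 hnext2 using fun Z : {Z // 𝒞 Z} => hnext Z.1 Z.2
  choose prev hprev1 hprev2 using fun Z : {Z // 𝒞 Z} => hprev Z.1 Z.2
  let next' : {Z // 𝒞 Z} → {Z // 𝒞 Z} := fun Z => ⟨next Z, hnext1 Z⟩
  let prev' : {Z // 𝒞 Z} → {Z // 𝒞 Z} := fun Z => ⟨prev Z, hprev1 Z⟩
  -- The sequence of modules is placed so that `M` sits at index `1`, where it is the image of
  -- the differential with index `0`.
  let Z : ℤ → {Z // 𝒞 Z} := fun i => match i with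
    | .ofNat 0 => prev' ⟨M, hM⟩
    | .ofNat (k + 1) => next'^[k] ⟨M, hM⟩
    | .negSucc k => prev'^[k + 2] ⟨M, hM⟩
  have hZ : ∀ i, FlatLink (Z i).1 (Z (i + 1)).1 := by
    intro i
    match i with
    | .ofNat 0 => exact hprev2 ⟨M, hM⟩
    | .ofNat (k + 1) =>
      have : Z (.ofNat (k + 1) + 1) = next' (Z (.ofNat (k + 1))) :=
        Function.iterate_succ_apply' next' k ⟨M, hM⟩
      rw [this]
      exact hnext2 _
    | .negSucc 0 =>
      exact hprev2 (prev' ⟨M, hM⟩)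
    | .negSucc (k + 1) =>
      have : Z (.negSucc (k + 1)) = prev' (Z (.negSucc k)) :=
        Function.iterate_succ_apply' prev' (k + 2) ⟨M, hM⟩
      rw [this]
      exact hprev2 _
  choose F f g hF hs ht using hZ
  refine ⟨F, fun i => f (i + 1) ∘ₗ g i, hF, fun i => ?_, fun I hI i => ?_, ⟨?_⟩⟩
  · have h1 : Function.Exact (f (i + 1) ∘ₗ g i) (g (i + 1)) :=
      ((hs i).surj.comp_exact_iff_exact).2 (hs (i + 1)).exact
    exact h1.comp_injective (f (i + 1 + 1)) (hs (i + 1 + 1)).inj (map_zero (f (i + 1 + 1)))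
  · rw [LinearMap.lTensor_comp, LinearMap.lTensor_comp]
    have h0 := lTensor_exact I (hs (i + 1)).exact (hs (i + 1)).surj
    have h1 : Function.Exact ((f (i + 1)).lTensor I ∘ₗ (g i).lTensor I) ((g (i + 1)).lTensor I) :=
      ((LinearMap.lTensor_surjective I (hs i).surj).comp_exact_iff_exact).2 h0
    exact h1.comp_injective ((f (i + 1 + 1)).lTensor I) (ht (i + 1 + 1) I hI) (map_zero _)
  · change M ≃ₗ[R] LinearMap.range (f 1 ∘ₗ g 0)
    exact (LinearEquiv.ofInjective (f 1) (hs 1).inj).trans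
      (LinearEquiv.ofEq _ _ (LinearMap.range_comp_of_range_eq_top _
        (LinearMap.range_eq_top.2 (hs 0).surj)).symm)

variable {S : Type u} [CommRing S] [Algebra R S] [Module.Flat R S]

/-- A Gorenstein flat module is an arbitrarily high syzygy of modules that are built from flat ones.
So it becomes flat after a flat base change to a ring of finite weak dimension. -/
theorem IsGorensteinFlat.flat_baseChange {n : ℕ}
    (hS : ∀ (N : Type u) [AddCommGroup N] [Module S N], FlatDimLT S N (n + 1))
    {M : ModuleCat.{u} R} (h : IsGorensteinFlat R M) : Module.Flat S (S ⊗[R] M) := by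
  obtain ⟨F, d, hF, hd, -, ⟨e⟩⟩ := h
  -- Each cycle module is the `n`-th syzygy of a later one.
  have key : ∀ k m : ℕ, k + m = n → ∀ i,
      FlatDimLT S (S ⊗[R] LinearMap.range (d i)) (m + 1) := by
    intro k
    induction k with
    | zero =>
      rintro m hm i
      obtain rfl : m = n := by lia
      exact hS _
    | succ k ih =>
      intro m hm i
      have hs : IsShortExact (LinearMap.range (d i)).subtype (d (i + 1)).rangeRestrict := by
        refine ⟨Subtype.val_injective, ?_, LinearMap.surjective_rangeRestrict _⟩
        rw [LinearMap.exact_iff, LinearMap.ker_rangeRestrict, Submodule.range_subtype]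
        exact LinearMap.exact_iff.1 (hd i)
      have := hF (i + 1)
      exact (hs.baseChange S).flatDimLT_left (.of_flat _) (ih (m + 1) (by lia) (i + 1))
  have := (flatDimLT_one_iff _ _).1 (key n 0 rfl 0)
  exact Module.Flat.of_linearEquiv (e.baseChange R S M _)

end GorensteinFlat

section Product

variable {R T S : Type u} [CommRing R] [CommRing T] [CommRing S] [Algebra R T] [Algebra R S]
  (h : IsProductRing R T S)

include h

/-- The component in the first factor of an injective module is flat, if each module over that
factor embeds into a free module. -/
theorem IsProductRing.flat_of_injective
    (hT : ∀ (N : Type u) [AddCommGroup N] [Module T N],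
      ∃ (F : Type u) (_ : AddCommGroup F) (_ : Module T F) (i : N →ₗ[T] F),
        Module.Free T F ∧ Function.Injective i)
    (I : Type u) [AddCommGroup I] [Module R I] (hI : Module.Injective R I) :
    Module.Flat R (T ⊗[R] I) := by
  obtain ⟨F, _, _, i, _, hi⟩ := hT (T ⊗[R] I)
  let : Module R F := Module.compHom F (algebraMap R T)
  have : IsScalarTower R T F := .of_compHom _ _ _
  have := h.flat_left
  have : Module.Flat R F := .trans R T F
  obtain ⟨r, hr⟩ := hI.out (i.restrictScalars R) hi
    ((h.decomp I).symm.toLinearMap ∘ₗ LinearMap.inl R _ _)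
  refine Module.Flat.of_retract (i.restrictScalars R)
    (LinearMap.fst R _ _ ∘ₗ (h.decomp I).toLinearMap ∘ₗ r) (LinearMap.ext fun y => ?_)
  change ((h.decomp I) (r (i.restrictScalars R y))).1 = y
  rw [hr]
  simp

theorem IsProductRing.flatDimLT (n : ℕ) (M : Type u) [AddCommGroup M] [Module R M]
    (hT : FlatDimLT R (T ⊗[R] M) n) (hS : FlatDimLT R (S ⊗[R] M) n) : FlatDimLT R M n :=
  (hT.prod hS).of_equiv (h.decomp M)

theorem IsProductRing.flatDimLT_of_injective
    (hT : ∀ (N : Type u) [AddCommGroup N] [Module T N],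
      ∃ (F : Type u) (_ : AddCommGroup F) (_ : Module T F) (i : N →ₗ[T] F),
        Module.Free T F ∧ Function.Injective i) {n : ℕ}
    (hS : ∀ (N : Type u) [AddCommGroup N] [Module S N], FlatDimLT S N (n + 1))
    (I : Type u) [AddCommGroup I] [Module R I] (hI : Module.Injective R I) :
    FlatDimLT R I (n + 1) := by
  have := h.flat_of_injective hT I hI
  have := h.symm.flat_left
  exact h.flatDimLT _ I (.of_flat _) (hS _).restrictScalars

/-- If all modules over one factor embed into free modules and are extensions of themselves by
themselves with free total module, and the other factor has weak dimension at most `n`, then the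
product is an `n`-wSG ring. -/
theorem IsProductRing.isWSG
    (hT : ∀ (N : Type u) [AddCommGroup N] [Module T N],
      ∃ (F : Type u) (_ : AddCommGroup F) (_ : Module T F) (i : N →ₗ[T] F),
        Module.Free T F ∧ Function.Injective i)
    (hT2 : ∀ (N : Type u) [AddCommGroup N] [Module T N],
      ∃ (F : Type u) (_ : AddCommGroup F) (_ : Module T F) (f : N →ₗ[T] F) (g : F →ₗ[T] N),
        Module.Free T F ∧ IsShortExact f g) {n : ℕ}
    (hS : ∀ (N : Type u) [AddCommGroup N] [Module S N], FlatDimLT S N (n + 1)) :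
    IsWSG R n := by
  intro M
  refine ⟨?_, fun I hI => isZero_tor_of_flatDimLT M I (h.flatDimLT_of_injective hT hS I hI)⟩
  obtain ⟨F, _, _, f, g, _, hfg⟩ := hT2 (T ⊗[R] M)
  let : Module R F := Module.compHom F (algebraMap R T)
  have : IsScalarTower R T F := .of_compHom _ _ _
  have := h.flat_left
  have := h.symm.flat_left
  have : Module.Flat R F := .trans R T F
  have hM : FlatDimLT R (S ⊗[R] M) (n + 1) := (hS _).restrictScalars
  refine ⟨ModuleCat.of R (F × ((S ⊗[R] M) × (S ⊗[R] M))),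
    ((f.restrictScalars R).prodMap (LinearMap.inl R _ _)) ∘ₗ (h.decomp M).toLinearMap,
    (h.decomp M).symm.toLinearMap ∘ₗ ((g.restrictScalars R).prodMap (LinearMap.snd R _ _)),
    ?_, ?_, ?_, flatDim_le_iff.2 (.prod (.of_flat _) (.prod hM hM))⟩
  · exact (hfg.inj.prodMap LinearMap.inl_injective).comp (h.decomp M).injective
  · rintro ⟨a, b, c⟩
    change (h.decomp M).symm (g a, c) = 0 ↔
      ∃ y, (f (h.decomp M y).1, ((h.decomp M y).2, (0 : S ⊗[R] M))) = (a, b, c)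
    rw [LinearEquiv.map_eq_zero_iff, Prod.mk_eq_zero, hfg.exact a]
    constructor
    · rintro ⟨⟨w, rfl⟩, rfl⟩
      exact ⟨(h.decomp M).symm (w, b), by simp⟩
    · rintro ⟨y, hy⟩
      rw [Prod.mk.injEq, Prod.mk.injEq] at hy
      exact ⟨⟨_, hy.1⟩, hy.2.2.symm⟩
  · exact (h.decomp M).symm.surjective.comp
      (hfg.surj.prodMap (LinearMap.snd_surjective (R := R)))

/-- An injective module over the product stays exact on short exact sequences whose last term has
a flat component in the second factor. -/
theorem IsProductRing.lTensor_injective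
    (hT : ∀ (N : Type u) [AddCommGroup N] [Module T N],
      ∃ (F : Type u) (_ : AddCommGroup F) (_ : Module T F) (i : N →ₗ[T] F),
        Module.Free T F ∧ Function.Injective i)
    {A B C : Type u} [AddCommGroup A] [AddCommGroup B]
    [AddCommGroup C] [Module R A] [Module R B] [Module R C] {f : A →ₗ[R] B} {g : B →ₗ[R] C}
    (hfg : IsShortExact f g) (hC : Module.Flat S (S ⊗[R] C))
    (I : Type u) [AddCommGroup I] [Module R I] (hI : Module.Injective R I) :
    Function.Injective (f.lTensor I) := by
  have := h.flat_of_injective hT I hI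
  have := h.symm.flat_left
  have h1 : Function.Injective (f.lTensor (T ⊗[R] I)) :=
    Module.Flat.lTensor_preserves_injective_linearMap f hfg.inj
  have h2 : Function.Injective (f.lTensor (S ⊗[R] I)) := by
    have hs := hfg.baseChange S
    have h3 := LinearMap.lTensor_injective_of_exact_of_flat _ hs.surj _ hs.inj hs.exact (S ⊗[R] I)
    let eA := TensorProduct.AlgebraTensorModule.cancelBaseChange R S S (S ⊗[R] I) A
    let eB := TensorProduct.AlgebraTensorModule.cancelBaseChange R S S (S ⊗[R] I) B
    have h4 : ∀ z, f.lTensor (S ⊗[R] I) (eA z) = eB ((f.baseChange S).lTensor (S ⊗[R] I) z) := by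
      intro z
      induction z with
      | zero => simp only [map_zero]
      | add z w hz hw => simp only [map_add, hz, hw]
      | tmul y z =>
        induction z with
        | zero => simp only [tmul_zero, map_zero]
        | add z w hz hw => simp only [tmul_add, map_add, hz, hw]
        | tmul s a => simp [eA, eB]
    have h5 : ⇑(f.lTensor (S ⊗[R] I)) = eB ∘ (f.baseChange S).lTensor (S ⊗[R] I) ∘ eA.symm := by
      funext z
      simp only [Function.comp_apply]
      rw [← h4, LinearEquiv.apply_symm_apply]
    rw [h5]
    exact eB.injective.comp (h3.comp eA.symm.injective)
  -- An element of `I ⊗ A` is determined by its components in the two factors.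
  rw [injective_iff_map_eq_zero]
  intro z hz
  let p := LinearMap.fst R _ _ ∘ₗ (h.decomp I).toLinearMap
  let q := LinearMap.snd R _ _ ∘ₗ (h.decomp I).toLinearMap
  have hp : p.rTensor A z = 0 := h1 (by
    rw [map_zero, ← LinearMap.comp_apply, LinearMap.lTensor_comp_rTensor,
      ← LinearMap.rTensor_comp_lTensor, LinearMap.comp_apply, hz, map_zero])
  have hq : q.rTensor A z = 0 := h2 (by
    rw [map_zero, ← LinearMap.comp_apply, LinearMap.lTensor_comp_rTensor,
      ← LinearMap.rTensor_comp_lTensor, LinearMap.comp_apply, hz, map_zero])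
  have hpq : ((h.decomp I).symm.toLinearMap ∘ₗ LinearMap.inl R _ _) ∘ₗ p +
      ((h.decomp I).symm.toLinearMap ∘ₗ LinearMap.inr R _ _) ∘ₗ q = LinearMap.id := by
    refine LinearMap.ext fun y => (h.decomp I).injective ?_
    simp [p, q]
  have hz' := LinearMap.congr_fun (congrArg (LinearMap.rTensor A) hpq) z
  rw [LinearMap.rTensor_add, LinearMap.add_apply, LinearMap.rTensor_comp A _ p,
    LinearMap.rTensor_comp A _ q, LinearMap.comp_apply, LinearMap.comp_apply, hp, hq, map_zero,
    map_zero, add_zero, LinearMap.rTensor_id, LinearMap.id_apply] at hz'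
  exact hz'.symm

/-- A module over the product is Gorenstein flat if its component in the second factor is flat. -/
theorem IsProductRing.isGorensteinFlat
    (hT : ∀ (N : Type u) [AddCommGroup N] [Module T N],
      ∃ (F : Type u) (_ : AddCommGroup F) (_ : Module T F) (i : N →ₗ[T] F),
        Module.Free T F ∧ Function.Injective i)
    {M : ModuleCat.{u} R} (hM : Module.Flat S (S ⊗[R] M)) : IsGorensteinFlat R M := by
  have := h.flat_left
  have := h.symm.flat_left
  -- The next cycle module is the cokernel of an embedding of `M` into the product of a free
  -- module over the first factor and the component of `M` in the second factor; the previous one is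
  -- a syzygy.
  refine isGorensteinFlat_of_flatLink (𝒞 := fun Z => Module.Flat S (S ⊗[R] Z)) ?_ ?_ hM
  · intro Z hZ
    obtain ⟨F, _, _, i, _, hi⟩ := hT (T ⊗[R] Z)
    let : Module R F := Module.compHom F (algebraMap R T)
    have : IsScalarTower R T F := .of_compHom _ _ _
    have : Module.Flat R F := .trans R T F
    have : Module.Flat R (S ⊗[R] Z) := .trans R S _
    have : Subsingleton (S ⊗[R] (F ⧸ LinearMap.range i)) := h.subsingleton_baseChange _
    have hfl : Module.Flat S (S ⊗[R] (F ⧸ LinearMap.range i)) := inferInstance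
    let f : Z →ₗ[R] F × (S ⊗[R] Z) :=
      ((i.restrictScalars R).prodMap LinearMap.id) ∘ₗ (h.decomp Z).toLinearMap
    let g : F × (S ⊗[R] Z) →ₗ[R] F ⧸ LinearMap.range i :=
      ((LinearMap.range i).mkQ.restrictScalars R) ∘ₗ LinearMap.fst R _ _
    have hfg : IsShortExact f g := by
      refine ⟨(hi.prodMap Function.injective_id).comp (h.decomp Z).injective, ?_,
        (Submodule.mkQ_surjective _).comp LinearMap.fst_surjective⟩
      rintro ⟨a, b⟩
      change (LinearMap.range i).mkQ a = 0 ↔ ∃ y, (i (h.decomp Z y).1, (h.decomp Z y).2) = _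
      rw [Submodule.mkQ_apply, Submodule.Quotient.mk_eq_zero]
      constructor
      · rintro ⟨w, rfl⟩
        exact ⟨(h.decomp Z).symm (w, b), by simp⟩
      · rintro ⟨y, hy⟩
        exact ⟨_, (Prod.mk.inj hy).1⟩
    exact ⟨ModuleCat.of R (F ⧸ LinearMap.range i), hfl, ModuleCat.of R (F × (S ⊗[R] Z)), f, g,
      (flatDimLT_one_iff _ _).1 (.prod (.of_flat _) (.of_flat _)), hfg,
      fun I hI => h.lTensor_injective hT hfg hfl I hI⟩
  · intro Z hZ
    obtain ⟨L, _, _, p, _, hp⟩ := exists_free_surjective (R := R) Z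
    have hs := IsShortExact.of_surjective hp
    exact ⟨ModuleCat.of R (LinearMap.ker p), (flatDimLT_one_iff _ _).1
      ((hs.baseChange S).flatDimLT_left (.of_flat _) (.of_flat _)), ModuleCat.of R L, _, p,
      inferInstanceAs (Module.Flat R L), hs, fun I hI => h.lTensor_injective hT hs hZ I hI⟩

/-- The Gorenstein flat dimension of a module over the product is at most the flat dimension of its
component in the second factor. -/
theorem IsProductRing.hasResolutionOfLength_gorensteinFlat
    (hT : ∀ (N : Type u) [AddCommGroup N] [Module T N],
      ∃ (F : Type u) (_ : AddCommGroup F) (_ : Module T F) (i : N →ₗ[T] F),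
        Module.Free T F ∧ Function.Injective i)
    {n : ℕ} (M : ModuleCat.{u} R) (hM : FlatDimLT S (S ⊗[R] M) (n + 1)) :
    HasResolutionOfLength (IsGorensteinFlat R) n M := by
  have := h.symm.flat_left
  induction n generalizing M with
  | zero => exact h.isGorensteinFlat hT ((flatDimLT_one_iff _ _).1 hM)
  | succ n ih =>
    obtain ⟨L, _, _, p, _, hp⟩ := exists_free_surjective (R := R) M
    refine ⟨ModuleCat.of R L, p, h.isGorensteinFlat hT (inferInstanceAs (Module.Flat S (S ⊗[R] L))),
      hp, ih _ ?_⟩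
    exact ((IsShortExact.of_surjective hp).baseChange S).flatDimLT_left (.of_flat _) hM

omit h in
/-- The flat dimension of a base change is at most the Gorenstein flat dimension, if the weak
dimension of the new ring is finite. -/
theorem flatDimLT_baseChange_of_gorensteinFlat [Module.Flat R S] {n : ℕ}
    (hS : ∀ (N : Type u) [AddCommGroup N] [Module S N], FlatDimLT S N (n + 1))
    {m : ℕ} (M : ModuleCat.{u} R) (hM : HasResolutionOfLength (IsGorensteinFlat R) m M) :
    FlatDimLT S (S ⊗[R] M) (m + 1) := by
  induction m generalizing M with
  | zero => exact (flatDimLT_one_iff _ _).2 (IsGorensteinFlat.flat_baseChange hS hM)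
  | succ m ih =>
    obtain ⟨G, p, hG, hp, hK⟩ := hM
    have := hG.flat_baseChange hS
    exact ((IsShortExact.of_surjective hp).baseChange S).flatDimLT_right (ih _ hK) (.of_flat _)

/-- The weak Gorenstein global dimension of the product is the weak global dimension of the second
factor, if that is finite. -/
theorem IsProductRing.wGgldim_eq
    (hT : ∀ (N : Type u) [AddCommGroup N] [Module T N],
      ∃ (F : Type u) (_ : AddCommGroup F) (_ : Module T F) (i : N →ₗ[T] F),
        Module.Free T F ∧ Function.Injective i)
    {n : ℕ} (hS : wdim S = n) : wGgldim R = n := by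
  have hS' := wdim_le_iff.1 hS.le
  have := h.symm.flat_left
  have hle : wGgldim R ≤ n := iSup_le fun M =>
    resolutionDim_le_iff.2 ⟨n, le_rfl, h.hasResolutionOfLength_gorensteinFlat hT M (hS' _)⟩
  refine le_antisymm hle ?_
  -- Conversely, a resolution over the product is tensored with the second factor.
  obtain ⟨m, hm⟩ := ENat.ne_top_iff_exists.1 (ne_top_of_le_ne_top (ENat.natCast_ne_top n) hle)
  rw [← hm, ← hS, wdim_le_iff]
  intro N _ _
  let : Module R N := Module.compHom N (algebraMap R S)
  have : IsScalarTower R S N := .of_compHom _ _ _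
  obtain ⟨k, hk, hres⟩ := resolutionDim_le_iff.1
    ((le_iSup (fun M : ModuleCat.{u} R => gorensteinFlatDim M) (ModuleCat.of R N)).trans hm.ge)
  exact ((flatDimLT_baseChange_of_gorensteinFlat hS' _ hres).mono (by lia)).of_equiv
    (baseChangeEquivOfSurjective h.symm.surjective_left N).symm

end Product

section NotWSG

variable {R : Type u} [CommRing R]

/-- If multiplication by `a` and by `b` gives a periodic exact complex on `R`, then it does so on
every module of finite flat dimension. -/
theorem FlatDimLT.exact_smul {a b : R} (hab : Function.Exact (LinearMap.lsmul R R a)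
    (LinearMap.lsmul R R b)) (hba : Function.Exact (LinearMap.lsmul R R b) (LinearMap.lsmul R R a))
    {n : ℕ} {M : Type u} [AddCommGroup M] [Module R M] (hM : FlatDimLT R M (n + 1)) :
    Function.Exact (LinearMap.lsmul R M a) (LinearMap.lsmul R M b) := by
  induction n generalizing M a b with
  | zero =>
    have := (flatDimLT_one_iff _ _).1 hM
    have key : ∀ r : R, ⇑(LinearMap.lsmul R M r) =
        TensorProduct.rid R M ∘ (LinearMap.lsmul R R r).lTensor M ∘ (TensorProduct.rid R M).symm :=
      fun r => by funext y; simp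
    have h := Module.Flat.lTensor_exact M hab
    intro y
    rw [key, key, Function.comp_apply, LinearEquiv.map_eq_zero_iff, Function.comp_apply, h]
    constructor
    · rintro ⟨z, hz⟩
      exact ⟨TensorProduct.rid R M z, by simp [hz]⟩
    · rintro ⟨z, rfl⟩
      exact ⟨(TensorProduct.rid R M).symm z, by simp [← TensorProduct.tmul_smul]⟩
  | succ n ih =>
    obtain ⟨L, _, _, p, _, hp⟩ := exists_free_surjective (R := R) M
    have hK := (IsShortExact.of_surjective hp).flatDimLT_left (.of_flat n) hM
    have hL : FlatDimLT R L (n + 1) := .of_flat n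
    have h1 := ih hba hab hK
    have h2 := ih hab hba hL
    have h3 : a * b = 0 := by
      have := hab.apply_apply_eq_zero 1
      simpa [mul_comm] using this
    intro y
    constructor
    · intro hy
      obtain ⟨l, rfl⟩ := hp y
      -- `b l` lies in the kernel of `p` and is killed by `a`, so it is `b k` with `k` in the kernel.
      have hbl : b • l ∈ LinearMap.ker p := by
        rw [LinearMap.mem_ker, map_smul]
        exact hy
      obtain ⟨k, hk⟩ := (h1 ⟨b • l, hbl⟩).1 (Subtype.ext (by
        change a • b • l = 0
        rw [← mul_smul, h3, zero_smul]))
      have hk' : b • (k : L) = b • l := congrArg Subtype.val hk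
      obtain ⟨l', hl'⟩ := (h2 (l - k)).1 (by
        change b • (l - (k : L)) = 0
        rw [smul_sub, hk', sub_self])
      refine ⟨p l', ?_⟩
      change a • p l' = p l
      rw [← map_smul]
      change a • l' = l - k at hl'
      rw [hl', map_sub, LinearMap.mem_ker.1 k.2, sub_zero]
    · rintro ⟨z, rfl⟩
      change b • a • z = 0
      rw [← mul_smul, mul_comm, h3, zero_smul]

/-- If `c ^ 2` annihilates precisely the multiples of an element `a`, whose square is a multiple of
`c ^ 2` and whose annihilator is generated by `c ^ 2`, then `R / (c)` is not an extension of itself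
by itself with total module of finite flat dimension. -/
theorem not_isWSG_of_exact {a c : R} (hab : Function.Exact (LinearMap.lsmul R R a)
    (LinearMap.lsmul R R (c ^ 2)))
    (hba : Function.Exact (LinearMap.lsmul R R (c ^ 2)) (LinearMap.lsmul R R a))
    (ha : c ^ 2 ∣ a ^ 2) (hc : ¬ IsUnit c) (n : ℕ) : ¬ IsWSG R n := by
  intro hW
  obtain ⟨⟨F, f, g, hf, hfg, hg, hF⟩, -⟩ := hW (ModuleCat.of R (R ⧸ Ideal.span {c}))
  have hM : ∀ y : R ⧸ Ideal.span {c}, c • y = 0 := fun y => by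
    obtain ⟨r, rfl⟩ := Ideal.Quotient.mk_surjective y
    rw [← Ideal.Quotient.mk_eq_mk, ← Submodule.Quotient.mk_smul, Submodule.Quotient.mk_eq_zero]
    exact Ideal.mem_span_singleton.2 (dvd_mul_right _ _)
  have hcF : ∀ y : F, c ^ 2 • y = 0 := fun y => by
    obtain ⟨z, hz⟩ := (hfg (c • y)).1 (by rw [map_smul]; exact hM _)
    rw [pow_two, mul_smul, ← hz, ← map_smul]
    exact (congrArg f (hM z)).trans (map_zero f)
  have hex := (flatDim_le_iff.1 hF).exact_smul hab hba
  -- As `c ^ 2` kills `F`, each element of `F` is a multiple of `a`, hence of `a ^ 2`.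
  have hF0 : ∀ y : F, y = 0 := fun y => by
    obtain ⟨z, rfl⟩ := (hex y).1 (hcF y)
    obtain ⟨w, rfl⟩ := (hex z).1 (hcF z)
    change a • a • w = 0
    obtain ⟨t, ht⟩ := ha
    rw [← mul_smul, ← pow_two, ht, mul_smul, hcF]
  have h1 : (Ideal.Quotient.mk (Ideal.span {c}) 1) = 0 := by
    obtain ⟨y, hy⟩ := hg (Ideal.Quotient.mk (Ideal.span {c}) 1)
    rw [← hy, hF0 y]
    exact map_zero g
  rw [Ideal.Quotient.eq_zero_iff_mem, Ideal.mem_span_singleton] at h1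
  exact hc (isUnit_of_dvd_one h1)

end NotWSG

/-! ### Periodic flat modules are projective -/

section PeriodicFlat

variable {R : Type u} [CommRing R]

section Contraction

variable {B : Type u} {d : (B →₀ R) →ₗ[R] (B →₀ R)}

theorem mem_supported_of_forall_single {D : Type u} {f : (B →₀ R) →ₗ[R] (D →₀ R)} {C : Set B}
    {E : Set D} (h : ∀ b ∈ C, f (Finsupp.single b 1) ∈ Finsupp.supported R R E) {x : B →₀ R}
    (hx : x ∈ Finsupp.supported R R C) : f x ∈ Finsupp.supported R R E := by
  rw [Finsupp.supported_eq_span_single] at hx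
  have hle : Submodule.span R ((fun b => Finsupp.single b (1 : R)) '' C) ≤
      (Finsupp.supported R R E).comap f := by
    rw [Submodule.span_le]
    rintro _ ⟨b, hb, rfl⟩
    exact h b hb
  exact hle hx

theorem eq_of_forall_single {N : Type u} [AddCommGroup N] [Module R N] {f g : (B →₀ R) →ₗ[R] N}
    {C : Set B} (h : ∀ b ∈ C, f (Finsupp.single b 1) = g (Finsupp.single b 1)) {x : B →₀ R}
    (hx : x ∈ Finsupp.supported R R C) : f x = g x := by
  rw [Finsupp.supported_eq_span_single] at hx
  refine LinearMap.eqOn_span ?_ hx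
  rintro _ ⟨b, hb, rfl⟩
  exact h b hb

theorem lmapDomain_lsubtypeDomain {C : Set B} {x : B →₀ R} (hx : x ∈ Finsupp.supported R R C) :
    Finsupp.lmapDomain R R (Subtype.val : C → B)
      (Finsupp.lsubtypeDomain (R := R) C x) = x := by
  refine Finsupp.ext fun b => ?_
  by_cases hb : b ∈ C
  · exact Finsupp.mapDomain_apply Subtype.val_injective _ (⟨b, hb⟩ : C)
  · refine (Finsupp.mapDomain_of_notMem_range _ _ (by simpa using hb)).trans ?_
    exact (Finsupp.notMem_support_iff.1 fun h => hb ((Finsupp.mem_supported R x).1 hx h)).symm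

theorem lsubtypeDomain_lmapDomain {C : Set B} (x : C →₀ R) :
    Finsupp.lsubtypeDomain (R := R) C
      (Finsupp.lmapDomain R R (Subtype.val : C → B) x) = x :=
  Finsupp.ext fun b => Finsupp.mapDomain_apply Subtype.val_injective x b

theorem lmapDomain_mem_supported {C : Set B} (x : C →₀ R) :
    Finsupp.lmapDomain R R (Subtype.val : C → B) x ∈ Finsupp.supported R R C := by
  refine (Finsupp.mem_supported R _).2 fun b hb => ?_
  by_contra h
  exact (Finsupp.mem_support_iff.1 hb) (Finsupp.mapDomain_of_notMem_range _ _ (by simpa using h))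

variable (d) in
/-- The pair `(φ, ψ)` is a partial contraction of the periodic complex with differential `d` at the
basis element `b`. -/
def ContractsAt (φ ψ : (B →₀ R) →ₗ[R] (B →₀ R)) (b : B) : Prop :=
  d (ψ (Finsupp.single b 1)) + φ (d (Finsupp.single b 1)) = Finsupp.single b 1

theorem contractsAt_supported {φ ψ : (B →₀ R) →ₗ[R] (B →₀ R)} {C : Set B}
    (h : ∀ b ∈ C, ContractsAt d φ ψ b) {x : B →₀ R} (hx : x ∈ Finsupp.supported R R C) :
    d (ψ x) + φ (d x) = x :=
  eq_of_forall_single (f := d ∘ₗ ψ + φ ∘ₗ d) (g := LinearMap.id) h hx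

/-- If a periodic exact complex of free modules has flat cycles, it is contractible on each finite
set of basis elements. The flatness of the cokernel of `d` gives the lift of finitely many of its
relations. -/
theorem exists_contractsAt_of_flat (hd : Function.Exact d d)
    (hfl : Module.Flat R ((B →₀ R) ⧸ LinearMap.range d)) (A : Finset B) :
    ∃ φ ψ : (B →₀ R) →ₗ[R] (B →₀ R), ∀ a ∈ A, ContractsAt d φ ψ a := by
  classical
  -- The relations `d a` with `a ∈ A` involve the basis elements in `F`; `f` lists them, and
  -- flatness factors the map from `R ^ F` to the cokernel of `d` through a free module that
  -- respects them.
  let F : Finset B := A.biUnion fun a => (d (Finsupp.single a 1)).support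
  let i : ((F : Set B) →₀ R) →ₗ[R] (B →₀ R) := Finsupp.lmapDomain R R Subtype.val
  let q : (B →₀ R) →ₗ[R] ((F : Set B) →₀ R) := Finsupp.lsubtypeDomain (F : Set B)
  have hiq : ∀ a ∈ A, i (q (d (Finsupp.single a 1))) = d (Finsupp.single a 1) := fun a ha => by
    refine lmapDomain_lsubtypeDomain ((Finsupp.mem_supported _ _).2 ?_)
    exact_mod_cast Finset.subset_biUnion_of_mem
      (fun a => (d (Finsupp.single a 1)).support) ha
  let f : ((A : Set B) →₀ R) →ₗ[R] ((F : Set B) →₀ R) :=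
    Finsupp.linearCombination R fun a => q (d (Finsupp.single a.1 1))
  have hf : ((LinearMap.range d).mkQ ∘ₗ i) ∘ₗ f = 0 := by
    refine Finsupp.lhom_ext' fun a => LinearMap.ext_ring ?_
    simp only [LinearMap.comp_apply, Finsupp.lsingle_apply, f, Finsupp.linearCombination_single,
      one_smul, hiq a.1 a.2]
    simp
  obtain ⟨k, a, y, hy, ha⟩ := Module.Flat.exists_factorization_of_comp_eq_zero_of_free hf
  obtain ⟨y', hy'⟩ := Module.projective_lifting_property (LinearMap.range d).mkQ y
    (Submodule.mkQ_surjective _)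
  -- The map `θ` takes values in the boundaries and fixes `d a` for `a ∈ A`.
  let θ : (B →₀ R) →ₗ[R] (B →₀ R) := (i - y' ∘ₗ a) ∘ₗ q
  have hθ : ∀ x, θ x ∈ LinearMap.range d := fun x => by
    rw [← Submodule.Quotient.mk_eq_zero, ← Submodule.mkQ_apply]
    have := LinearMap.congr_fun hy (q x)
    rw [← hy'] at this
    simpa [θ, sub_eq_zero] using this
  have hθ' : ∀ b ∈ A, θ (d (Finsupp.single b 1)) = d (Finsupp.single b 1) := fun b hb => by
    have := LinearMap.congr_fun ha (Finsupp.single ⟨b, hb⟩ 1)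
    simp only [LinearMap.comp_apply, f, Finsupp.linearCombination_single, one_smul,
      LinearMap.zero_apply] at this
    simp only [θ, LinearMap.comp_apply, LinearMap.sub_apply, this, map_zero, sub_zero, hiq b hb]
  obtain ⟨φ, hφ⟩ := Module.projective_lifting_property d.rangeRestrict (θ.codRestrict _ hθ)
    (LinearMap.surjective_rangeRestrict d)
  have hφ' : ∀ x, d (φ x) = θ x := fun x => congrArg Subtype.val (LinearMap.congr_fun hφ x)
  have hψ : ∀ b, ∃ y, b ∈ A → d y = Finsupp.single b 1 - φ (d (Finsupp.single b 1)) := fun b => by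
    by_cases hb : b ∈ A
    · obtain ⟨y, hy⟩ := (hd (Finsupp.single b 1 - φ (d (Finsupp.single b 1)))).1
        (by rw [map_sub, hφ', hθ' b hb, sub_self])
      exact ⟨y, fun _ => hy⟩
    · exact ⟨0, fun h => absurd h hb⟩
  choose ψ hψ using hψ
  refine ⟨φ, Finsupp.linearCombination R ψ, fun b hb => ?_⟩
  rw [ContractsAt, Finsupp.linearCombination_single, one_smul, hψ b hb, sub_add_cancel]

/-- A periodic complex of free modules with a countable basis is contractible if it is so on each
finite set of basis elements: the projection to the cycles is the sum of the differences
`θ (k + 1) - θ k` of projections to finitely generated submodules. -/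
theorem exists_contraction_of_countable [Countable B] (hdd : ∀ x, d (d x) = 0)
    (hloc : ∀ A : Finset B, ∃ φ ψ : (B →₀ R) →ₗ[R] (B →₀ R), ∀ a ∈ A, ContractsAt d φ ψ a) :
    ∃ s : (B →₀ R) →ₗ[R] (B →₀ R), ∀ x, d (s x) + s (d x) = x := by
  classical
  -- Finitely generated submodules of the boundaries are fixed by some `d ∘ ρ`.
  have hfg : ∀ W : Submodule R (B →₀ R), W.FG → ∃ ρ : (B →₀ R) →ₗ[R] (B →₀ R),
      (LinearMap.range ρ).FG ∧ ∀ x ∈ W, d (ρ (d x)) = d x := by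
    intro W hW
    obtain ⟨A, hA⟩ : ∃ A : Finset B, W ≤ Finsupp.supported R R (A : Set B) := by
      obtain ⟨s, rfl⟩ := hW
      refine ⟨s.biUnion Finsupp.support, Submodule.span_le.2 fun x hx => ?_⟩
      rw [SetLike.mem_coe, Finsupp.mem_supported]
      exact_mod_cast Finset.subset_biUnion_of_mem Finsupp.support hx
    obtain ⟨φ, ψ, h⟩ := hloc A
    let F : Finset B := A.biUnion fun a => (d (Finsupp.single a 1)).support
    let π : (B →₀ R) →ₗ[R] (B →₀ R) := Finsupp.linearCombination R fun b =>
      if b ∈ F then Finsupp.single b 1 else 0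
    have hπ : ∀ x ∈ Finsupp.supported R R (F : Set B), π x = x := fun x hx =>
      eq_of_forall_single (f := π) (g := LinearMap.id) (fun b hb => by
        rw [Finsupp.linearCombination_single, if_pos (Finset.mem_coe.1 hb), one_smul]; rfl) hx
    refine ⟨φ ∘ₗ π, ?_, fun x hx => ?_⟩
    · rw [LinearMap.range_comp]
      refine Submodule.FG.map _ ?_
      rw [Finsupp.range_linearCombination]
      refine Submodule.fg_span (((F : Set B).toFinite.image fun b =>
        Finsupp.single b (1 : R)).insert 0 |>.subset ?_)
      rintro _ ⟨b, rfl⟩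
      by_cases hb : b ∈ F
      · right; exact ⟨b, hb, by simp [hb]⟩
      · left; simp [hb]
    · have hx' := hA hx
      have hdx : d x ∈ Finsupp.supported R R (F : Set B) :=
        mem_supported_of_forall_single (fun b hb => by
          rw [Finsupp.mem_supported]
          exact_mod_cast Finset.subset_biUnion_of_mem
            (fun a => (d (Finsupp.single a 1)).support) hb) hx'
      rw [LinearMap.comp_apply, hπ _ hdx]
      have := congrArg d (contractsAt_supported (C := (A : Set B)) h hx')
      rwa [map_add, hdd, zero_add] at this
  choose ρ hρ1 hρ2 using hfg
  cases isEmpty_or_nonempty B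
  · exact ⟨0, fun x => Subsingleton.elim _ _⟩
  obtain ⟨e, he⟩ := exists_surjective_nat B
  -- With a surjection `e : ℕ → B`, choose `r (k + 1)` so that `d ∘ r (k + 1)` fixes the boundaries
  -- `d (r k x)` and `d (e k)`.
  let next : ℕ → {r : (B →₀ R) →ₗ[R] (B →₀ R) // (LinearMap.range r).FG} →
      {r : (B →₀ R) →ₗ[R] (B →₀ R) // (LinearMap.range r).FG} := fun k r =>
    ⟨ρ (LinearMap.range r.1 ⊔ Submodule.span R {Finsupp.single (e k) 1})
      (r.2.sup (Submodule.fg_span_singleton _)), hρ1 _ _⟩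
  let r : ℕ → {r : (B →₀ R) →ₗ[R] (B →₀ R) // (LinearMap.range r).FG} := fun k =>
    Nat.rec ⟨0, by rw [LinearMap.range_zero]; exact Submodule.fg_bot⟩ next k
  let θ : ℕ → (B →₀ R) →ₗ[R] (B →₀ R) := fun k => d ∘ₗ (r k).1
  have hθ1 : ∀ k x, θ (k + 1) (θ k x) = θ k x := fun k x =>
    hρ2 _ (r k |>.2.sup (Submodule.fg_span_singleton _)) ((r k).1 x)
      (Submodule.mem_sup_left ⟨x, rfl⟩)
  have hθ2 : ∀ k, θ (k + 1) (d (Finsupp.single (e k) 1)) = d (Finsupp.single (e k) 1) := fun k =>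
    hρ2 _ (r k |>.2.sup (Submodule.fg_span_singleton _)) (Finsupp.single (e k) 1)
      (Submodule.mem_sup_right (Submodule.mem_span_singleton_self _))
  have hθ3 : ∀ k l, k < l → ∀ x, θ l (θ k x) = θ k x := by
    intro k l hkl x
    induction l, hkl using Nat.le_induction with
    | base => exact hθ1 k x
    | succ l _ ih => rw [← ih, hθ1]
  have hθ4 : ∀ x, ∃ n, ∀ l ≥ n, θ l (d x) = d x := by
    intro x
    induction x using Finsupp.induction_linear with
    | zero => exact ⟨0, by simp⟩
    | add x y hx hy =>
      obtain ⟨n, hn⟩ := hx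
      obtain ⟨m, hm⟩ := hy
      exact ⟨max n m, fun l hl => by
        rw [map_add, map_add, hn l (le_of_max_le_left hl), hm l (le_of_max_le_right hl)]⟩
    | single b a =>
      obtain ⟨k, rfl⟩ := he b
      refine ⟨k + 1, fun l hl => ?_⟩
      have h1 : θ l (d (Finsupp.single (e k) 1)) = d (Finsupp.single (e k) 1) := by
        obtain rfl | hlt := hl.eq_or_lt
        · exact hθ2 k
        · rw [← hθ2 k, hθ3 _ _ hlt]
      have h2 : Finsupp.single (e k) a = a • Finsupp.single (e k) (1 : R) := by simp
      rw [h2, map_smul, map_smul, h1]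
  -- On boundaries the differences `δ k` are almost all zero and add up to the identity; hence
  -- `σ y = ∑ r (k + 2) (δ k y)` is a section of `d`.
  let δ : ℕ → (B →₀ R) →ₗ[R] (B →₀ R) := fun k => θ (k + 1) - θ k
  have hδ : ∀ x, ∃ n, ∀ k ≥ n, δ k (d x) = 0 := fun x => by
    obtain ⟨n, hn⟩ := hθ4 x
    exact ⟨n, fun k hk => by
      rw [LinearMap.sub_apply, hn k hk, hn (k + 1) (by lia), sub_self]⟩
  have hfin : ∀ y ∈ LinearMap.range d, (Function.support fun k => δ k y).Finite := by
    rintro _ ⟨x, rfl⟩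
    obtain ⟨n, hn⟩ := hδ x
    refine (Set.finite_lt_nat n).subset fun k hk => ?_
    by_contra hk'
    exact hk (hn k (not_lt.1 hk'))
  let σ₁ : LinearMap.range d →ₗ[R] (ℕ →₀ (B →₀ R)) :=
    { toFun := fun y => Finsupp.ofSupportFinite (fun k => δ k y) (hfin y y.2)
      map_add' := fun y z => by ext1 k; exact map_add (δ k) _ _
      map_smul' := fun a y => by ext1 k; exact map_smul (δ k) _ _ }
  let σ : LinearMap.range d →ₗ[R] (B →₀ R) := Finsupp.lsum R (fun k => (r (k + 2)).1) ∘ₗ σ₁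
  have hσ : ∀ y : LinearMap.range d, d (σ y) = y := by
    rintro ⟨_, x, rfl⟩
    obtain ⟨n, hn⟩ := hθ4 x
    have hsupp : (σ₁ ⟨d x, x, rfl⟩).support ⊆ Finset.range n := fun k hk => by
      by_contra hk'
      rw [Finsupp.mem_support_iff] at hk
      refine hk ?_
      change δ k (d x) = 0
      have := not_lt.1 (fun h => hk' (Finset.mem_range.2 h))
      rw [LinearMap.sub_apply, hn k this, hn (k + 1) (by lia), sub_self]
    change d (Finsupp.sum (σ₁ ⟨d x, x, rfl⟩) fun k => (r (k + 2)).1) = d x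
    rw [Finsupp.sum_of_support_subset _ hsupp _ (fun _ _ => map_zero _), map_sum]
    have h1 : ∀ k ∈ Finset.range n, d ((r (k + 2)).1 (σ₁ ⟨d x, x, rfl⟩ k)) =
        θ (k + 1) (d x) - θ k (d x) := fun k _ => by
      change θ (k + 2) (δ k (d x)) = _
      rw [LinearMap.sub_apply, map_sub, hθ3 (k + 1) (k + 2) (by lia), hθ3 k (k + 2) (by lia)]
    rw [Finset.sum_congr rfl h1, Finset.sum_range_sub (fun k => θ k (d x)), hn n le_rfl]
    have h0 : θ 0 (d x) = 0 := map_zero d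
    rw [h0, sub_zero]
  have hker : ∀ x, d x = 0 → x ∈ LinearMap.range d := fun x hx => by
    obtain ⟨φ, ψ, h⟩ := hloc x.support
    have := contractsAt_supported (C := (x.support : Set B)) h
      (Finsupp.mem_supported R x |>.2 subset_rfl)
    rw [hx, map_zero, add_zero] at this
    exact ⟨_, this⟩
  have hx : ∀ x, x - σ ⟨d x, x, rfl⟩ ∈ LinearMap.range d := fun x =>
    hker _ (by rw [map_sub, hσ, sub_self])
  let s : (B →₀ R) →ₗ[R] (B →₀ R) :=
    σ ∘ₗ (LinearMap.id - σ ∘ₗ d.rangeRestrict).codRestrict (LinearMap.range d) hx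
  refine ⟨s, fun x => ?_⟩
  have h1 : d (s x) = x - σ ⟨d x, x, rfl⟩ := hσ _
  have h2 : s (d x) = σ ⟨d x, x, rfl⟩ := by
    refine congrArg σ (Subtype.ext ?_)
    change d x - σ (d.rangeRestrict (d x)) = d x
    have : d.rangeRestrict (d x) = 0 := Subtype.ext (hdd x)
    rw [this, map_zero, sub_zero]
  rw [h1, h2, sub_add_cancel]

/-- The contraction of a periodic complex on a countable set of basis elements that is stable under
the differential and under partial contractions for its finite subsets. -/
theorem exists_contraction_on_countable {C : Set B} (hC : C.Countable) (hdd : ∀ x, d (d x) = 0)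
    (hdC : ∀ b ∈ C, d (Finsupp.single b 1) ∈ Finsupp.supported R R C)
    (hloc : ∀ A : Finset B, (A : Set B) ⊆ C → ∃ φ ψ : (B →₀ R) →ₗ[R] (B →₀ R),
      (∀ b ∈ C, φ (Finsupp.single b 1) ∈ Finsupp.supported R R C ∧
        ψ (Finsupp.single b 1) ∈ Finsupp.supported R R C) ∧ ∀ a ∈ A, ContractsAt d φ ψ a) :
    ∃ t : (B →₀ R) →ₗ[R] (B →₀ R), (∀ x, t x ∈ Finsupp.supported R R C) ∧
      ∀ x ∈ Finsupp.supported R R C, d (t x) + t (d x) = x := by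
  classical
  have := hC.to_subtype
  let i : (C →₀ R) →ₗ[R] (B →₀ R) := Finsupp.lmapDomain R R Subtype.val
  let q : (B →₀ R) →ₗ[R] (C →₀ R) := Finsupp.lsubtypeDomain C
  have hiq : ∀ x ∈ Finsupp.supported R R C, i (q x) = x := fun x => lmapDomain_lsubtypeDomain
  have hqi : ∀ x, q (i x) = x := lsubtypeDomain_lmapDomain
  have hi : ∀ x, i x ∈ Finsupp.supported R R C := lmapDomain_mem_supported
  have hd : ∀ x, i (q (d (i x))) = d (i x) := fun x =>
    hiq _ (mem_supported_of_forall_single hdC (hi x))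
  obtain ⟨s, hs⟩ := exists_contraction_of_countable (d := q ∘ₗ d ∘ₗ i)
    (fun x => by simp only [LinearMap.comp_apply, hd, hdd, map_zero]) (fun A => by
      obtain ⟨φ, ψ, h1, h2⟩ := hloc (A.map ⟨Subtype.val, Subtype.val_injective⟩) (by simp)
      refine ⟨q ∘ₗ φ ∘ₗ i, q ∘ₗ ψ ∘ₗ i, fun a ha => ?_⟩
      have hia : i (Finsupp.single a 1) = Finsupp.single a.1 1 := Finsupp.mapDomain_single
      have hψ := hiq _ (h1 a.1 a.2).2
      have := h2 a.1 (Finset.mem_map_of_mem _ ha)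
      rw [ContractsAt] at this ⊢
      simp only [LinearMap.comp_apply, hd]
      rw [hia, hψ, ← map_add, this, ← hia, hqi])
  refine ⟨i ∘ₗ s ∘ₗ q, fun x => hi _, fun x hx => ?_⟩
  have h1 := congrArg i (hs (q x))
  simp only [LinearMap.comp_apply, map_add, hd] at h1
  rw [hiq x hx] at h1
  exact h1

/-- Each element lies in a countable set that is closed under a map between finite subsets. -/
theorem exists_countable_closed (F : Finset B → Finset B) (b : B) :
    ∃ C : Set B, C.Countable ∧ b ∈ C ∧ ∀ A : Finset B, (A : Set B) ⊆ C → (F A : Set B) ⊆ C := by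
  let next : Set B → Set B := fun C => C ∪ ⋃ A ∈ {A : Finset B | (A : Set B) ⊆ C}, (F A : Set B)
  have hnext : ∀ C : Set B, C.Countable → (next C).Countable := fun C hC => by
    refine hC.union (Set.Countable.biUnion ?_ fun A _ => (F A).countable_toSet)
    refine ((Set.countable_ofPred_finite_subset hC).preimage
      (f := fun A : Finset B => (A : Set B)) Finset.coe_injective).mono fun A hA => ?_
    exact ⟨A.finite_toSet, hA⟩
  let C : ℕ → Set B := fun n => next^[n] {b}
  have hC : ∀ n, C (n + 1) = next (C n) := fun n => Function.iterate_succ_apply' next n {b}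
  have hmono : Monotone C := monotone_nat_of_le_succ fun n => by
    rw [hC]
    exact Set.subset_union_left
  refine ⟨⋃ n, C n, Set.countable_iUnion fun n => ?_, Set.mem_iUnion.2 ⟨0, rfl⟩, fun A hA => ?_⟩
  · induction n with
    | zero => exact Set.countable_singleton b
    | succ n ih => rw [hC]; exact hnext _ ih
  · obtain ⟨n, hn⟩ := Directed.exists_mem_subset_of_finset_subset_biUnion hmono.directed_le hA
    refine Set.Subset.trans ?_ (Set.subset_iUnion C (n + 1))
    rw [hC]
    exact Set.Subset.trans (Set.subset_biUnion_of_mem (u := fun A : Finset B => (F A : Set B))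
      (show A ∈ {A : Finset B | (A : Set B) ⊆ C n} from hn)) Set.subset_union_right

variable (d) in
/-- `s` is a contraction of the subcomplex spanned by the set `C` of basis elements. -/
structure IsContractionOn (C : Set B) (s : (B →₀ R) →ₗ[R] (B →₀ R)) : Prop where
  stable : ∀ b ∈ C, d (Finsupp.single b 1) ∈ Finsupp.supported R R C
  mem : ∀ x, s x ∈ Finsupp.supported R R C
  contracts : ∀ b ∈ C, ContractsAt d s s b

/-- A contraction on `C` can be extended by a countable set of basis elements. The chain map
`r = d s + s d` is a projection to the subcomplex spanned by `C`, so `s` is glued with a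
contraction `t` of a countable subcomplex that is stable under `r`. -/
theorem IsContractionOn.exists_extension (hdd : ∀ x, d (d x) = 0)
    (hloc : ∀ A : Finset B, ∃ φ ψ : (B →₀ R) →ₗ[R] (B →₀ R), ∀ a ∈ A, ContractsAt d φ ψ a)
    {C : Set B} {s : (B →₀ R) →ₗ[R] (B →₀ R)} (h : IsContractionOn d C s) (b : B) :
    ∃ (C' : Set B) (s' : (B →₀ R) →ₗ[R] (B →₀ R)), IsContractionOn d C' s' ∧ C ⊆ C' ∧ b ∈ C' ∧
      ∀ a ∈ C, s (Finsupp.single a 1) = s' (Finsupp.single a 1) := by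
  classical
  choose φ ψ hφψ using hloc
  obtain ⟨D, hD, hbD, hF⟩ := exists_countable_closed (fun A : Finset B =>
    A.biUnion fun a => (d (Finsupp.single a 1)).support ∪ (s (Finsupp.single a 1)).support ∪
      A.powerset.biUnion fun A' => (φ A' (Finsupp.single a 1)).support ∪
        (ψ A' (Finsupp.single a 1)).support) b
  have hF' : ∀ a ∈ D, ∀ A : Finset B, (A : Set B) ⊆ D →
      d (Finsupp.single a 1) ∈ Finsupp.supported R R D ∧
      s (Finsupp.single a 1) ∈ Finsupp.supported R R D ∧
      φ A (Finsupp.single a 1) ∈ Finsupp.supported R R D ∧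
      ψ A (Finsupp.single a 1) ∈ Finsupp.supported R R D := by
    intro a ha A hA
    have h1 := hF (insert a A) (by
      rw [Finset.coe_insert]
      exact Set.insert_subset ha hA)
    have h2 := Set.Subset.trans (Finset.coe_subset.2
      (Finset.subset_biUnion_of_mem _ (Finset.mem_insert_self a A))) h1
    have h3 : ∀ x : B →₀ R, x.support ⊆ (φ A (Finsupp.single a 1)).support ∪
        (ψ A (Finsupp.single a 1)).support → x ∈ Finsupp.supported R R D := fun x hx => by
      refine (Finsupp.mem_supported R x).2 (Set.Subset.trans (Finset.coe_subset.2 ?_) h2)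
      exact (hx.trans (Finset.subset_biUnion_of_mem (fun A' => (φ A' (Finsupp.single a 1)).support ∪
        (ψ A' (Finsupp.single a 1)).support)
        (Finset.mem_powerset.2 (Finset.subset_insert a A)))).trans Finset.subset_union_right
    have h4 : ∀ x : B →₀ R, x.support ⊆ (d (Finsupp.single a 1)).support ∪
        (s (Finsupp.single a 1)).support → x ∈ Finsupp.supported R R D := fun x hx => by
      refine (Finsupp.mem_supported R x).2 (Set.Subset.trans (Finset.coe_subset.2 ?_) h2)
      exact hx.trans Finset.subset_union_left
    exact ⟨h4 _ Finset.subset_union_left, h4 _ Finset.subset_union_right,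
      h3 _ Finset.subset_union_left, h3 _ Finset.subset_union_right⟩
  have hdD : ∀ a ∈ D, d (Finsupp.single a 1) ∈ Finsupp.supported R R D := fun a ha =>
    (hF' a ha ∅ (by simp)).1
  have hsD : ∀ a ∈ D, s (Finsupp.single a 1) ∈ Finsupp.supported R R D := fun a ha =>
    (hF' a ha ∅ (by simp)).2.1
  obtain ⟨t, ht1, ht2⟩ := exists_contraction_on_countable hD hdd hdD fun A hA =>
    ⟨φ A, ψ A, fun a ha => (hF' a ha A hA).2.2, hφψ A⟩
  let r : (B →₀ R) →ₗ[R] (B →₀ R) := d ∘ₗ s + s ∘ₗ d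
  have hr : ∀ x, r x = d (s x) + s (d x) := fun _ => rfl
  have hrC : ∀ x, r x ∈ Finsupp.supported R R C := fun x =>
    add_mem (mem_supported_of_forall_single h.stable (h.mem x)) (h.mem _)
  have hrid : ∀ x ∈ Finsupp.supported R R C, r x = x := fun x hx =>
    contractsAt_supported h.contracts hx
  have hrD : ∀ x ∈ Finsupp.supported R R D, r x ∈ Finsupp.supported R R D := fun x hx =>
    add_mem (mem_supported_of_forall_single hdD (mem_supported_of_forall_single hsD hx))
      (mem_supported_of_forall_single hsD (mem_supported_of_forall_single hdD hx))
  have hrd : ∀ x, r (d x) = d (r x) := fun x => by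
    rw [hr, hr, hdd, map_zero, map_add, hdd, add_zero, zero_add]
  let s' : (B →₀ R) →ₗ[R] (B →₀ R) :=
    s ∘ₗ r + (LinearMap.id - r) ∘ₗ t ∘ₗ (LinearMap.id - r)
  have hs' : ∀ x, s' x = s (r x) + (t (x - r x) - r (t (x - r x))) := fun _ => rfl
  refine ⟨C ∪ D, s', ⟨?_, ?_, ?_⟩, Set.subset_union_left, Or.inr hbD, fun a ha => ?_⟩
  · rintro a (ha | ha)
    · exact Finsupp.supported_mono Set.subset_union_left (h.stable a ha)
    · exact Finsupp.supported_mono Set.subset_union_right (hdD a ha)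
  · intro x
    rw [hs']
    exact add_mem (Finsupp.supported_mono Set.subset_union_left (h.mem _))
      (Finsupp.supported_mono Set.subset_union_right (sub_mem (ht1 _) (hrD _ (ht1 _))))
  · intro a ha
    rw [ContractsAt]
    generalize hx : Finsupp.single a (1 : R) = x
    have hxr : x - r x ∈ Finsupp.supported R R D := by
      rcases ha with ha | ha
      · rw [hrid x (hx ▸ Finsupp.single_mem_supported R 1 ha), sub_self]
        exact zero_mem _
      · have hxD : x ∈ Finsupp.supported R R D := hx ▸ Finsupp.single_mem_supported R 1 ha
        exact sub_mem hxD (hrD x hxD)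
    have h1 := ht2 _ hxr
    have h2 : d (s (r x)) + s (d (r x)) = r x := hrid _ (hrC x)
    have h3 : r (r x) = r x := hrid _ (hrC x)
    have h4 : r (x - r x) = 0 := by rw [map_sub, h3, sub_self]
    have h5 := congrArg r h1
    rw [h4, map_add] at h5
    rw [hs', hs', hrd, ← map_sub, map_add, map_sub, ← hrd]
    linear_combination (norm := abel) h1 + h2 - h5
  · have hx : Finsupp.single a (1 : R) ∈ Finsupp.supported R R C :=
      Finsupp.single_mem_supported R 1 ha
    rw [hs', hrid _ hx, sub_self, map_zero, map_zero, sub_zero, add_zero]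

/-- A periodic complex of free modules is contractible if it is so on each finite set of basis
elements. -/
theorem exists_contraction (hdd : ∀ x, d (d x) = 0)
    (hloc : ∀ A : Finset B, ∃ φ ψ : (B →₀ R) →ₗ[R] (B →₀ R), ∀ a ∈ A, ContractsAt d φ ψ a) :
    ∃ s : (B →₀ R) →ₗ[R] (B →₀ R), ∀ x, d (s x) + s (d x) = x := by
  classical
  let α := {p : Set B × ((B →₀ R) →ₗ[R] (B →₀ R)) // IsContractionOn d p.1 p.2}
  let le : α → α → Prop := fun p q => p.1.1 ⊆ q.1.1 ∧
    ∀ b ∈ p.1.1, p.1.2 (Finsupp.single b 1) = q.1.2 (Finsupp.single b 1)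
  -- Contractions are ordered by extension; the union `v` of a chain is defined on basis elements.
  obtain ⟨⟨⟨C, s⟩, hs⟩, hmax⟩ := exists_maximal_of_chains_bounded (r := le) (fun c hc => by
    let v : B → (B →₀ R) := fun b =>
      if h : ∃ p ∈ c, b ∈ p.1.1 then h.choose.1.2 (Finsupp.single b 1) else 0
    have hv : ∀ p ∈ c, ∀ b ∈ p.1.1, v b = p.1.2 (Finsupp.single b 1) := fun p hp b hb => by
      have h : ∃ p ∈ c, b ∈ p.1.1 := ⟨p, hp, hb⟩
      have hq := h.choose_spec
      simp only [v, dif_pos h]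
      by_cases hpq : h.choose = p
      · rw [hpq]
      · rcases hc hq.1 hp hpq with hle | hle
        · exact hle.2 b hq.2
        · exact (hle.2 b hb).symm
    let s : (B →₀ R) →ₗ[R] (B →₀ R) := Finsupp.linearCombination R v
    have hs : ∀ b, s (Finsupp.single b 1) = v b := fun b => by
      rw [Finsupp.linearCombination_single, one_smul]
    have hsub : ∀ p ∈ c, p.1.1 ⊆ ⋃ p ∈ c, p.1.1 := fun p hp =>
      Set.subset_biUnion_of_mem (u := fun p : α => p.1.1) hp
    refine ⟨⟨⟨⋃ p ∈ c, p.1.1, s⟩, ⟨?_, ?_, ?_⟩⟩, fun p hp =>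
      ⟨hsub p hp, fun b hb => ((hs b).trans (hv p hp b hb)).symm⟩⟩
    · intro b hb
      obtain ⟨p, hp, hb⟩ := Set.mem_iUnion₂.1 hb
      exact Finsupp.supported_mono (hsub p hp) (p.2.stable b hb)
    · intro x
      refine mem_supported_of_forall_single (C := Set.univ) (fun b _ => ?_) (by simp)
      rw [hs]
      by_cases h : ∃ p ∈ c, b ∈ p.1.1
      · obtain ⟨p, hp, hb⟩ := h
        rw [hv p hp b hb]
        exact Finsupp.supported_mono (hsub p hp) (p.2.mem _)
      · simp only [v, dif_neg h]
        exact zero_mem _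
    · intro b hb
      obtain ⟨p, hp, hb⟩ := Set.mem_iUnion₂.1 hb
      have h1 : s (d (Finsupp.single b 1)) = p.1.2 (d (Finsupp.single b 1)) :=
        eq_of_forall_single (fun a ha => (hs a).trans (hv p hp a ha)) (p.2.stable b hb)
      change d (s _) + s (d _) = _
      rw [h1, hs, hv p hp b hb]
      exact p.2.contracts b hb)
    (fun {p q r} h1 h2 => ⟨h1.1.trans h2.1, fun b hb => (h1.2 b hb).trans (h2.2 b (h1.1 hb))⟩)
  refine ⟨s, fun x => contractsAt_supported (C := Set.univ) (fun b _ => ?_) (by simp)⟩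
  obtain ⟨C', s', hs', hCC', hb, hss'⟩ := hs.exists_extension hdd hloc b
  exact hs.contracts b ((hmax ⟨⟨C', s'⟩, hs'⟩ ⟨hCC', hss'⟩).1 hb)

end Contraction

section

variable {M P : Type u} [AddCommGroup M] [Module R M] [AddCommGroup P] [Module R P]

/-- The case of a free middle term. The sequence is spliced with itself to a periodic complex, and a
contraction of that splits it. -/
theorem projective_of_isShortExact_finsupp [Module.Flat R M] {B : Type u} {f : M →ₗ[R] (B →₀ R)}
    {g : (B →₀ R) →ₗ[R] M} (h : IsShortExact f g) : Module.Projective R M := by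
  let d := f ∘ₗ g
  have hker : LinearMap.ker d = LinearMap.ker g :=
    LinearMap.ker_comp_of_ker_eq_bot _ (LinearMap.ker_eq_bot.2 h.inj)
  have hrange : LinearMap.range d = LinearMap.ker g := by
    rw [LinearMap.range_comp_of_range_eq_top _ (LinearMap.range_eq_top.2 h.surj)]
    exact (LinearMap.exact_iff.1 h.exact).symm
  have hd : Function.Exact d d := LinearMap.exact_iff.2 (hker.trans hrange.symm)
  have hfl : Module.Flat R ((B →₀ R) ⧸ LinearMap.range d) :=
    .of_linearEquiv ((Submodule.quotEquivOfEq _ _ hrange).trans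
      (g.quotKerEquivOfSurjective h.surj))
  obtain ⟨s, hs⟩ := exists_contraction (fun x => hd.apply_apply_eq_zero x)
    (exists_contractsAt_of_flat hd hfl)
  refine Module.Projective.of_split f (g ∘ₗ s) (LinearMap.ext fun y => h.inj ?_)
  have := hs (f y)
  have h0 : d (f y) = 0 := by
    change f (g (f y)) = 0
    rw [h.exact.apply_apply_eq_zero, map_zero]
  rwa [h0, map_zero, add_zero] at this

/-- A projective module becomes free after adding a free module (Eilenberg's swindle). -/
theorem exists_free_prod_equiv [Module.Projective R P] :
    ∃ (W : Type u) (_ : AddCommGroup W) (_ : Module R W), Module.Free R W ∧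
      Nonempty ((P × W) ≃ₗ[R] W) := by
  obtain ⟨L, _, _, p, _, hp⟩ := exists_free_surjective (R := R) P
  obtain ⟨i, hi⟩ := Module.projective_lifting_property p LinearMap.id hp
  let Q := LinearMap.ker p
  let e1 : L ≃ₗ[R] Q × P := (Function.Exact.splitSurjectiveEquiv (LinearMap.exact_subtype_ker_map p)
    Subtype.val_injective ⟨i, hi⟩).1
  let e2 : (ℕ →₀ (Q × P)) ≃ₗ[R] (ℕ →₀ P) × (ℕ →₀ Q) := LinearEquiv.ofLinearMap
    ((Finsupp.mapRange.linearMap (LinearMap.snd R Q P)).prod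
      (Finsupp.mapRange.linearMap (LinearMap.fst R Q P)))
    ((Finsupp.mapRange.linearMap (LinearMap.inr R Q P)).coprod
      (Finsupp.mapRange.linearMap (LinearMap.inl R Q P)))
    (by ext <;> simp) (by ext <;> simp)
  let e3 : (ℕ →₀ P) ≃ₗ[R] P × (ℕ →₀ P) :=
    Finsupp.domLCongr (Equiv.natSumPUnitEquivNat.{0}.symm.trans (Equiv.sumComm _ _)) ≪≫ₗ
      Finsupp.sumFinsuppLEquivProdFinsupp R ≪≫ₗ
      (Finsupp.uniqueLinearEquiv R P PUnit.unit).prodCongr (LinearEquiv.refl R _)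
  let e4 : (ℕ →₀ L) ≃ₗ[R] (ℕ →₀ P) × (ℕ →₀ Q) := Finsupp.mapRange.linearEquiv e1 ≪≫ₗ e2
  exact ⟨ℕ →₀ L, inferInstance, inferInstance, inferInstance,
    ⟨(LinearEquiv.refl R P).prodCongr e4 ≪≫ₗ (LinearEquiv.prodAssoc R P _ _).symm ≪≫ₗ
      e3.symm.prodCongr (LinearEquiv.refl R _) ≪≫ₗ e4.symm⟩⟩

/-- A flat module `M` with an exact sequence `0 → M → P → M → 0`, where `P` is projective, is
projective (Benson and Goodearl). Adding `0 → W → W × W → W → 0` makes the middle term free. -/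
theorem projective_of_isShortExact_self [Module.Flat R M] [Module.Projective R P] {f : M →ₗ[R] P}
    {g : P →ₗ[R] M} (h : IsShortExact f g) : Module.Projective R M := by
  obtain ⟨W, _, _, _, ⟨e⟩⟩ := exists_free_prod_equiv (R := R) (P := P)
  let b := Module.Free.chooseBasis R (W × W)
  let e' : (P × (W × W)) ≃ₗ[R] (Module.Free.ChooseBasisIndex R (W × W) →₀ R) :=
    (LinearEquiv.prodAssoc R P W W).symm ≪≫ₗ e.prodCongr (LinearEquiv.refl R W) ≪≫ₗ b.repr
  have hs : IsShortExact (e'.toLinearMap ∘ₗ f.prodMap (LinearMap.inl R W W))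
      (g.prodMap (LinearMap.snd R W W) ∘ₗ e'.symm.toLinearMap) := by
    refine ⟨e'.injective.comp (h.inj.prodMap LinearMap.inl_injective), fun y => ?_,
      (h.surj.prodMap (LinearMap.snd_surjective (R := R))).comp e'.symm.surjective⟩
    obtain ⟨⟨x, w, w'⟩, rfl⟩ := e'.surjective y
    simp only [LinearMap.comp_apply, LinearEquiv.coe_coe, LinearEquiv.symm_apply_apply,
      LinearMap.prodMap_apply, LinearMap.snd_apply, Prod.mk_eq_zero, h.exact x, Set.mem_range,
      EmbeddingLike.apply_eq_iff_eq, Prod.exists, LinearMap.inl_apply, Prod.mk.injEq]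
    constructor
    · rintro ⟨⟨m, rfl⟩, rfl⟩
      exact ⟨m, w, rfl, rfl, rfl⟩
    · rintro ⟨m, w, rfl, rfl, rfl⟩
      exact ⟨⟨m, rfl⟩, rfl⟩
  have : Module.Flat R (M × W) := (flatDimLT_one_iff _ _).1 (.prod (.of_flat 0) (.of_flat 0))
  have := projective_of_isShortExact_finsupp hs
  exact Module.Projective.of_split (LinearMap.inl R M W) (LinearMap.fst R M W) (by ext; simp)

end

end PeriodicFlat

/-! ### Global dimension of the factors of an SG ring -/

section NotSG

variable {R : Type u} [CommRing R]

/-- A module `M` of flat dimension at most `n` with an exact sequence `0 → M → P → M → 0`, where `P`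
has projective dimension at most `n`, has projective dimension at most `n`. Syzygies of the sequence
have the same shape, so this is reduced to flat modules. -/
theorem projDimLT_of_isShortExact_self {n : ℕ} {M P : Type u} [AddCommGroup M] [Module R M]
    [AddCommGroup P] [Module R P] {f : M →ₗ[R] P} {g : P →ₗ[R] M} (h : IsShortExact f g)
    (hM : FlatDimLT R M (n + 1)) (hP : ProjDimLT R P (n + 1)) : ProjDimLT R M (n + 1) := by
  induction n generalizing M P with
  | zero =>
    have := (flatDimLT_one_iff _ _).1 hM
    have := (projDimLT_one_iff _ _).1 hP
    exact (projDimLT_one_iff _ _).2 (projective_of_isShortExact_self h)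
  | succ n ih =>
    obtain ⟨L, _, _, p, _, hp⟩ := exists_free_surjective (R := R) M
    obtain ⟨q, hq⟩ := Module.projective_lifting_property g p h.surj
    have hq' : ∀ l, g (q l) = p l := fun l => LinearMap.congr_fun hq l
    -- A horseshoe: `π` covers `P` compatibly with `p`, so the kernels form a sequence `a, b` of the
    -- same shape.
    let π : L × L →ₗ[R] P := (f ∘ₗ p).coprod q
    have hπg : ∀ l, g (π l) = p l.2 := fun l => by
      simp [π, hq', h.exact.apply_apply_eq_zero]
    have hπ : Function.Surjective π := fun y => by
      obtain ⟨l₂, hl₂⟩ := hp (g y)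
      obtain ⟨m, hm⟩ := (h.exact (y - q l₂)).1 (by rw [map_sub, hq', hl₂, sub_self])
      obtain ⟨l₁, rfl⟩ := hp m
      exact ⟨(l₁, l₂), by simp [π, hm]⟩
    let a : LinearMap.ker p →ₗ[R] LinearMap.ker π :=
      (LinearMap.inl R L L ∘ₗ (LinearMap.ker p).subtype).codRestrict _ fun k => by simp [π]
    let b : LinearMap.ker π →ₗ[R] LinearMap.ker p :=
      (LinearMap.snd R L L ∘ₗ (LinearMap.ker π).subtype).codRestrict _ fun k => by
        rw [LinearMap.mem_ker]
        change p k.1.2 = 0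
        rw [← hπg, LinearMap.mem_ker.1 k.2, map_zero]
    have hab : IsShortExact a b := by
      refine ⟨fun x y hxy => Subtype.ext (congrArg (fun z => z.1.1) hxy), fun y => ?_, fun k => ?_⟩
      · constructor
        · intro hy
          have h2 : y.1.2 = 0 := congrArg Subtype.val hy
          have h1 : f (p y.1.1) = 0 := by
            have h3 : f (p y.1.1) + q y.1.2 = 0 := y.2
            rwa [h2, map_zero, add_zero] at h3
          exact ⟨⟨y.1.1, h.inj (h1.trans (map_zero f).symm)⟩, Subtype.ext (Prod.ext rfl h2.symm)⟩
        · rintro ⟨k, rfl⟩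
          rfl
      · obtain ⟨m, hm⟩ := (h.exact (q k)).1 (by rw [hq', LinearMap.mem_ker.1 k.2])
        obtain ⟨l, rfl⟩ := hp m
        exact ⟨⟨(-l, k), by simp [π, hm]⟩, rfl⟩
    have hs := IsShortExact.of_surjective hp
    exact hs.projDimLT_right (ih hab (hs.flatDimLT_left (.of_flat _) hM)
      ((IsShortExact.of_surjective hπ).projDimLT_left (.of_projective _) hP)) (.of_projective _)

variable {T S : Type u} [CommRing T] [CommRing S] [Algebra R T] [Algebra R S]

/-- In a product that is an `n`-SG ring, a factor with weak dimension at most `n` has global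
dimension at most `n`. -/
theorem IsProductRing.gldim_le_of_isSG (h : IsProductRing R T S) {n : ℕ} (hS : wdim S ≤ n)
    (hR : IsSG R n) : gldim S ≤ (n : WithBot ℕ∞) := by
  rw [gldim_le_iff]
  intro N _ _
  let : Module R N := Module.compHom N (algebraMap R S)
  have : IsScalarTower R S N := .of_compHom _ _ _
  have := h.symm.flat_left
  obtain ⟨⟨P, f, g, hf, hfg, hg, hP⟩, -⟩ := hR (ModuleCat.of R N)
  have hN : FlatDimLT R N (n + 1) := (wdim_le_iff.1 hS N).restrictScalars
  have hN' : ProjDimLT R N (n + 1) := projDimLT_of_isShortExact_self (M := N) (f := f) (g := g)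
    ⟨hf, hfg, hg⟩ hN ((projectiveDimension_le_iff _ n).1 hP)
  exact (hN'.baseChange S).of_equiv (baseChangeEquivOfSurjective h.symm.surjective_left N).symm

end NotSG

/-! ### Products with truncated polynomial rings -/

section Examples

variable (K : Type u) [Field K] (S : Type u) [CommRing S]

/-- In `K[X] / (X ^ (i + j))` the annihilator of `X ^ i` is generated by `X ^ j`. -/
theorem truncatedPoly_pow_mul_eq_zero_iff {i j m : ℕ} (hm : i + j = m) (t : TruncatedPoly K m) :
    (Ideal.Quotient.mk (Ideal.span {X ^ m}) X : TruncatedPoly K m) ^ i * t = 0 ↔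
      ∃ z, (Ideal.Quotient.mk (Ideal.span {X ^ m}) X : TruncatedPoly K m) ^ j * z = t := by
  subst hm
  obtain ⟨p, rfl⟩ := Ideal.Quotient.mk_surjective t
  rw [← map_pow, ← map_mul, Ideal.Quotient.eq_zero_iff_mem, Ideal.mem_span_singleton, pow_add,
    mul_dvd_mul_iff_left (pow_ne_zero _ X_ne_zero)]
  constructor
  · rintro ⟨q, rfl⟩
    exact ⟨Ideal.Quotient.mk _ q, by rw [← map_pow, ← map_mul]⟩
  · rintro ⟨z, hz⟩
    obtain ⟨q, rfl⟩ := Ideal.Quotient.mk_surjective z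
    rw [← map_pow, ← map_mul, eq_comm, Ideal.Quotient.eq, Ideal.mem_span_singleton] at hz
    have h := (dvd_mul_left ((X : K[X]) ^ j) (X ^ i)).trans hz
    exact (dvd_sub_left (dvd_mul_right _ _)).1 h

theorem isProductRing_prod (T : Type u) [CommRing T] :
    letI : Algebra (T × S) T := (RingHom.fst T S).toAlgebra
    letI : Algebra (T × S) S := (RingHom.snd T S).toAlgebra
    IsProductRing (T × S) T S :=
  Function.bijective_id

theorem isWSG_truncatedPoly_two_prod {n : ℕ} (hS : wdim S ≤ n) :
    IsWSG (TruncatedPoly K 2 × S) n :=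
  letI : Algebra (TruncatedPoly K 2 × S) (TruncatedPoly K 2) :=
    (RingHom.fst (TruncatedPoly K 2) S).toAlgebra
  letI : Algebra (TruncatedPoly K 2 × S) S := (RingHom.snd (TruncatedPoly K 2) S).toAlgebra
  have hx := isTruncated_truncatedPoly K two_ne_zero
  (isProductRing_prod S (TruncatedPoly K 2)).isWSG
    (fun N _ _ => hx.exists_free_injective two_ne_zero N)
    (fun N _ _ => hx.exists_isShortExact_self N) (wdim_le_iff.1 hS)

theorem not_isSG_truncatedPoly_two_prod {n : ℕ} (hS : wdim S ≤ n)
    (hS' : (n : WithBot ℕ∞) < gldim S) : ¬ IsSG (TruncatedPoly K 2 × S) n := fun h =>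
  letI : Algebra (TruncatedPoly K 2 × S) (TruncatedPoly K 2) :=
    (RingHom.fst (TruncatedPoly K 2) S).toAlgebra
  letI : Algebra (TruncatedPoly K 2 × S) S := (RingHom.snd (TruncatedPoly K 2) S).toAlgebra
  hS'.not_ge ((isProductRing_prod S (TruncatedPoly K 2)).gldim_le_of_isSG hS h)

theorem wGgldim_truncatedPoly_three_prod {n : ℕ} (hS : wdim S = n) :
    wGgldim (TruncatedPoly K 3 × S) = n :=
  letI : Algebra (TruncatedPoly K 3 × S) (TruncatedPoly K 3) :=
    (RingHom.fst (TruncatedPoly K 3) S).toAlgebra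
  letI : Algebra (TruncatedPoly K 3 × S) S := (RingHom.snd (TruncatedPoly K 3) S).toAlgebra
  have hx := isTruncated_truncatedPoly K three_ne_zero
  (isProductRing_prod S (TruncatedPoly K 3)).wGgldim_eq
    (fun N _ _ => hx.exists_free_injective three_ne_zero N) hS

theorem not_isWSG_truncatedPoly_three_prod (n : ℕ) : ¬ IsWSG (TruncatedPoly K 3 × S) n := by
  have hx := isTruncated_truncatedPoly K three_ne_zero
  have h1 := truncatedPoly_pow_mul_eq_zero_iff K (show 1 + 2 = 3 from rfl)
  have h2 := truncatedPoly_pow_mul_eq_zero_iff K (show 2 + 1 = 3 from rfl)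
  simp only [pow_one] at h1 h2
  generalize (Ideal.Quotient.mk (Ideal.span {X ^ 3}) X : TruncatedPoly K 3) = x at hx h1 h2
  -- With `a = (x, 0)` and `c = (x, 1)`, the annihilators of `a` and `c ^ 2 = (x ^ 2, 1)` are
  -- generated by each other.
  refine not_isWSG_of_exact (a := (x, 0)) (c := (x, 1)) ?_ ?_ ⟨(1, 0), by simp⟩ ?_ n
  · rintro ⟨t, s⟩
    simp only [LinearMap.lsmul_apply, smul_eq_mul, Prod.pow_mk, one_pow, Prod.mk_mul_mk, one_mul,
      Prod.mk_eq_zero, h2, Set.mem_range, Prod.exists, Prod.mk.injEq, zero_mul]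
    exact ⟨fun ⟨⟨z, hz⟩, hs⟩ => ⟨z, 0, hz, hs.symm⟩, fun ⟨z, _, hz, hs⟩ => ⟨⟨z, hz⟩, hs.symm⟩⟩
  · rintro ⟨t, s⟩
    simp only [LinearMap.lsmul_apply, smul_eq_mul, Prod.pow_mk, one_pow, Prod.mk_mul_mk, one_mul,
      Prod.mk_eq_zero, h1, Set.mem_range, Prod.exists, Prod.mk.injEq, zero_mul]
    exact ⟨fun ⟨⟨z, hz⟩, _⟩ => ⟨z, s, hz, rfl⟩, fun ⟨z, _, hz, _⟩ => ⟨⟨z, hz⟩, trivial⟩⟩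
  · intro hu
    have hu' : IsUnit x := hu.map (RingHom.fst (TruncatedPoly K 3) S)
    obtain ⟨c, hc⟩ := hx.exists_topCoeff
    have h3 : x ^ 2 = 0 := hu'.mul_left_cancel (by
      rw [← pow_succ', hx.pow_eq_zero, mul_zero])
    have h4 := hc 2 (by lia)
    rw [h3, map_zero] at h4
    simp at h4

end Examples

/-! ### Dimensions of polynomial rings -/

section PolynomialDimension

variable {A : Type u} [CommRing A]

section Coeff

variable (A) (M : Type u) [AddCommGroup M] [Module A M]

/-- The coefficient of `X ^ k` of an element of `A[X] ⊗ M`. -/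
noncomputable def tensorCoeff (k : ℕ) : A[X] ⊗[A] M →ₗ[A] M :=
  (TensorProduct.lid A M).toLinearMap ∘ₗ (lcoeff A k).rTensor M

variable {A M}

theorem tensorCoeff_tmul (k : ℕ) (p : A[X]) (m : M) :
    tensorCoeff A M k (p ⊗ₜ m) = p.coeff k • m := by
  simp [tensorCoeff]

theorem tensorCoeff_succ_X_smul (k : ℕ) (z : A[X] ⊗[A] M) :
    tensorCoeff A M (k + 1) ((X : A[X]) • z) = tensorCoeff A M k z := by
  induction z with
  | zero => simp
  | add z w hz hw => rw [smul_add, map_add, hz, hw, map_add]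
  | tmul p m => rw [TensorProduct.smul_tmul', tensorCoeff_tmul, tensorCoeff_tmul]; simp

theorem exists_eq_sum_tensorCoeff (z : A[X] ⊗[A] M) : ∃ n, ∀ m ≥ n,
    tensorCoeff A M m z = 0 ∧ z = ∑ k ∈ Finset.range m, (X ^ k : A[X]) ⊗ₜ tensorCoeff A M k z := by
  induction z with
  | zero => exact ⟨0, by simp⟩
  | add z w hz hw =>
    obtain ⟨n, hn⟩ := hz
    obtain ⟨n', hn'⟩ := hw
    refine ⟨max n n', fun m hm => ?_⟩
    have h1 := hn m (le_of_max_le_left hm)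
    have h2 := hn' m (le_of_max_le_right hm)
    refine ⟨by rw [map_add, h1.1, h2.1, add_zero], ?_⟩
    simp only [map_add, tmul_add, Finset.sum_add_distrib]
    rw [← h1.2, ← h2.2]
  | tmul p m =>
    refine ⟨p.natDegree + 1, fun l hl => ⟨?_, ?_⟩⟩
    · rw [tensorCoeff_tmul, coeff_eq_zero_of_natDegree_lt (by lia), zero_smul]
    · conv_lhs => rw [p.as_sum_range' l (by lia), TensorProduct.sum_tmul]
      refine Finset.sum_congr rfl fun k _ => ?_
      rw [tensorCoeff_tmul, ← TensorProduct.smul_tmul, smul_eq_C_mul, C_mul_X_pow_eq_monomial]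

theorem eq_zero_of_tensorCoeff {z : A[X] ⊗[A] M} (h : ∀ k, tensorCoeff A M k z = 0) : z = 0 := by
  obtain ⟨n, hn⟩ := exists_eq_sum_tensorCoeff z
  rw [(hn n le_rfl).2]
  exact Finset.sum_eq_zero fun k _ => by rw [h, tmul_zero]

end Coeff

/-- The characteristic sequence `0 → A[X] ⊗ M → A[X] ⊗ M → M → 0` of a module over `A[X]`. -/
theorem exists_characteristic_isShortExact (M : Type u) [AddCommGroup M] [Module A M]
    [Module A[X] M] [IsScalarTower A A[X] M] :
    ∃ (f : A[X] ⊗[A] M →ₗ[A[X]] A[X] ⊗[A] M) (g : A[X] ⊗[A] M →ₗ[A[X]] M), IsShortExact f g := by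
  let ξ : M →ₗ[A] M := Algebra.lsmul A A M (X : A[X])
  let f : A[X] ⊗[A] M →ₗ[A[X]] A[X] ⊗[A] M :=
    LinearMap.lsmul A[X] _ (X : A[X]) - ξ.baseChange A[X]
  let g : A[X] ⊗[A] M →ₗ[A[X]] M := TensorProduct.AlgebraTensorModule.lift
    (LinearMap.toSpanSingleton A[X] (M →ₗ[A] M) LinearMap.id)
  have hf : ∀ p m, f (p ⊗ₜ m) = (X * p) ⊗ₜ m - p ⊗ₜ ((X : A[X]) • m) := fun p m => by
    simp [f, ξ, TensorProduct.smul_tmul']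
  have hg : ∀ (p : A[X]) (m : M), g (p ⊗ₜ m) = p • m := fun p m => by simp [g]
  have hfg : ∀ z, g (f z) = 0 := fun z => by
    induction z with
    | zero => simp
    | add z w hz hw => rw [map_add, map_add, hz, hw, add_zero]
    | tmul p m => rw [hf, map_sub, hg, hg, mul_comm, mul_smul, sub_self]
  refine ⟨f, g, ?_, fun z => ⟨fun hz => ?_, ?_⟩, fun m => ⟨1 ⊗ₜ m, by rw [hg, one_smul]⟩⟩
  · -- If `f z = 0`, each coefficient of `z` is `X` times the next one, and almost all vanish.
    rw [injective_iff_map_eq_zero]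
    intro z hz
    have hξ : ∀ k z, tensorCoeff A M k (ξ.baseChange A[X] z) = ξ (tensorCoeff A M k z) :=
      fun k z => by
        induction z with
        | zero => simp
        | add z w hz hw => simp only [map_add, hz, hw]
        | tmul p m => simp [tensorCoeff_tmul]
    have hrec : ∀ k, tensorCoeff A M k z = ξ (tensorCoeff A M (k + 1) z) := fun k => by
      have h1 : (X : A[X]) • z = ξ.baseChange A[X] z := sub_eq_zero.1 hz
      rw [← hξ, ← h1, tensorCoeff_succ_X_smul]
    obtain ⟨n, hn⟩ := exists_eq_sum_tensorCoeff z
    have hall : ∀ j k, n ≤ k + j → tensorCoeff A M k z = 0 := by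
      intro j
      induction j with
      | zero => exact fun k hk => (hn k hk).1
      | succ j ih => exact fun k hk => by rw [hrec, ih (k + 1) (by lia), map_zero]
    exact eq_zero_of_tensorCoeff fun k => hall n k (by lia)
  · -- Modulo the image of `f`, the element `p ⊗ m` agrees with `1 ⊗ p m`.
    have key : ∀ z, z - 1 ⊗ₜ g z ∈ LinearMap.range f := by
      intro z
      induction z with
      | zero => simp
      | add z w hz hw =>
        rw [map_add, tmul_add, add_sub_add_comm]
        exact add_mem hz hw
      | tmul p m =>
        rw [hg]
        induction p using Polynomial.induction_on generalizing m with
        | C a =>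
          rw [← algebraMap_eq, algebraMap_smul, ← smul_tmul, ← Algebra.algebraMap_eq_smul_one,
            sub_self]
          exact zero_mem _
        | add p q hp hq =>
          rw [add_tmul, add_smul, tmul_add, add_sub_add_comm]
          exact add_mem (hp m) (hq m)
        | monomial k a h =>
          have h1 := add_mem (h ((X : A[X]) • m)) (LinearMap.mem_range_self f ((C a * X ^ k) ⊗ₜ m))
          rw [hf, ← mul_smul, mul_assoc, ← pow_succ, mul_left_comm, ← pow_succ'] at h1
          convert h1 using 1
          abel
    have := key z
    rwa [hz, tmul_zero, sub_zero] at this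
  · rintro ⟨w, rfl⟩
    exact hfg w

/-- The weak dimension grows by at most one on passing to the polynomial ring. -/
theorem flatDimLT_polynomial {n : ℕ}
    (h : ∀ (M : Type u) [AddCommGroup M] [Module A M], FlatDimLT A M (n + 1))
    (M : Type u) [AddCommGroup M] [Module A[X] M] : FlatDimLT A[X] M (n + 2) := by
  let : Module A M := Module.compHom M (algebraMap A A[X])
  have : IsScalarTower A A[X] M := .of_compHom _ _ _
  obtain ⟨f, g, hs⟩ := exists_characteristic_isShortExact (A := A) M
  have hM := (h M).baseChange A[X]
  exact hs.flatDimLT_right hM (hM.mono (by lia))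

section Regular

variable {R : Type u} [CommRing R] [Algebra R A]

/-- If `A` is the quotient of `R` by a regular element `x`, then modules on which `x` is regular
are acyclic for the base change to `A`. -/
theorem acyclic_of_isSMulRegular {x : R} (hx : IsRegular x)
    (hA : Function.Surjective (algebraMap R A))
    (hker : ∀ r : R, algebraMap R A r = 0 → x ∣ r) (hxA : algebraMap R A x = 0)
    {L M : Type u} [AddCommGroup L] [Module R L] [AddCommGroup M] [Module R M] (p : L →ₗ[R] M)
    (hL : Module.Free R L) (hM : ∀ y : M, x • y = 0 → y = 0) :
    (∀ y : LinearMap.ker p, x • y = 0 → y = 0) ∧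
      Function.Injective ((LinearMap.ker p).subtype.lTensor A) := by
  have hreg : ∀ l : L, x • l = 0 → l = 0 := fun l hl =>
    Module.Flat.isSMulRegular_of_isRegular hx (by simpa using hl)
  refine ⟨fun y hy => Subtype.ext (hreg y (congrArg Subtype.val hy)), ?_⟩
  have hone : ∀ (N : Type u) [AddCommGroup N] [Module R N] (z : A ⊗[R] N), ∃ y : N, z = 1 ⊗ₜ y :=
    fun N _ _ z => by
      induction z with
      | zero => exact ⟨0, by simp⟩
      | add z w hz hw =>
        obtain ⟨a, rfl⟩ := hz
        obtain ⟨b, rfl⟩ := hw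
        exact ⟨a + b, (tmul_add _ _ _).symm⟩
      | tmul a y =>
        obtain ⟨r, rfl⟩ := hA a
        exact ⟨r • y, by rw [Algebra.algebraMap_eq_smul_one, smul_tmul]⟩
  have hzero : ∀ l : L, (1 : A) ⊗ₜ[R] l = 0 → ∃ l', l = x • l' := fun l hl => by
    have hex : Function.Exact (LinearMap.lsmul R R x) (Algebra.linearMap R A) := fun r => by
      constructor
      · exact fun hr => (hker r hr).imp fun c hc => hc.symm
      · rintro ⟨c, rfl⟩
        simp [hxA]
    obtain ⟨z, hz⟩ := (rTensor_exact L hex hA (1 ⊗ₜ l)).1 (by simpa using hl)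
    refine ⟨TensorProduct.lid R L z, ?_⟩
    have h1 : ∀ z, TensorProduct.lid R L ((LinearMap.lsmul R R x).rTensor L z) =
        x • TensorProduct.lid R L z := fun z => by
      induction z with
      | zero => simp
      | add z w hz hw => simp only [map_add, hz, hw, smul_add]
      | tmul r l => simp [mul_smul]
    rw [← h1, hz]
    simp
  rw [injective_iff_map_eq_zero]
  intro z hz
  obtain ⟨y, rfl⟩ := hone _ z
  obtain ⟨l, hl⟩ := hzero y (by simpa using hz)
  have hl' : l ∈ LinearMap.ker p := by
    rw [LinearMap.mem_ker]
    refine hM _ ?_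
    rw [← map_smul, ← hl]
    exact y.2
  have hy : y = x • (⟨l, hl'⟩ : LinearMap.ker p) := Subtype.ext hl
  rw [hy, ← smul_tmul, ← Algebra.algebraMap_eq_smul_one, hxA, zero_tmul]

end Regular

section Syzygy

variable {E : Type u} [CommRing E] [Algebra A[X] E] [Algebra A E] [IsScalarTower A A[X] E]

/-- If `E` is the quotient of `A[X]` by `X`, each module `M` over `E` has a syzygy `K` over
`A[X]` such that `M` is a direct summand of `K / X K`: the class of an element is sent to its
coefficient of `X`. -/
theorem exists_syzygy_retract (hE : Function.Surjective (algebraMap A E))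
    (hX : algebraMap A[X] E X = 0) (M : Type u) [AddCommGroup M] [Module E M] [Module A[X] M]
    [IsScalarTower A[X] E M] :
    ∃ (L : Type u) (_ : AddCommGroup L) (_ : Module A[X] L) (g : L →ₗ[A[X]] M),
      Module.Free A[X] L ∧ Function.Surjective g ∧
      ∃ (i : M →ₗ[E] E ⊗[A[X]] (LinearMap.ker g)) (r : E ⊗[A[X]] (LinearMap.ker g) →ₗ[E] M),
        r ∘ₗ i = LinearMap.id := by
  let : Module A M := Module.compHom M (algebraMap A E)
  have : IsScalarTower A E M := .of_compHom _ _ _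
  have : IsScalarTower A A[X] M := .of_algebraMap_smul fun a m => by
    rw [← algebraMap_smul E (algebraMap A A[X] a) m, ← IsScalarTower.algebraMap_apply,
      algebraMap_smul]
  have hsurj : Function.Surjective (algebraMap A[X] E) := fun e => by
    obtain ⟨a, rfl⟩ := hE e
    exact ⟨algebraMap A A[X] a, (IsScalarTower.algebraMap_apply _ _ _ _).symm⟩
  have hXM : ∀ m : M, (X : A[X]) • m = 0 := fun m => by
    rw [← algebraMap_smul E, hX, zero_smul]
  have hsmul : ∀ (q : A[X]) (m : M), q • m = q.coeff 0 • m := fun q m => by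
    conv_lhs => rw [← q.divX_mul_X_add, add_smul, mul_smul, hXM, smul_zero, zero_add,
      ← algebraMap_eq, algebraMap_smul]
  obtain ⟨L, _, _, p, _, hp⟩ := exists_free_surjective (R := A) M
  have h0 : ∀ (q : A[X]) (z : A[X] ⊗[A] L),
      tensorCoeff A L 0 (q • z) = q.coeff 0 • tensorCoeff A L 0 z := fun q z => by
    induction z with
    | zero => simp
    | add z w hz hw => rw [smul_add, map_add, hz, hw, map_add, smul_add]
    | tmul r l =>
      rw [smul_tmul', tensorCoeff_tmul, tensorCoeff_tmul, smul_eq_mul, mul_coeff_zero, mul_smul]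
  have h1 : ∀ (q : A[X]) (z : A[X] ⊗[A] L), tensorCoeff A L 1 (q • z) =
      q.coeff 0 • tensorCoeff A L 1 z + q.coeff 1 • tensorCoeff A L 0 z := fun q z => by
    induction z with
    | zero => simp
    | add z w hz hw => simp only [smul_add, map_add, hz, hw]; abel
    | tmul r l =>
      rw [smul_tmul', tensorCoeff_tmul, tensorCoeff_tmul, tensorCoeff_tmul, smul_eq_mul,
        mul_coeff_one, add_smul, mul_smul, mul_smul]
  let g : A[X] ⊗[A] L →ₗ[A[X]] M :=
    { toFun := fun z => p (tensorCoeff A L 0 z)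
      map_add' := fun z w => by rw [map_add, map_add]
      map_smul' := fun q z => by rw [RingHom.id_apply, hsmul, ← map_smul, h0] }
  have hg : ∀ z, g z = p (tensorCoeff A L 0 z) := fun _ => rfl
  refine ⟨A[X] ⊗[A] L, inferInstance, inferInstance, g, inferInstance, fun m => ?_, ?_⟩
  · obtain ⟨l, rfl⟩ := hp m
    exact ⟨1 ⊗ₜ l, by rw [hg, tensorCoeff_tmul, coeff_one_zero, one_smul]⟩
  let K := LinearMap.ker g
  have hXmem : ∀ l : L, (X : A[X]) ⊗ₜ[A] l ∈ LinearMap.ker g := fun l => by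
    rw [LinearMap.mem_ker, hg, tensorCoeff_tmul, coeff_X_zero, zero_smul, map_zero]
  let c : K →ₗ[A[X]] M :=
    { toFun := fun z => p (tensorCoeff A L 1 z.1)
      map_add' := fun z w => by rw [← map_add, ← map_add]; rfl
      map_smul' := fun q z => by
        change p (tensorCoeff A L 1 (q • z.1)) = q • p (tensorCoeff A L 1 z.1)
        have hz : p (tensorCoeff A L 0 z.1) = 0 := z.2
        rw [h1, map_add, map_smul, map_smul, hz, smul_zero, add_zero, hsmul] }
  let r : E ⊗[A[X]] K →ₗ[E] M :=
    (baseChangeEquivOfSurjective hsurj M).toLinearMap ∘ₗ c.baseChange E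
  let i' : L →ₗ[A] E ⊗[A[X]] K :=
    { toFun := fun l => 1 ⊗ₜ ⟨X ⊗ₜ l, hXmem l⟩
      map_add' := fun l l' => by
        rw [← tmul_add]
        congr 1
        exact Subtype.ext (tmul_add _ _ _)
      map_smul' := fun a l => by
        have hl : (⟨X ⊗ₜ (a • l), hXmem (a • l)⟩ : K) = (C a : A[X]) • ⟨X ⊗ₜ l, hXmem l⟩ := by
          refine Subtype.ext ?_
          change X ⊗ₜ[A] (a • l) = (C a : A[X]) • (X ⊗ₜ[A] l)
          rw [smul_tmul', ← smul_tmul, smul_eq_mul, smul_eq_C_mul]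
        rw [hl, RingHom.id_apply, ← smul_tmul, ← algebraMap_eq, algebraMap_smul, smul_tmul'] }
  have hi' : LinearMap.ker p ≤ LinearMap.ker i' := fun l hl => by
    have hl1 : (1 : A[X]) ⊗ₜ[A] l ∈ LinearMap.ker g := by
      rw [LinearMap.mem_ker, hg, tensorCoeff_tmul, coeff_one_zero, one_smul]
      exact hl
    have h2 : (⟨X ⊗ₜ l, hXmem l⟩ : K) = (X : A[X]) • ⟨1 ⊗ₜ l, hl1⟩ := by
      refine Subtype.ext ?_
      change X ⊗ₜ[A] l = (X : A[X]) • ((1 : A[X]) ⊗ₜ[A] l)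
      rw [smul_tmul', smul_eq_mul, mul_one]
    have h3 : (X : A[X]) • (1 : E) = 0 := by rw [← Algebra.algebraMap_eq_smul_one, hX]
    change (1 : E) ⊗ₜ[A[X]] (⟨X ⊗ₜ l, hXmem l⟩ : K) = 0
    rw [h2, ← smul_tmul, h3, zero_tmul]
  let i : M →ₗ[A] E ⊗[A[X]] K :=
    (LinearMap.ker p).liftQ i' hi' ∘ₗ (p.quotKerEquivOfSurjective hp).symm.toLinearMap
  refine ⟨LinearMap.extendScalarsOfSurjective hE i, r, LinearMap.ext fun m => ?_⟩
  obtain ⟨l, rfl⟩ := hp m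
  have h2 : (p.quotKerEquivOfSurjective hp).symm (p l) = Submodule.Quotient.mk l := by
    rw [LinearEquiv.symm_apply_eq]; rfl
  change r ((LinearMap.ker p).liftQ i' hi' ((p.quotKerEquivOfSurjective hp).symm (p l))) = p l
  rw [h2]
  change baseChangeEquivOfSurjective hsurj M (c.baseChange E (1 ⊗ₜ (⟨X ⊗ₜ l, hXmem l⟩ : K))) = p l
  rw [LinearMap.baseChange_tmul, baseChangeEquivOfSurjective_tmul, one_smul]
  change p (tensorCoeff A L 1 (X ⊗ₜ l)) = p l
  rw [tensorCoeff_tmul, coeff_X_one, one_smul]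

end Syzygy

end PolynomialDimension

section PolynomialDimension

section

variable {A : Type u} [CommRing A] {E : Type u} [CommRing E] [Algebra A[X] E] [Algebra A E]
  [IsScalarTower A A[X] E]

/-- The modules over `A[X]` on which `X` is regular are closed under syzygies and acyclic for the
base change to `A[X] / X`. -/
theorem acyclic_polynomial (hE : Function.Bijective (algebraMap A E))
    (hX : algebraMap A[X] E X = 0) {L M : Type u} [AddCommGroup L] [Module A[X] L]
    [AddCommGroup M] [Module A[X] M] (p : L →ₗ[A[X]] M) (hL : Module.Free A[X] L)
    (hM : ∀ y : M, (X : A[X]) • y = 0 → y = 0) :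
    (∀ y : LinearMap.ker p, (X : A[X]) • y = 0 → y = 0) ∧
      Function.Injective ((LinearMap.ker p).subtype.lTensor E) := by
  have hC : ∀ a, algebraMap A[X] E (C a) = algebraMap A E a := fun a =>
    (IsScalarTower.algebraMap_apply A A[X] E a).symm
  refine acyclic_of_isSMulRegular (x := (X : A[X])) ?_ ?_ (fun q hq => ?_) hX p hL hM
  · exact isRegular_X
  · intro e
    obtain ⟨a, rfl⟩ := hE.2 e
    exact ⟨C a, hC a⟩
  · rw [← q.divX_mul_X_add, map_add, map_mul, hX, mul_zero, zero_add, hC] at hq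
    exact X_dvd_iff.2 ((injective_iff_map_eq_zero _).1 hE.1 _ hq)

/-- If all modules over `A[X]` have flat dimension at most `n + 1`, then all modules over
`A[X] / X` have flat dimension at most `n`: the syzygy `K` of a module `M` with `X M = 0` has flat
dimension at most `n`, so has `K / X K`, and `M` is a direct summand of that. -/
theorem flatDimLT_of_polynomial (hE : Function.Bijective (algebraMap A E))
    (hX : algebraMap A[X] E X = 0) {n : ℕ}
    (h : ∀ (N : Type u) [AddCommGroup N] [Module A[X] N], FlatDimLT A[X] N (n + 2))
    (M : Type u) [AddCommGroup M] [Module E M] : FlatDimLT E M (n + 1) := by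
  let : Module A[X] M := Module.compHom M (algebraMap A[X] E)
  have : IsScalarTower A[X] E M := .of_compHom _ _ _
  obtain ⟨L, _, _, g, hL, hg, i, r, hri⟩ := exists_syzygy_retract hE.2 hX M
  have hK := (IsShortExact.of_surjective hg).flatDimLT_left (.of_flat _) (h M)
  have hreg : ∀ y : LinearMap.ker g, (X : A[X]) • y = 0 → y = 0 := fun y hy => Subtype.ext <|
    (Module.Flat.isSMulRegular_of_isRegular (isRegular_X (R := A))).right_eq_zero_of_smul
      (congrArg Subtype.val hy)
  exact (hK.baseChange_of_acyclic E
    (𝒜 := fun N => ∀ y : N, (X : A[X]) • y = 0 → y = 0)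
    (fun _ _ _ _ _ _ p hL _ hM => acyclic_polynomial hE hX p hL hM) hreg).of_retract i r hri

/-- The analogue of `flatDimLT_of_polynomial` for projective dimensions. -/
theorem projDimLT_of_polynomial (hE : Function.Bijective (algebraMap A E))
    (hX : algebraMap A[X] E X = 0) {n : ℕ}
    (h : ∀ (N : Type u) [AddCommGroup N] [Module A[X] N], ProjDimLT A[X] N (n + 2))
    (M : Type u) [AddCommGroup M] [Module E M] : ProjDimLT E M (n + 1) := by
  let : Module A[X] M := Module.compHom M (algebraMap A[X] E)
  have : IsScalarTower A[X] E M := .of_compHom _ _ _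
  obtain ⟨L, _, _, g, hL, hg, i, r, hri⟩ := exists_syzygy_retract hE.2 hX M
  have hK := (IsShortExact.of_surjective hg).projDimLT_left (.of_projective _) (h M)
  have hreg : ∀ y : LinearMap.ker g, (X : A[X]) • y = 0 → y = 0 := fun y hy => Subtype.ext <|
    (Module.Flat.isSMulRegular_of_isRegular (isRegular_X (R := A))).right_eq_zero_of_smul
      (congrArg Subtype.val hy)
  exact (hK.baseChange_of_acyclic E
    (𝒜 := fun N => ∀ y : N, (X : A[X]) • y = 0 → y = 0)
    (fun _ _ _ _ _ _ p hL _ hM => acyclic_polynomial hE hX p hL hM) hreg).of_retract i r hri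

end

variable {R R' : Type u} [CommRing R] [CommRing R']

theorem wdim_le_of_ringEquiv (e : R ≃+* R') {n : ℕ} (h : wdim R ≤ n) : wdim R' ≤ n := by
  rw [wdim_le_iff] at h ⊢
  intro M _ _
  let : Algebra R R' := e.toRingHom.toAlgebra
  have he : Function.Bijective (algebraMap R R') := e.bijective
  have : Module.Flat R R' :=
    .of_linearEquiv (LinearEquiv.ofBijective (Algebra.linearMap R R') he).symm
  let : Module R M := Module.compHom M (algebraMap R R')
  have : IsScalarTower R R' M := .of_compHom _ _ _
  exact ((h M).baseChange R').of_equiv (baseChangeEquivOfSurjective he.2 M).symm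

theorem gldim_le_of_ringEquiv (e : R ≃+* R') {n : ℕ} (h : gldim R ≤ n) : gldim R' ≤ n := by
  rw [gldim_le_iff] at h ⊢
  intro M _ _
  let : Algebra R R' := e.toRingHom.toAlgebra
  have he : Function.Bijective (algebraMap R R') := e.bijective
  have : Module.Flat R R' :=
    .of_linearEquiv (LinearEquiv.ofBijective (Algebra.linearMap R R') he).symm
  let : Module R M := Module.compHom M (algebraMap R R')
  have : IsScalarTower R R' M := .of_compHom _ _ _
  exact ((h M).baseChange R').of_equiv (baseChangeEquivOfSurjective he.2 M).symm

variable (A : Type u) [CommRing A]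

/-- The quotient of `A[X]` by `X` is a copy of `A`. -/
theorem bijective_algebraMap_quotient_X :
    Function.Bijective (algebraMap A (A[X] ⧸ Ideal.span {(X : A[X])})) := by
  have hC : ∀ a, algebraMap A (A[X] ⧸ Ideal.span {(X : A[X])}) a = Ideal.Quotient.mk _ (C a) :=
    fun _ => rfl
  constructor
  · rw [injective_iff_map_eq_zero]
    intro a ha
    rw [hC, Ideal.Quotient.eq_zero_iff_mem, Ideal.mem_span_singleton, X_dvd_iff, coeff_C_zero] at ha
    exact ha
  · intro e
    obtain ⟨q, rfl⟩ := Ideal.Quotient.mk_surjective e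
    refine ⟨q.coeff 0, ?_⟩
    rw [hC, eq_comm, Ideal.Quotient.mk_eq_mk_iff_sub_mem, Ideal.mem_span_singleton, X_dvd_iff]
    simp

theorem wdim_polynomial_le_succ_iff {n : ℕ} : wdim A[X] ≤ (n + 1 : ℕ) ↔ wdim A ≤ n := by
  refine ⟨fun h => ?_, fun h => ?_⟩
  · have hE := bijective_algebraMap_quotient_X A
    refine wdim_le_of_ringEquiv (RingEquiv.ofBijective _ hE).symm ?_
    rw [wdim_le_iff] at h ⊢
    intro M _ _
    exact flatDimLT_of_polynomial hE (Ideal.Quotient.mk_singleton_self X) h M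
  · rw [wdim_le_iff] at h ⊢
    intro M _ _
    exact flatDimLT_polynomial h M

theorem gldim_le_of_gldim_polynomial_le_succ {n : ℕ}
    (h : gldim A[X] ≤ ((n + 1 : ℕ) : WithBot ℕ∞)) : gldim A ≤ n := by
  have hE := bijective_algebraMap_quotient_X A
  refine gldim_le_of_ringEquiv (RingEquiv.ofBijective _ hE).symm ?_
  rw [gldim_le_iff] at h ⊢
  intro M _ _
  exact projDimLT_of_polynomial hE (Ideal.Quotient.mk_singleton_self X) h M

/-- The module `A[X] / X` is not flat, since the regular element `X` kills it. -/
theorem not_wdim_polynomial_le_zero [Nontrivial A] : ¬ wdim A[X] ≤ (0 : ℕ) := fun h => by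
  rw [wdim_le_iff] at h
  have := (flatDimLT_one_iff _ _).1 (h (A[X] ⧸ Ideal.span {(X : A[X])}))
  have h1 : (1 : A[X] ⧸ Ideal.span {(X : A[X])}) = 0 := by
    refine Module.Flat.isSMulRegular_of_isRegular (R := A[X]) isRegular_X ?_
    change (X : A[X]) • _ = (X : A[X]) • _
    rw [smul_zero, ← Algebra.algebraMap_eq_smul_one]
    exact Ideal.Quotient.mk_singleton_self X
  have : Subsingleton (A[X] ⧸ Ideal.span {(X : A[X])}) := subsingleton_of_zero_eq_one h1.symm
  exact not_subsingleton A (bijective_algebraMap_quotient_X A).1.subsingleton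

/-- Each new variable raises the weak dimension by one. -/
theorem wdim_mvPolynomial_le_iff (A : Type u) [CommRing A] [Nontrivial A] (hA : wdim A = 0)
    (n m : ℕ) : wdim (MvPolynomial (Fin n) A) ≤ m ↔ n ≤ m := by
  induction n generalizing m with
  | zero =>
    have h0 : wdim A ≤ (m : ℕ) := by simp [hA]
    exact ⟨fun _ => zero_le, fun _ =>
      wdim_le_of_ringEquiv (MvPolynomial.isEmptyRingEquiv A (Fin 0)).symm h0⟩
  | succ n ih =>
    have e := (MvPolynomial.finSuccEquiv A n).toRingEquiv
    have h1 : wdim (MvPolynomial (Fin (n + 1)) A) ≤ m ↔ wdim (MvPolynomial (Fin n) A)[X] ≤ m :=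
      ⟨wdim_le_of_ringEquiv e, wdim_le_of_ringEquiv e.symm⟩
    rw [h1]
    cases m with
    | zero => exact ⟨fun h => absurd h (not_wdim_polynomial_le_zero _), fun h => by lia⟩
    | succ m => rw [wdim_polynomial_le_succ_iff, ih, Nat.succ_le_succ_iff]

/-- Each new variable raises the global dimension by at least one. -/
theorem gldim_le_zero_of_gldim_mvPolynomial_le (A : Type u) [CommRing A] {n : ℕ}
    (h : gldim (MvPolynomial (Fin n) A) ≤ (n : WithBot ℕ∞)) : gldim A ≤ (0 : ℕ) := by
  induction n with
  | zero => exact gldim_le_of_ringEquiv (MvPolynomial.isEmptyRingEquiv A (Fin 0)) h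
  | succ n ih =>
    exact ih (gldim_le_of_gldim_polynomial_le_succ _
      (gldim_le_of_ringEquiv (MvPolynomial.finSuccEquiv A n).toRingEquiv h))

end PolynomialDimension

/-! ### Von Neumann regular rings -/

section VonNeumannRegular

variable {A : Type u} [CommRing A]

theorem IsVonNeumannRegularRing.exists_idempotent (hA : IsVonNeumannRegularRing A) (a : A) :
    ∃ e, e * e = e ∧ a ∣ e ∧ e * a = a := by
  obtain ⟨x, hx⟩ := hA a
  exact ⟨a * x, by linear_combination (-x) * hx, ⟨x, rfl⟩, by linear_combination -hx⟩

/-- A finitely generated ideal of a von Neumann regular ring contains an element acting on it as the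
identity: if `e` and `f` do so for `I` and `J`, then `e + f - e f` does so for `I + J`. -/
theorem IsVonNeumannRegularRing.exists_unit_of_fg (hA : IsVonNeumannRegularRing A) {I : Ideal A}
    (hI : I.FG) : ∃ e ∈ I, ∀ i ∈ I, e * i = i := by
  induction I, hI using Submodule.fg_induction with
  | singleton a =>
    obtain ⟨e, -, h1, h2⟩ := hA.exists_idempotent a
    refine ⟨e, Ideal.mem_span_singleton.2 h1, fun i hi => ?_⟩
    obtain ⟨b, rfl⟩ := Ideal.mem_span_singleton.1 hi
    rw [← mul_assoc, h2]
  | sup I J _ _ hI hJ =>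
    obtain ⟨e, he, h1⟩ := hI
    obtain ⟨f, hf, h2⟩ := hJ
    refine ⟨e + f - e * f, sub_mem (add_mem (Ideal.mem_sup_left he) (Ideal.mem_sup_right hf))
      (Ideal.mem_sup_left (Ideal.mul_mem_right _ _ he)), fun i hi => ?_⟩
    obtain ⟨x, hx, y, hy, rfl⟩ := Submodule.mem_sup.1 hi
    linear_combination (1 - f) * h1 x hx + (1 - e) * h2 y hy

theorem IsVonNeumannRegularRing.flat (hA : IsVonNeumannRegularRing A) (M : Type u)
    [AddCommGroup M] [Module A M] : Module.Flat A M := by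
  rw [Module.Flat.iff_rTensor_injective]
  intro I hI
  obtain ⟨e, he, h⟩ := hA.exists_unit_of_fg hI
  -- The map `m ↦ e ⊗ m` gives a left inverse.
  refine Function.LeftInverse.injective
    (g := fun z => (⟨e, he⟩ : I) ⊗ₜ[A] TensorProduct.lid A M z) fun z => ?_
  induction z with
  | zero => simp
  | add z w hz hw => simp only [map_add, tmul_add] at hz hw ⊢; rw [hz, hw]
  | tmul i m =>
    simp only [LinearMap.rTensor_tmul, lid_tmul]
    rw [← smul_tmul]
    congr 1
    exact Subtype.ext ((mul_comm _ _).trans (h i i.2))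

theorem IsVonNeumannRegularRing.wdim_eq_zero (hA : IsVonNeumannRegularRing A) : wdim A = 0 := by
  have h : wdim A ≤ (0 : ℕ) := wdim_le_iff.2 fun M _ _ => by
    have := hA.flat M
    exact .of_flat _
  simpa using h

/-- A ring all of whose cyclic modules are projective is Noetherian: its ideals are generated by
idempotents. -/
theorem isNoetherianRing_of_gldim_le_zero (h : gldim A ≤ (0 : ℕ)) : IsNoetherianRing A := by
  rw [gldim_le_iff] at h
  rw [isNoetherianRing_iff_ideal_fg]
  intro I
  have := (projDimLT_one_iff _ _).1 (h (A ⧸ I))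
  obtain ⟨σ, hσ⟩ := Module.projective_lifting_property (Submodule.mkQ I)
    LinearMap.id (Submodule.mkQ_surjective I)
  have hσ' : ∀ x, Submodule.mkQ I (σ x) = x := fun x => LinearMap.congr_fun hσ x
  -- With a section `σ` of `A → A / I`, the element `1 - σ 1` generates `I`.
  refine ⟨{1 - σ (Submodule.mkQ I 1)}, le_antisymm ?_ fun i hi => ?_⟩
  · rw [Finset.coe_singleton, Submodule.span_singleton_le_iff_mem]
    refine (Submodule.Quotient.mk_eq_zero I).1 ?_
    change Submodule.mkQ I _ = 0
    rw [map_sub, hσ', sub_self]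
  · rw [Finset.coe_singleton, Ideal.mem_span_singleton]
    refine ⟨i, ?_⟩
    have h0 : i • σ (Submodule.mkQ I 1) = 0 := by
      rw [← map_smul, ← map_smul, smul_eq_mul, mul_one]
      have : Submodule.mkQ I i = 0 := by rwa [← LinearMap.mem_ker, Submodule.ker_mkQ]
      rw [this, map_zero]
    rw [sub_mul, one_mul, mul_comm, ← smul_eq_mul i, h0, sub_zero]

end VonNeumannRegular

theorem IsVonNeumannRegularRing.wdim_mvPolynomial {A : Type u} [CommRing A] [Nontrivial A]
    (hA : IsVonNeumannRegularRing A) (n : ℕ) : wdim (MvPolynomial (Fin n) A) = n := by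
  have h := wdim_mvPolynomial_le_iff A hA.wdim_eq_zero n
  refine le_antisymm ((h n).2 le_rfl) ?_
  by_contra! hlt
  obtain ⟨m, hm⟩ := ENat.ne_top_iff_exists.1 hlt.ne_top
  rw [← hm, Nat.cast_lt] at hlt
  exact absurd ((h m).1 hm.ge) (by lia)

theorem lt_gldim_mvPolynomial {A : Type u} [CommRing A] (hA : ¬ IsNoetherianRing A) (n : ℕ) :
    (n : WithBot ℕ∞) < gldim (MvPolynomial (Fin n) A) :=
  lt_of_not_ge fun h =>
    hA (isNoetherianRing_of_gldim_le_zero (gldim_le_zero_of_gldim_mvPolynomial_le A h))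

/-! ### Generic flatness -/

section GenericFlatness

section TorOneVanish

variable {D : Type u} [CommRing D] (E : Type u) [CommRing E] [Algebra D E]

variable (D) in
/-- The condition `Tor_1(M, E) = 0`: every short exact sequence that ends in `M` stays exact
when it is tensored with `E`. -/
def TorOneVanish (M : Type u) [AddCommGroup M] [Module D M] : Prop :=
  ∀ (K L : Type u) [AddCommGroup K] [Module D K] [AddCommGroup L] [Module D L]
    (f : K →ₗ[D] L) (g : L →ₗ[D] M), IsShortExact f g → Function.Injective (f.rTensor E)

variable {E} {M M' M'' : Type u} [AddCommGroup M] [Module D M] [AddCommGroup M'] [Module D M']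
  [AddCommGroup M''] [Module D M'']

theorem TorOneVanish.of_equiv (h : TorOneVanish D E M) (e : M' ≃ₗ[D] M) : TorOneVanish D E M' :=
  fun K L _ _ _ _ f g hs => h K L f (e.toLinearMap ∘ₗ g)
    ⟨hs.inj, fun x => by simpa using hs.exact x, e.surjective.comp hs.surj⟩

theorem TorOneVanish.of_projective [Module.Projective D M] : TorOneVanish D E M := by
  intro K L _ _ _ _ f g hs
  -- The sequence splits, and a left inverse `r` of `f` gives one after tensoring.
  obtain ⟨s, hsg⟩ := Module.projective_lifting_property g LinearMap.id hs.surj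
  have hsplit := hs.exact.split_tfae'.out 0 1
  obtain ⟨-, r, hr⟩ := hsplit.1 ⟨hs.inj, s, hsg⟩
  refine Function.LeftInverse.injective (g := r.rTensor E) fun z => ?_
  rw [← LinearMap.rTensor_comp_apply, hr, LinearMap.rTensor_id_apply]

/-- A module killed by an element that is invertible in `E`. -/
theorem TorOneVanish.of_smul_eq_zero {d : D} (hd : IsUnit (algebraMap D E d))
    (hM : ∀ m : M, d • m = 0) : TorOneVanish D E M := by
  intro K L _ _ _ _ f g hs
  -- Multiplication by `d` on `K` factors through `f`.
  have hd' : ∀ l, d • l ∈ LinearMap.range f := fun l => (hs.exact _).1 (by rw [map_smul, hM])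
  let h : L →ₗ[D] K := (LinearEquiv.ofInjective f hs.inj).symm.toLinearMap ∘ₗ
    (LinearMap.lsmul D L d).codRestrict (LinearMap.range f) hd'
  have hh : h ∘ₗ f = LinearMap.lsmul D K d := LinearMap.ext fun k => by
    apply hs.inj
    have : f (h (f k)) = d • f k := congrArg Subtype.val
      ((LinearEquiv.ofInjective f hs.inj).apply_symm_apply ⟨d • f k, hd' (f k)⟩)
    simpa using this
  rw [injective_iff_map_eq_zero]
  intro z hz
  have h1 : (LinearMap.lsmul D K d).rTensor E z = 0 := by
    rw [← hh, LinearMap.rTensor_comp_apply, hz, map_zero]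
  have h2 : (LinearMap.lsmul D K d).rTensor E = (LinearMap.lsmul D E d).lTensor K :=
    TensorProduct.ext' fun k e => smul_tmul d k e
  obtain ⟨v, hv⟩ := hd.exists_left_inv
  have h3 : (LinearMap.mulLeft D v).lTensor K ((LinearMap.lsmul D E d).lTensor K z) = z := by
    rw [← LinearMap.lTensor_comp_apply]
    have : LinearMap.mulLeft D v ∘ₗ LinearMap.lsmul D E d = LinearMap.id := LinearMap.ext fun e => by
      change v * (d • e) = e
      rw [Algebra.smul_def, ← mul_assoc, hv, one_mul]
    rw [this, LinearMap.lTensor_id_apply]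
  rw [← h3, ← h2, h1, map_zero]

/-- The preimage of a short exact sequence `0 → K → L → M → 0` under the inclusion of a submodule of
`M`. -/
theorem IsShortExact.restrict {K L : Type u} [AddCommGroup K] [Module D K] [AddCommGroup L]
    [Module D L] {f : K →ₗ[D] L} {g : L →ₗ[D] M} (hs : IsShortExact f g) (N : Submodule D M) :
    ∃ hf : ∀ k, f k ∈ N.comap g,
      IsShortExact (f.codRestrict (N.comap g) hf) (g.restrict (p := N.comap g) fun _ hl => hl) := by
  have hf : ∀ k, f k ∈ N.comap g := fun k => by
    rw [Submodule.mem_comap, hs.exact.apply_apply_eq_zero]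
    exact zero_mem _
  refine ⟨hf, fun k k' hk => hs.inj (congrArg Subtype.val hk), fun l => ⟨fun hl => ?_, ?_⟩,
    fun m => ?_⟩
  · obtain ⟨k, hk⟩ := (hs.exact l.1).1 (congrArg Subtype.val hl)
    exact ⟨k, Subtype.ext hk⟩
  · rintro ⟨k, rfl⟩
    exact Subtype.ext (hs.exact.apply_apply_eq_zero k)
  · obtain ⟨l, hl⟩ := hs.surj m.1
    exact ⟨⟨l, by rw [Submodule.mem_comap, hl]; exact m.2⟩, Subtype.ext hl⟩

theorem TorOneVanish.extension {i : M' →ₗ[D] M} {q : M →ₗ[D] M''} (h : IsShortExact i q)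
    (h' : TorOneVanish D E M') (h'' : TorOneVanish D E M'') : TorOneVanish D E M := by
  intro K L _ _ _ _ f g hs
  -- The preimage of `M'` splits the inclusion `K → L` into two steps.
  obtain ⟨hf, h1⟩ := hs.restrict (LinearMap.ker q)
  have h2 : f = ((LinearMap.ker q).comap g).subtype ∘ₗ f.codRestrict _ hf := rfl
  rw [h2, LinearMap.rTensor_comp]
  exact (h'' _ _ _ _ (IsShortExact.of_surjective (g := q ∘ₗ g) (h.surj.comp hs.surj))).comp
    (h'.of_equiv h.kerEquiv _ _ _ _ h1)

theorem TorOneVanish.of_iSup {F : ℕ → Submodule D M} (hF : Monotone F) (htop : ⨆ i, F i = ⊤)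
    (h : ∀ i, TorOneVanish D E (F i)) : TorOneVanish D E M := by
  intro K L _ _ _ _ f g hs
  rw [injective_iff_map_eq_zero]
  intro z hz
  -- The vanishing of the image of `z` involves only finitely many elements of `L`.
  obtain ⟨K₀, hK₀, y, rfl⟩ := TensorProduct.exists_of_fg z
  have hy : (K₀.map f).subtype.rTensor E ((f.submoduleMap K₀).rTensor E y) = 0 := by
    rw [← LinearMap.rTensor_comp_apply] at hz ⊢
    exact hz
  obtain ⟨Q, hQ, hQfg, hQy⟩ := TensorProduct.eq_zero_of_fg_of_subtype_eq_zero (hK₀.map f) hy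
  obtain ⟨i, hi⟩ : ∃ i, Q.map g ≤ F i := by
    obtain ⟨_, ⟨i, rfl⟩, hi⟩ := (CompleteLattice.isCompactElement_iff_le_of_directed_sSup_le _ _).1
      ((Submodule.fg_iff_compact _).1 (hQfg.map g)) (Set.range F) (Set.range_nonempty F)
      hF.directed_le.directedOn_range (le_top.trans htop.ge)
    exact ⟨i, hi⟩
  have hQP : Q ≤ (F i).comap g := Submodule.map_le_iff_le_comap.1 hi
  obtain ⟨hf, h1⟩ := hs.restrict (F i)
  refine (injective_iff_map_eq_zero _).1 (h i _ _ _ _ h1) _ ?_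
  have h3 := congrArg ((Submodule.inclusion hQP).rTensor E) hQy
  rw [map_zero, ← LinearMap.rTensor_comp_apply, ← LinearMap.rTensor_comp_apply] at h3
  rw [← LinearMap.rTensor_comp_apply]
  exact h3

end TorOneVanish

section

variable {D : Type u} [CommRing D]

variable (D) in
/-- Generic flatness over the ring `D` for the finitely generated modules over the `D`-algebra
`B`: each of them has no first Tor against the `D`-algebras in which some fixed nonzero element of
`D` is invertible. -/
def GenericallyFlat (B : Type u) [CommRing B] [Algebra D B] : Prop :=
  ∀ (M : Type u) [AddCommGroup M] [Module B M] [Module D M] [IsScalarTower D B M]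
    [Module.Finite B M], ∃ d : D, d ≠ 0 ∧ ∀ (E : Type u) [CommRing E] [Algebra D E],
      IsUnit (algebraMap D E d) → TorOneVanish D E M

/-- The base case: by dévissage it suffices to consider the quotients of `D` by a prime `p`, which are
free if `p = 0` and killed by a nonzero element otherwise. -/
theorem genericallyFlat_self [IsDomain D] [IsNoetherianRing D] : GenericallyFlat D D := by
  intro M _ inst inst' _ _
  -- The two module structures over `D` on `M` agree because of the scalar tower.
  obtain rfl : inst = inst' := Module.ext' _ _ fun d m => by
    exact @algebraMap_smul D _ D _ _ M _ inst inst' _ d m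
  induction ‹Module.Finite D M› using
    IsNoetherianRing.induction_on_isQuotientEquivQuotientPrime D with
  | subsingleton N => exact ⟨1, one_ne_zero, fun E _ _ _ => .of_projective⟩
  | quotient N p e =>
    by_cases hp : p.1 = ⊥
    · have : Module.Projective D N := .of_equiv
        (e ≪≫ₗ Submodule.quotEquivOfEqBot _ hp).symm
      exact ⟨1, one_ne_zero, fun E _ _ _ => .of_projective⟩
    · obtain ⟨d, hd, hd0⟩ := Submodule.exists_mem_ne_zero_of_ne_bot hp
      refine ⟨d, hd0, fun E _ _ hE => .of_smul_eq_zero hE fun m => e.injective ?_⟩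
      obtain ⟨x, hx⟩ := Ideal.Quotient.mk_surjective (e m)
      rw [map_smul, map_zero, ← hx]
      exact Ideal.Quotient.eq_zero_iff_mem.2 (p.1.mul_mem_right _ hd)
  | exact N₁ N₂ N₃ f g hf hg hfg h₁ h₃ =>
    obtain ⟨d, hd, h₁⟩ := h₁
    obtain ⟨d', hd', h₃⟩ := h₃
    refine ⟨d * d', mul_ne_zero hd hd', fun E _ _ hE => ?_⟩
    rw [map_mul, IsUnit.mul_iff] at hE
    exact .extension ⟨hf, hfg, hg⟩ (h₁ E hE.1) (h₃ E hE.2)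

theorem GenericallyFlat.of_algEquiv {B B' : Type u} [CommRing B] [Algebra D B] [CommRing B']
    [Algebra D B'] (h : GenericallyFlat D B) (e : B ≃ₐ[D] B') : GenericallyFlat D B' := by
  intro M _ _ _ _ _
  let : Module B M := Module.compHom M e.toRingHom
  have : IsScalarTower D B M := .of_algebraMap_smul fun d m => by
    change e (algebraMap D B d) • m = d • m
    rw [e.commutes, algebraMap_smul]
  have : Module.Finite B M := by
    obtain ⟨s, hs⟩ := Module.Finite.fg_top (R := B') (M := M)
    refine ⟨s, eq_top_iff.2 fun m _ => ?_⟩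
    have hm : m ∈ Submodule.span B' (s : Set M) := hs ▸ Submodule.mem_top
    induction hm using Submodule.span_induction with
    | mem x hx => exact Submodule.subset_span hx
    | zero => exact zero_mem _
    | add x y _ _ hx hy => exact add_mem (hx trivial) (hy trivial)
    | smul b x _ hx =>
      have := Submodule.smul_mem _ (e.symm b) (hx trivial)
      change e (e.symm b) • x ∈ _ at this
      rwa [e.apply_symm_apply] at this
  exact h M

theorem isShortExact_inclusion {B : Type u} [CommRing B] {M : Type u} [AddCommGroup M] [Module B M]
    {P Q : Submodule B M} (h : P ≤ Q) :
    IsShortExact (Submodule.inclusion h) (P.submoduleOf Q).mkQ := by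
  refine ⟨Submodule.inclusion_injective h, fun x => ?_, Submodule.mkQ_surjective _⟩
  refine (Submodule.Quotient.mk_eq_zero (P.submoduleOf Q)).trans ⟨fun hx => ⟨⟨x.1, hx⟩, rfl⟩, ?_⟩
  rintro ⟨y, rfl⟩
  exact y.2

theorem IsShortExact.restrictScalars (D : Type u) [CommRing D] {B : Type u} [CommRing B]
    [Algebra D B] {M₁ M₂ M₃ : Type u} [AddCommGroup M₁] [AddCommGroup M₂] [AddCommGroup M₃]
    [Module B M₁] [Module B M₂] [Module B M₃] [Module D M₁] [Module D M₂] [Module D M₃]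
    [IsScalarTower D B M₁] [IsScalarTower D B M₂] [IsScalarTower D B M₃]
    {f : M₁ →ₗ[B] M₂} {g : M₂ →ₗ[B] M₃} (h : IsShortExact f g) :
    IsShortExact (f.restrictScalars D) (g.restrictScalars D) :=
  ⟨h.inj, h.exact, h.surj⟩

/-- Generic flatness for the polynomial ring `B[X]`: a finitely generated module `M` is the union of
the submodules `F i = W + X W + ⋯ + X ^ i W`, where `W` is generated over `B` by finitely many
generators of `M`. Since `F (i + 1) / F i` is the quotient of `W` by a submodule that grows with
`i`, only finitely many modules over `B` occur. -/
theorem GenericallyFlat.polynomial {B : Type u} [CommRing B] [Algebra D B] [IsDomain D]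
    [IsNoetherianRing B] (h : GenericallyFlat D B) : GenericallyFlat D B[X] := by
  intro M _ _ _ _ hM
  let : Module B M := Module.compHom M (algebraMap B B[X])
  have : IsScalarTower B B[X] M := .of_compHom _ _ _
  have : IsScalarTower D B M := .of_algebraMap_smul fun d m => by
    rw [← algebraMap_smul B[X] (algebraMap D B d) m, ← IsScalarTower.algebraMap_apply,
      algebraMap_smul]
  obtain ⟨s, hs⟩ := hM.fg_top
  let W := Submodule.span B (s : Set M)
  have : Module.Finite B W := .of_fg ⟨s, rfl⟩
  let ξ : M →ₗ[B] M := Algebra.lsmul B B M (X : B[X])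
  let F : ℕ → Submodule B M := fun i => (Finset.range (i + 1)).sup fun j => W.map (ξ ^ j)
  have hF : Monotone F := fun i j hij => Finset.sup_mono (Finset.range_subset_range.2 (by lia))
  have hWF : ∀ i j, j ≤ i → ∀ w ∈ W, (ξ ^ j) w ∈ F i := fun i j hij w hw =>
    have hle : W.map (ξ ^ j) ≤ F i :=
      Finset.le_sup (f := fun j => W.map (ξ ^ j)) (Finset.mem_range.2 (Nat.lt_succ_of_le hij))
    hle (Submodule.mem_map_of_mem hw)
  have hξF : ∀ i, F i ≤ (F (i + 1)).comap ξ := fun i => Finset.sup_le fun j hj => by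
    rintro _ ⟨w, hw, rfl⟩
    rw [Submodule.mem_comap, ← Module.End.mul_apply, ← pow_succ']
    exact hWF _ _ (by have := Finset.mem_range.1 hj; lia) w hw
  have hF0 : F 0 = W := by simp [F, Module.End.one_eq_id]
  have hFsucc : ∀ i, F (i + 1) = W.map (ξ ^ (i + 1)) ⊔ F i := fun i => by
    simp only [F, Finset.range_add_one (n := i + 1), Finset.sup_insert]
  have htop : ⨆ i, F i = ⊤ := by
    have hmem : ∀ x, x ∈ ⨆ i, F i ↔ ∃ i, x ∈ F i := fun x =>
      Submodule.mem_iSup_of_directed _ hF.directed_le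
    have hq : ∀ (q : B[X]), ∀ x ∈ ⨆ i, F i, q • x ∈ ⨆ i, F i := fun q => by
      induction q using Polynomial.induction_on with
      | C a =>
        intro x hx
        rw [← algebraMap_eq, algebraMap_smul]
        exact Submodule.smul_mem _ _ hx
      | add p q hp hq =>
        intro x hx
        rw [add_smul]
        exact add_mem (hp x hx) (hq x hx)
      | monomial k a hk =>
        intro x hx
        obtain ⟨i, hi⟩ := (hmem x).1 hx
        rw [pow_succ, ← mul_assoc, mul_smul]
        exact hk _ ((hmem _).2 ⟨i + 1, hξF i hi⟩)
    refine eq_top_iff.2 fun m _ => ?_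
    have hm : m ∈ Submodule.span B[X] (s : Set M) := hs ▸ Submodule.mem_top
    induction hm using Submodule.span_induction with
    | mem x hx => exact (hmem x).2 ⟨0, hF0 ▸ Submodule.subset_span hx⟩
    | zero => exact zero_mem _
    | add x y _ _ hx hy => exact add_mem (hx trivial) (hy trivial)
    | smul q x _ hx => exact hq q x (hx trivial)
  -- Multiplication by `X ^ (i + 1)` makes `F (i + 1) / F i` a quotient of `W`.
  let ψ : ∀ i, W →ₗ[B] F (i + 1) ⧸ (F i).submoduleOf (F (i + 1)) := fun i =>
    ((F i).submoduleOf (F (i + 1))).mkQ ∘ₗ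
      (ξ ^ (i + 1)).restrict fun w hw => hWF (i + 1) (i + 1) le_rfl w hw
  have hψ : ∀ i, Function.Surjective (ψ i) := fun i x => by
    obtain ⟨⟨m, hm⟩, rfl⟩ := Submodule.mkQ_surjective _ x
    obtain ⟨_, ⟨w, hw, rfl⟩, m', hm', hmm⟩ := Submodule.mem_sup.1 (hFsucc i ▸ hm)
    refine ⟨⟨w, hw⟩, (Submodule.Quotient.eq _).2 ?_⟩
    change (ξ ^ (i + 1)) w - m ∈ F i
    rw [← hmm, sub_add_cancel_left]
    exact neg_mem hm'
  have hker : ∀ i (w : W), w ∈ LinearMap.ker (ψ i) ↔ (ξ ^ (i + 1)) (w : M) ∈ F i := fun i w =>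
    Submodule.Quotient.mk_eq_zero _
  have hmono : Monotone fun i => LinearMap.ker (ψ i) := monotone_nat_of_le_succ fun i w hw => by
    rw [hker] at hw ⊢
    rw [pow_succ', Module.End.mul_apply]
    exact hξF i hw
  obtain ⟨k, hk⟩ := monotone_stabilizes_iff_noetherian.2
    (isNoetherian_of_isNoetherianRing_of_finite B W) ⟨_, hmono⟩
  choose d hd hdE using fun i => h (W ⧸ LinearMap.ker (ψ i))
  obtain ⟨c, hc, hcE⟩ := h W
  refine ⟨c * ∏ i ∈ Finset.range (k + 1), d i,
    mul_ne_zero hc (Finset.prod_ne_zero_iff.2 fun i _ => hd i), fun E _ _ hE => ?_⟩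
  rw [map_mul, IsUnit.mul_iff, map_prod, IsUnit.prod_iff] at hE
  have hquot : ∀ i, TorOneVanish D E (W ⧸ LinearMap.ker (ψ i)) := fun i => by
    rcases le_total i k with hi | hi
    · exact hdE i E (hE.2 i (Finset.mem_range.2 (by lia)))
    · have : LinearMap.ker (ψ k) = LinearMap.ker (ψ i) := hk i hi
      rw [← this]
      exact hdE k E (hE.2 k (Finset.mem_range.2 (by lia)))
  have hall : ∀ i, TorOneVanish D E (F i) := fun i => by
    induction i with
    | zero =>
      rw [hF0]
      exact hcE E hE.1
    | succ i ih =>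
      have he := ((hquot i).of_equiv
        (((ψ i).quotKerEquivOfSurjective (hψ i)).symm.restrictScalars D))
      exact .extension ((isShortExact_inclusion (hF i.le_succ)).restrictScalars D) ih he
  refine .of_iSup (F := fun i => (F i).restrictScalars D)
    (fun i j hij => hF hij) ?_ hall
  rw [eq_top_iff]
  intro m _
  obtain ⟨i, hi⟩ := (Submodule.mem_iSup_of_directed F hF.directed_le).1
    (htop ▸ Submodule.mem_top : m ∈ ⨆ i, F i)
  exact Submodule.mem_iSup_of_mem i hi

theorem genericallyFlat_mvPolynomial [IsDomain D] [IsNoetherianRing D] (n : ℕ) :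
    GenericallyFlat D (MvPolynomial (Fin n) D) := by
  induction n with
  | zero => exact genericallyFlat_self.of_algEquiv (MvPolynomial.isEmptyAlgEquiv D (Fin 0)).symm
  | succ n ih => exact ih.polynomial.of_algEquiv (MvPolynomial.finSuccEquiv D n).symm

end

end GenericFlatness

/-! ### Coherence of polynomial rings over von Neumann regular rings -/

section Coherence

variable {m n : ℕ}

/-- The change of coefficients along `g` for vectors of polynomials. -/
noncomputable def mapVec {R R' : Type u} [CommRing R] [CommRing R'] (g : R →+* R') :
    (Fin m → MvPolynomial (Fin n) R) →ₛₗ[MvPolynomial.map (σ := Fin n) g]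
      (Fin m → MvPolynomial (Fin n) R') where
  toFun v j := MvPolynomial.map g (v j)
  map_add' _ _ := funext fun _ => map_add _ _ _
  map_smul' _ _ := funext fun _ => map_mul _ _ _

/-- The syzygies of a family of polynomials. -/
noncomputable def syzygies {R : Type u} [CommRing R] (f : Fin m → MvPolynomial (Fin n) R) :
    Submodule (MvPolynomial (Fin n) R) (Fin m → MvPolynomial (Fin n) R) :=
  LinearMap.ker (Fintype.linearCombination (MvPolynomial (Fin n) R) f)

theorem linearCombination_mapVec {R R' : Type u} [CommRing R] [CommRing R'] (g : R →+* R')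
    (f v : Fin m → MvPolynomial (Fin n) R) :
    Fintype.linearCombination (MvPolynomial (Fin n) R') (mapVec g f) (mapVec g v) =
      MvPolynomial.map g (Fintype.linearCombination (MvPolynomial (Fin n) R) f v) := by
  simp [Fintype.linearCombination_apply, mapVec]

/-- If the cokernel of `φ` has vanishing first Tor, the kernel of `φ` commutes with the base change,
up to a surjection. -/
theorem TorOneVanish.rTensor_exact {D B E : Type u} [CommRing D] [CommRing B] [CommRing E]
    [Algebra D B] [Algebra D E] {L M : Type u} [AddCommGroup L] [AddCommGroup M] [Module B L]
    [Module B M] [Module D L] [Module D M] [IsScalarTower D B L] [IsScalarTower D B M]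
    {φ : L →ₗ[B] M} (h : TorOneVanish D E (M ⧸ LinearMap.range φ)) :
    Function.Exact (((LinearMap.ker φ).subtype.restrictScalars D).rTensor E)
      ((φ.restrictScalars D).rTensor E) := by
  have h1 : IsShortExact (LinearMap.ker φ).subtype φ.rangeRestrict :=
    ⟨Subtype.val_injective, fun x => by simp [Subtype.ext_iff], φ.surjective_rangeRestrict⟩
  have h2 : IsShortExact (LinearMap.range φ).subtype (LinearMap.range φ).mkQ :=
    ⟨Subtype.val_injective, fun x => by simp, Submodule.mkQ_surjective _⟩
  have h1' := h1.restrictScalars D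
  have h3 : φ.restrictScalars D = (LinearMap.range φ).subtype.restrictScalars D ∘ₗ
    φ.rangeRestrict.restrictScalars D := rfl
  rw [h3, LinearMap.rTensor_comp]
  exact (_root_.rTensor_exact E h1'.exact h1'.surj).comp_injective _
    (h _ _ _ _ (h2.restrictScalars D)) (map_zero _)

theorem proj_rTensor_sum_single {D E V : Type u} [CommRing D] [CommRing E] [Algebra D E]
    [AddCommGroup V] [Module D V] (w : Fin m → V ⊗[D] E) (i : Fin m) :
    (LinearMap.proj i).rTensor E (∑ j, (LinearMap.single D (fun _ => V) j).rTensor E (w j)) =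
      w i := by
  rw [map_sum, Finset.sum_eq_single i]
  · rw [← LinearMap.rTensor_comp_apply, LinearMap.proj_comp_single_same, LinearMap.rTensor_id_apply]
  · intro j _ hj
    rw [← LinearMap.rTensor_comp_apply, LinearMap.proj_comp_single_ne _ _ _ _ hj.symm,
      LinearMap.rTensor_zero, LinearMap.zero_apply]
  · exact fun h => absurd (Finset.mem_univ i) h

/-- If the ideal generated by the family `f` over `D` has vanishing first Tor against `E`, then all
syzygies over `E` come from those over `D`. -/
theorem syzygies_mapVec_le {D E : Type u} [CommRing D] [CommRing E] [Algebra D E]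
    (f : Fin m → MvPolynomial (Fin n) D)
    (h : TorOneVanish D E (MvPolynomial (Fin n) D ⧸
      LinearMap.range (Fintype.linearCombination (MvPolynomial (Fin n) D) f))) :
    syzygies (mapVec (algebraMap D E) f) ≤
      Submodule.span _ (mapVec (algebraMap D E) '' (syzygies f : Set _)) := by
  intro v hv
  let φ := Fintype.linearCombination (MvPolynomial (Fin n) D) f
  let α : MvPolynomial (Fin n) D ⊗[D] E ≃ₗ[D] MvPolynomial (Fin n) E :=
    TensorProduct.comm D _ _ ≪≫ₗ
      (MvPolynomial.algebraTensorAlgEquiv D E).toLinearEquiv.restrictScalars D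
  have hα : ∀ p e, α (p ⊗ₜ e) = e • MvPolynomial.map (algebraMap D E) p := fun p e => by
    simp [α]
  let β (j : Fin m) : (Fin m → MvPolynomial (Fin n) D) ⊗[D] E →ₗ[D] MvPolynomial (Fin n) E :=
    α.toLinearMap ∘ₗ (LinearMap.proj j).rTensor E
  have hβ : ∀ j u e, β j (u ⊗ₜ e) = e • MvPolynomial.map (algebraMap D E) (u j) := fun j u e =>
    hα _ _
  have hex := h.rTensor_exact
  -- The element of the tensor product with components `v j`.
  let z := ∑ j, (LinearMap.single D (fun _ => MvPolynomial (Fin n) D) j).rTensor E (α.symm (v j))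
  have hz : ∀ i, β i z = v i := fun i => by
    change α ((LinearMap.proj i).rTensor E z) = _
    rw [proj_rTensor_sum_single, LinearEquiv.apply_symm_apply]
  have hβφ : ∀ z, α ((φ.restrictScalars D).rTensor E z) =
      ∑ j, β j z * MvPolynomial.map (algebraMap D E) (f j) := fun z => by
    induction z with
    | zero => simp
    | add z w hz hw => simp only [map_add, hz, hw, add_mul, Finset.sum_add_distrib]
    | tmul u e =>
      rw [LinearMap.rTensor_tmul, hα]
      simp only [hβ, LinearMap.restrictScalars_apply, φ, Fintype.linearCombination_apply, map_sum,
        smul_eq_mul, map_mul, Finset.smul_sum, smul_mul_assoc]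
  have hz0 : (φ.restrictScalars D).rTensor E z = 0 := by
    apply α.injective
    rw [hβφ, map_zero]
    simp only [hz]
    exact hv
  obtain ⟨y, hy⟩ := (hex z).1 hz0
  have hmem : ∀ y, (fun j => β j (((LinearMap.ker φ).subtype.restrictScalars D).rTensor E y)) ∈
      Submodule.span (MvPolynomial (Fin n) E)
        (mapVec (algebraMap D E) '' (syzygies f : Set (Fin m → MvPolynomial (Fin n) D))) :=
    fun y => by
      induction y with
      | zero =>
        simp only [map_zero]
        exact zero_mem _
      | add z w hz hw =>
        simp only [map_add]
        exact add_mem hz hw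
      | tmul k e =>
        have hk : k.1 ∈ syzygies f := k.2
        have := Submodule.smul_mem _ (MvPolynomial.C e) (Submodule.subset_span
          (R := MvPolynomial (Fin n) E) (Set.mem_image_of_mem (mapVec (algebraMap D E)) hk))
        convert this using 1
        funext j
        rw [LinearMap.rTensor_tmul, hβ, MvPolynomial.smul_eq_C_mul]
        rfl
  have := hmem y
  rw [hy] at this
  simpa only [hz] using this

/-- A polynomial vanishes over `A / (1 - a)` only if the idempotent `a` kills it. -/
theorem C_mul_eq_zero_of_map_mk {A : Type u} [CommRing A] {a : A} (ha : a * a = a)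
    {q : MvPolynomial (Fin n) A}
    (hq : MvPolynomial.map (Ideal.Quotient.mk (Ideal.span {1 - a})) q = 0) :
    MvPolynomial.C a * q = 0 := by
  ext i
  have h1 := congrArg (MvPolynomial.coeff i) hq
  rw [MvPolynomial.coeff_map, MvPolynomial.coeff_zero, Ideal.Quotient.eq_zero_iff_mem,
    Ideal.mem_span_singleton] at h1
  obtain ⟨b, hb⟩ := h1
  rw [MvPolynomial.coeff_C_mul, MvPolynomial.coeff_zero, hb]
  linear_combination (-b) * ha

/-- If the syzygies of `f` over the quotient `A / (1 - a)` by an idempotent are finitely generated,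
then so are the syzygies of `f` over `A`, up to multiplication by `a`. -/
theorem exists_fg_smul_mem {A : Type u} [CommRing A] {a : A} (ha : a * a = a)
    (f : Fin m → MvPolynomial (Fin n) A)
    (h : (syzygies (mapVec (Ideal.Quotient.mk (Ideal.span {1 - a})) f)).FG) :
    ∃ P : Submodule (MvPolynomial (Fin n) A) (Fin m → MvPolynomial (Fin n) A),
      P.FG ∧ P ≤ syzygies f ∧ ∀ v ∈ syzygies f, MvPolynomial.C (σ := Fin n) a • v ∈ P := by
  classical
  let μ := mapVec (m := m) (n := n) (Ideal.Quotient.mk (Ideal.span {1 - a}))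
  have hμ : Function.Surjective μ := fun w => by
    choose v hv using fun j => MvPolynomial.map_surjective _ Ideal.Quotient.mk_surjective (w j)
    exact ⟨v, funext hv⟩
  have : RingHomSurjective (MvPolynomial.map (σ := Fin n)
      (Ideal.Quotient.mk (Ideal.span {1 - a}))) :=
    ⟨MvPolynomial.map_surjective _ Ideal.Quotient.mk_surjective⟩
  have hkill : ∀ v, μ v = 0 → MvPolynomial.C (σ := Fin n) a • v = 0 := fun v hv =>
    funext fun j => C_mul_eq_zero_of_map_mk ha (congrFun hv j)
  obtain ⟨S, hS⟩ := h
  -- The generators are the lifts of the given ones, multiplied by `a`.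
  let σ := Function.surjInv hμ
  have hσ : ∀ w, μ (σ w) = w := Function.surjInv_eq hμ
  refine ⟨Submodule.span _ ((fun w => MvPolynomial.C (σ := Fin n) a • σ w) '' (S : Set _)),
    ⟨S.image fun w => MvPolynomial.C (σ := Fin n) a • σ w, by rw [Finset.coe_image]⟩, ?_, fun v hv => ?_⟩
  · rw [Submodule.span_le]
    rintro _ ⟨w, hw, rfl⟩
    have hw' : w ∈ syzygies (μ f) := hS ▸ Submodule.subset_span hw
    change Fintype.linearCombination _ f (MvPolynomial.C (σ := Fin n) a • σ w) = 0
    rw [map_smul]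
    refine C_mul_eq_zero_of_map_mk ha ?_
    rw [← linearCombination_mapVec]
    change Fintype.linearCombination _ (μ f) (μ (σ w)) = 0
    rw [hσ]
    exact hw'
  · have h1 : μ v ∈ syzygies (μ f) := by
      have hv' : Fintype.linearCombination (MvPolynomial (Fin n) A) f v = 0 := hv
      change Fintype.linearCombination _ (mapVec _ f) (mapVec _ v) = 0
      rw [linearCombination_mapVec, hv', map_zero]
    have h2 : (S : Set _) = μ '' (σ '' (S : Set _)) := by
      rw [← Set.image_comp]
      simp [hσ]
    rw [← hS, h2, ← Submodule.map_span] at h1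
    obtain ⟨u, hu, huv⟩ := h1
    have h3 : MvPolynomial.C (σ := Fin n) a • v = MvPolynomial.C (σ := Fin n) a • u := by
      rw [← sub_eq_zero, ← smul_sub]
      exact hkill _ (by rw [map_sub, huv, sub_self])
    rw [h3]
    have h4 := Submodule.smul_mem_pointwise_smul u (MvPolynomial.C a : MvPolynomial (Fin n) A) _ hu
    rw [Submodule.smul_span] at h4
    rw [← Set.image_smul, ← Set.image_comp] at h4
    exact h4

/-- On some neighbourhood of a prime `𝔪`, cut out by an idempotent `a`, a finitely generated ideal
contained in `𝔪` vanishes and a given element outside `𝔪` is invertible. -/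
theorem IsVonNeumannRegularRing.exists_idempotent_notMem {A : Type u} [CommRing A]
    (hA : IsVonNeumannRegularRing A) (𝔪 : Ideal A) [𝔪.IsPrime] {J : Ideal A} (hJ : J.FG)
    (hJ𝔪 : J ≤ 𝔪) {x : A} (hx : x ∉ 𝔪) :
    ∃ a ∉ 𝔪, a * a = a ∧ x ∣ a ∧ ∀ j ∈ J, a * j = 0 := by
  obtain ⟨e, he, h⟩ := hA.exists_unit_of_fg hJ
  obtain ⟨ε, hε, hxε, h'⟩ := hA.exists_idempotent x
  refine ⟨(1 - e) * ε, ?_, ?_, hxε.mul_left _, fun j hj => ?_⟩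
  · intro hmem
    rcases Ideal.IsPrime.mem_or_mem ‹_› hmem with h1 | h1
    · exact Ideal.IsPrime.ne_top ‹_› ((Ideal.eq_top_iff_one _).2
        (by simpa using add_mem h1 (hJ𝔪 he)))
    · exact hx (h' ▸ Ideal.mul_mem_right _ _ h1)
  · linear_combination (1 - e) ^ 2 * hε + ε * h e he
  · linear_combination (-ε) * h j hj

/-- Locally on the spectrum of `A`, the syzygies are finitely generated: near `𝔪`, the ring `A` is an
algebra over the domain `D = A₀ / (𝔪 ∩ A₀)` in which a given nonzero element of `D` is invertible, so
that generic flatness reduces the claim to syzygies over the Noetherian ring `D`. -/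
theorem IsVonNeumannRegularRing.exists_notMem_smul_mem {A A₀ : Type u} [CommRing A] [CommRing A₀]
    [IsNoetherianRing A₀] [Algebra A₀ A] (hA : IsVonNeumannRegularRing A)
    (f : Fin m → MvPolynomial (Fin n) A₀) (𝔪 : Ideal A) [𝔪.IsPrime] :
    ∃ a ∉ 𝔪, ∃ P : Submodule (MvPolynomial (Fin n) A) (Fin m → MvPolynomial (Fin n) A),
      P.FG ∧ P ≤ syzygies (mapVec (algebraMap A₀ A) f) ∧
        ∀ v ∈ syzygies (mapVec (algebraMap A₀ A) f), MvPolynomial.C (σ := Fin n) a • v ∈ P := by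
  let 𝔭 := 𝔪.comap (algebraMap A₀ A)
  let D := A₀ ⧸ 𝔭
  let fD := mapVec (Ideal.Quotient.mk 𝔭) f
  obtain ⟨d, hd, hdE⟩ := genericallyFlat_mvPolynomial (D := D) n (MvPolynomial (Fin n) D ⧸
    LinearMap.range (Fintype.linearCombination (MvPolynomial (Fin n) D) fD))
  obtain ⟨x, rfl⟩ := Ideal.Quotient.mk_surjective d
  have hx : algebraMap A₀ A x ∉ 𝔪 := fun h => hd (Ideal.Quotient.eq_zero_iff_mem.2 h)
  obtain ⟨a, ha𝔪, ha, ⟨y, hxa⟩, haJ⟩ := hA.exists_idempotent_notMem 𝔪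
    (Ideal.FG.map (IsNoetherian.noetherian 𝔭) (algebraMap A₀ A)) Ideal.map_comap_le hx
  refine ⟨a, ha𝔪, exists_fg_smul_mem ha _ ?_⟩
  let E := A ⧸ Ideal.span {1 - a}
  let : Algebra D E := (Ideal.Quotient.lift 𝔭 ((Ideal.Quotient.mk _).comp (algebraMap A₀ A))
    fun p hp => Ideal.Quotient.eq_zero_iff_mem.2 (Ideal.mem_span_singleton.2
      ⟨algebraMap A₀ A p, by linear_combination haJ _ (Ideal.mem_map_of_mem _ hp)⟩)).toAlgebra
  have hcomp : (algebraMap D E).comp (Ideal.Quotient.mk 𝔭) =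
      (Ideal.Quotient.mk (Ideal.span {1 - a})).comp (algebraMap A₀ A) := RingHom.ext fun _ => rfl
  have hunit : IsUnit (algebraMap D E (Ideal.Quotient.mk 𝔭 x)) := by
    refine IsUnit.of_mul_eq_one (Ideal.Quotient.mk _ y) ?_
    change Ideal.Quotient.mk (Ideal.span {1 - a}) (algebraMap A₀ A x) * Ideal.Quotient.mk _ y = 1
    rw [← map_mul, ← hxa, eq_comm, ← map_one (Ideal.Quotient.mk (Ideal.span {1 - a})),
      Ideal.Quotient.eq]
    exact Ideal.mem_span_singleton_self _
  have hf : mapVec (Ideal.Quotient.mk (Ideal.span {1 - a})) (mapVec (algebraMap A₀ A) f) =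
      mapVec (algebraMap D E) fD := funext fun j => by
    change MvPolynomial.map _ (MvPolynomial.map _ _) = MvPolynomial.map _ (MvPolynomial.map _ _)
    rw [MvPolynomial.map_map, MvPolynomial.map_map, hcomp]
  rw [hf]
  obtain ⟨S, hS⟩ := IsNoetherian.noetherian (syzygies fD)
  classical
  refine ⟨S.image (mapVec (algebraMap D E)), le_antisymm ?_ ?_⟩
  · rw [Submodule.span_le, Finset.coe_image]
    rintro _ ⟨v, hv, rfl⟩
    have hv' : Fintype.linearCombination (MvPolynomial (Fin n) D) fD v = 0 := by
      have : v ∈ syzygies fD := hS ▸ Submodule.subset_span hv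
      exact this
    change Fintype.linearCombination _ (mapVec _ fD) (mapVec _ v) = 0
    rw [linearCombination_mapVec, hv', map_zero]
  · refine (syzygies_mapVec_le fD (hdE E hunit)).trans (Submodule.span_le.2 ?_)
    rw [← hS, Finset.coe_image]
    exact Submodule.image_span_subset_span _ _

theorem IsVonNeumannRegularRing.fg_syzygies {A A₀ : Type u} [CommRing A] [CommRing A₀]
    [IsNoetherianRing A₀] [Algebra A₀ A] (hA : IsVonNeumannRegularRing A)
    (f : Fin m → MvPolynomial (Fin n) A₀) : (syzygies (mapVec (algebraMap A₀ A) f)).FG := by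
  let N := syzygies (mapVec (algebraMap A₀ A) f)
  -- The elements that multiply `N` into a finitely generated submodule form an ideal.
  let J : Ideal A :=
    { carrier := {a | ∃ P : Submodule (MvPolynomial (Fin n) A) (Fin m → MvPolynomial (Fin n) A),
        P.FG ∧ P ≤ N ∧ ∀ v ∈ N, MvPolynomial.C (σ := Fin n) a • v ∈ P}
      zero_mem' := ⟨⊥, Submodule.fg_bot, bot_le, fun v _ => by
        rw [map_zero, zero_smul]; exact zero_mem _⟩
      add_mem' := by
        rintro a b ⟨P, hP, hPN, haP⟩ ⟨Q, hQ, hQN, hbQ⟩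
        refine ⟨P ⊔ Q, hP.sup hQ, sup_le hPN hQN, fun v hv => ?_⟩
        rw [map_add, add_smul]
        exact Submodule.add_mem_sup (haP v hv) (hbQ v hv)
      smul_mem' := by
        rintro c a ⟨P, hP, hPN, haP⟩
        refine ⟨P, hP, hPN, fun v hv => ?_⟩
        rw [smul_eq_mul, map_mul, mul_smul]
        exact P.smul_mem _ (haP v hv) }
  have hJ : J = ⊤ := by
    by_contra hne
    obtain ⟨𝔪, h𝔪, hJ𝔪⟩ := Ideal.exists_le_maximal J hne
    obtain ⟨a, ha, hP⟩ := hA.exists_notMem_smul_mem f 𝔪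
    exact ha (hJ𝔪 hP)
  obtain ⟨P, hP, hPN, h1⟩ : (1 : A) ∈ J := hJ ▸ Submodule.mem_top
  have : P = N := le_antisymm hPN fun v hv => by simpa using h1 v hv
  rwa [this] at hP

/-- Finitely many polynomials have their coefficients in a finitely generated subring, which is
Noetherian. -/
theorem exists_isNoetherianRing_coeffs {A : Type u} [CommRing A]
    (f : Fin m → MvPolynomial (Fin n) A) :
    ∃ (A₀ : Type u) (_ : CommRing A₀) (_ : Algebra A₀ A), IsNoetherianRing A₀ ∧
      ∃ g : Fin m → MvPolynomial (Fin n) A₀, mapVec (algebraMap A₀ A) g = f := by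
  classical
  let s : Finset A := Finset.univ.biUnion fun j => (f j).coeffs
  let A₀ := Algebra.adjoin ℤ (s : Set A)
  have hfin : Algebra.FiniteType ℤ A₀ := A₀.fg_iff_finiteType.1 ⟨s, rfl⟩
  have hg : ∀ j, ∃ p, MvPolynomial.map (algebraMap A₀ A) p = f j := fun j => by
    refine MvPolynomial.mem_range_map_iff_coeffs_subset.2 fun c hc => ?_
    exact ⟨⟨c, Algebra.subset_adjoin (Finset.mem_biUnion.2 ⟨j, Finset.mem_univ j, hc⟩)⟩, rfl⟩
  choose g hg using hg
  exact ⟨A₀, inferInstance, inferInstance, Algebra.FiniteType.isNoetherianRing ℤ A₀, g, funext hg⟩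

/-- Polynomial rings over a von Neumann regular ring are coherent. -/
theorem IsVonNeumannRegularRing.isCoherentRing_mvPolynomial {A : Type u} [CommRing A]
    (hA : IsVonNeumannRegularRing A) (n : ℕ) : IsCoherentRing (MvPolynomial (Fin n) A) := by
  intro I hI
  obtain ⟨m, f, rfl⟩ := Submodule.fg_iff_exists_fin_generating_family.1 hI
  obtain ⟨A₀, _, _, _, g, rfl⟩ := exists_isNoetherianRing_coeffs f
  have hfg := hA.fg_syzygies g
  rw [← Fintype.range_linearCombination]
  refine Module.finitePresentation_of_surjective _ (LinearMap.surjective_rangeRestrict _) ?_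
  rwa [LinearMap.ker_rangeRestrict]

end Coherence

end SGRing

theorem mainTheorem9 :
    (∀ (K : Type u) [Field K] (n : ℕ) (S : Type u) [CommRing S],
      SGRing.IsCoherentRing S → SGRing.wdim S = (n : ℕ∞) → (n : WithBot ℕ∞) < SGRing.gldim S →
        (SGRing.IsWSG (SGRing.TruncatedPoly K 2 × S) n ∧
          ¬ SGRing.IsSG (SGRing.TruncatedPoly K 2 × S) n) ∧
        (SGRing.wGgldim (SGRing.TruncatedPoly K 3 × S) = (n : ℕ∞) ∧
          ¬ SGRing.IsWSG (SGRing.TruncatedPoly K 3 × S) n)) ∧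
    (∀ (S₀ : Type u) [CommRing S₀],
      SGRing.IsVonNeumannRegularRing S₀ → ¬ IsNoetherianRing S₀ → ∀ n : ℕ,
        SGRing.IsCoherentRing (MvPolynomial (Fin n) S₀) ∧
        SGRing.wdim (MvPolynomial (Fin n) S₀) = (n : ℕ∞) ∧
        (n : WithBot ℕ∞) < SGRing.gldim (MvPolynomial (Fin n) S₀)) := by
  refine ⟨fun K _ n S _ _ hw hg => ⟨⟨SGRing.isWSG_truncatedPoly_two_prod K S hw.le,
    SGRing.not_isSG_truncatedPoly_two_prod K S hw.le hg⟩,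
    SGRing.wGgldim_truncatedPoly_three_prod K S hw,
    SGRing.not_isWSG_truncatedPoly_three_prod K S n⟩, fun S₀ _ hS₀ hN n => ?_⟩
  have : Nontrivial S₀ := not_subsingleton_iff_nontrivial.1 fun _ => hN inferInstance
  exact ⟨hS₀.isCoherentRing_mvPolynomial n, hS₀.wdim_mvPolynomial n,
    SGRing.lt_gldim_mvPolynomial hN n⟩
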